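/- Let $d\in\{2,3\}$, let $\Omega\subset\mathbb R^d$ be a bounded convex polygonal (polyhedral) domain, let $A\in\mathbb R^{d\times d}$ be a constant symmetric positive definite matrix, and let $m\ge 1$, $C_\sigma>0$. *Meshes.* $\mathcal T_h$ denotes a conforming simplicial triangulation of $\Omega$ with mesh size $h=\max_K h_K$, $h_K=\operatorname{diam}K$, which is quasi-uniform: $h\le C_\sigma\rho$, where $\rho=\min_K\rho_K$ and $\rho_K$ is the inradius of $K$. $\mathcal E_h$ is the set of all (interior and boundary) $(d-1)$-dimensional faces, $h_e=\operatorname{diam}e$, $\boldsymbol x_K$ is the barycenter of $K$, and $n_e=\#\mathcal T_h$. *Patches.* Given a threshold $N\le n_e$, put $S_0(K)=\{K\}$, let $S_t(K)$ consist of all elements whose closure meets the closure of an element of $S_{t-1}(K)$, and let $S(K)=S_t(K)$ for the first $t$ with $\#S_t(K)\ge N$. Let $I(K)=\{\boldsymbol x_{K'}:K'\in S(K)\}$. With $\mathbb P_m$ the polynomials of total degree at most $m$, assume that for every $K$ every $p\in\mathbb P_m$ that vanishes on $I(K)$ vanishes on $S(K)$. Set $$\Lambda_m=\max_{K\in\mathcal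 T_h}\ \max_{0\ne p\in\mathbb P_m}\frac{\max_{\boldsymbol x\in S(K)}|p(\boldsymbol x)|}{\max_{\boldsymbol x\in I(K)}|p(\boldsymbol x)|}.$$ *Reconstruction.* For a piecewise constant $v_h$, $\mathcal R^m_Kv_h$ is the minimizer of $\sum_{\boldsymbol x\in I(K)}(p(\boldsymbol x)-v_h(\boldsymbol x))^2$ over $p\in\mathbb P_m$ subject to $p(\boldsymbol x_K)=v_h(\boldsymbol x_K)$, and $(\mathcal R^mv_h)|_K=(\mathcal R^m_Kv_h)|_K$. Let $\lambda_j=\mathcal R^me_j$, $1\le j\le n_e$, where $e_j$ is the indicator function of the $j$-th element. *Matrices.* For $\theta=\pm1$ and a penalty parameter $\mu$ let $$a_{h,\theta}(u,v)=\sum_{K}\int_KA\nabla u\cdot\nabla v\,dx-\sum_{e\in\mathcal E_h}\int_e\{A\nabla u\}\cdot[v]\,ds+\theta\sum_{e\in\mathcal E_h}\int_e\{A\nabla v\}\cdot[u]\,ds+\sum_{e\in\mathcal E_h}\int_e\mu h_e^{-1}[u]\cdot[v]\,ds,$$ where $[v]=v^+\mathbf n^++v^-\mathbf n^-$ and $\{\boldsymbol\tau\}=\frac12(\boldsymbol\tau^++\boldsymbol\tau^-)$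 on interior faces, and $[v]=v\mathbf n$ and $\{\boldsymbol\tau\}=\boldsymbol\tau$ on boundary faces ($\mathbf n$, $\mathbf n^\pm$ being unit outward normals). Let $A_{m,\theta}=(a_{h,\theta}(\lambda_i,\lambda_j))_{i,j}$ and $M_m=((\lambda_i,\lambda_j)_{L^2(\Omega)})_{i,j}$, and let $\kappa(B)=\|B\|_2\|B^{-1}\|_2$. **Theorem.** In the following, "all meshes" means all triangulations $\mathcal T_h$ of $\Omega$ as above, and the constants are independent of the mesh (in particular of $h$). 1. For every $N$ there are constants $c,C>0$, depending only on $d,\Omega,m,C_\sigma,N$, such that for all meshes $$c\,h^d\,\mathbf v^T\mathbf v\le\mathbf v^TM_m\mathbf v\le C\Lambda_m^2h^d\,\mathbf v^T\mathbf v\qquad\text{for all }\mathbf v\in\mathbb R^{n_e}.$$ 2. ($\theta=-1$.) There is $\mu_0>0$, depending only on $d,\Omega,A,m,C_\sigma$, such that for every $\mu\ge\mu_0$ and every $N$ there is a constant $C>0$ such that for all meshes $A_{m,-1}$ is invertible and $$\kappa(A_{m,-1})\le C\Lambda_m^2h^{-2}.$$ 3. ($\theta=1$.) For every $\mu>0$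 and every $N$ there is a constant $C>0$ such that for all meshes $A_{m,1}$ is invertible and $$\kappa(A_{m,1})\le C\Lambda_m^2h^{-2}.$$ In 2 and 3, $C$ depends only on $d,\Omega,A,m,C_\sigma,\mu,N$. -/

import Mathlib

open MeasureTheory Matrix

noncomputable section

namespace RDA

/-- A bounded convex polygonal (polyhedral) domain of `ℝ^d`: a nonempty open convex set whose
closure is the convex hull of finitely many points. -/
structure IsConvexPolytopalDomain {d : ℕ} (Ω : Set (EuclideanSpace ℝ (Fin d))) : Prop where
  isOpen : IsOpen Ω
  convex : Convex ℝ Ω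
  nonempty : Ω.Nonempty
  polytopal : ∃ V : Finset (EuclideanSpace ℝ (Fin d)),
    closure Ω = convexHull ℝ (V : Set (EuclideanSpace ℝ (Fin d)))

/-- A (conforming, simplicial) triangulation of `Ω`: a finite pure `d`-dimensional simplicial
complex with underlying space `closure Ω`. Simplices are represented by their vertex sets. -/
structure Triangulation {d : ℕ} (Ω : Set (EuclideanSpace ℝ (Fin d))) where
  complex : Geometry.SimplicialComplex ℝ (EuclideanSpace ℝ (Fin d))
  finite_faces : complex.faces.Finite
  space_eq : complex.space = closure Ω
  pure : ∀ s ∈ complex.faces, ∃ t ∈ complex.faces, s ⊆ t ∧ t.card = d + 1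

/-- The closed simplex with the given vertices. -/
def simplex {d : ℕ} (s : Finset (EuclideanSpace ℝ (Fin d))) : Set (EuclideanSpace ℝ (Fin d)) :=
  convexHull ℝ (s : Set (EuclideanSpace ℝ (Fin d)))

/-- The barycenter `x_K`. -/
def barycenter {d : ℕ} (K : Finset (EuclideanSpace ℝ (Fin d))) : EuclideanSpace ℝ (Fin d) :=
  (K.card : ℝ)⁻¹ • ∑ x ∈ K, x

/-- The inradius `ρ_K`: the radius of the largest closed ball contained in the simplex. -/
def inradius {d : ℕ} (K : Finset (EuclideanSpace ℝ (Fin d))) : ℝ :=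
  sSup {r : ℝ | 0 ≤ r ∧ ∃ x, Metric.closedBall x r ⊆ simplex K}

/-- The unit outward normal of the element `K` on its facet `e`: the vector from the barycenter of
`K` to the barycenter of `e`, projected orthogonally to the directions of `e`, and normalized. -/
def outwardNormal {d : ℕ} (K e : Finset (EuclideanSpace ℝ (Fin d))) : EuclideanSpace ℝ (Fin d) :=
  let w := (vectorSpan ℝ (e : Set (EuclideanSpace ℝ (Fin d))))ᗮ.starProjection
    (barycenter e - barycenter K)
  ‖w‖⁻¹ • w

/-- The value at `x` of a polynomial in the `d` coordinates. -/
def evalAt {d : ℕ} (p : MvPolynomial (Fin d) ℝ) (x : EuclideanSpace ℝ (Fin d)) : ℝ :=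
  MvPolynomial.eval (fun i => x i) p

/-- The gradient at `x` of a polynomial in the `d` coordinates. -/
def gradAt {d : ℕ} (p : MvPolynomial (Fin d) ℝ) (x : EuclideanSpace ℝ (Fin d)) :
    EuclideanSpace ℝ (Fin d) :=
  WithLp.toLp 2 fun i => evalAt (MvPolynomial.pderiv i p) x

/-- The space `ℙ_m` of polynomials in `d` variables of total degree at most `m`. -/
abbrev PolySpace (d m : ℕ) : Submodule ℝ (MvPolynomial (Fin d) ℝ) :=
  MvPolynomial.restrictTotalDegree (Fin d) ℝ m

/-- The spectral condition number `κ(A) = ‖A‖₂ ‖A⁻¹‖₂` of a square matrix (meaningful when `A` is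
invertible). -/
def condNumber {ι : Type*} [Fintype ι] [DecidableEq ι] (A : Matrix ι ι ℝ) : ℝ :=
  ‖Matrix.toEuclideanCLM (𝕜 := ℝ) A‖ * ‖Matrix.toEuclideanCLM (𝕜 := ℝ) A⁻¹‖

namespace Triangulation

variable {d : ℕ} {Ω : Set (EuclideanSpace ℝ (Fin d))} (T : Triangulation Ω)

open scoped Classical in
/-- The elements `K ∈ 𝒯_h`: the `d`-dimensional simplices. -/
def elements : Finset (Finset (EuclideanSpace ℝ (Fin d))) :=
  T.finite_faces.toFinset.filter fun s => s.card = d + 1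

open scoped Classical in
/-- The set `ℰ_h` of all faces, interior and boundary: the `(d-1)`-dimensional simplices. -/
def meshFaces : Finset (Finset (EuclideanSpace ℝ (Fin d))) :=
  T.finite_faces.toFinset.filter fun s => s.card = d

/-- The elements as an index type. -/
abbrev Elem : Type := {K : Finset (EuclideanSpace ℝ (Fin d)) // K ∈ T.elements}

instance : DecidableEq T.Elem := Classical.decEq _

/-- The mesh size `h = max_K h_K`. -/
def meshSize : ℝ := ⨆ K : T.Elem, Metric.diam (simplex K.1)

/-- Quasi-uniformity with constant `Cσ`: `h ≤ Cσ ρ` with `ρ = min_K ρ_K`. -/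
def QuasiUniform (Cσ : ℝ) : Prop := ∀ K : T.Elem, T.meshSize ≤ Cσ * inradius K.1

open scoped Classical in
/-- `Δ(K)`: the elements whose closure meets the closure of `K`. -/
def neighbours (K : T.Elem) : Finset T.Elem :=
  Finset.univ.filter fun K' => (simplex K.1 ∩ simplex K'.1).Nonempty

/-- The recursive layers `S_t(K)`. -/
def layer (K : T.Elem) : ℕ → Finset T.Elem
  | 0 => {K}
  | t + 1 => (layer K t).biUnion T.neighbours

/-- The element patch `S(K)` for the threshold `N = #S`: the layer `S_t(K)` with the smallest `t`
such that `#S_t(K) ≥ N`. -/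
def patch (N : ℕ) (K : T.Elem) : Finset T.Elem :=
  T.layer K (sInf {t : ℕ | N ≤ (T.layer K t).card})

/-- The closed region covered by the patch `S(K)`. -/
def patchRegion (N : ℕ) (K : T.Elem) : Set (EuclideanSpace ℝ (Fin d)) :=
  ⋃ K' ∈ T.patch N K, simplex K'.1

/-- The unisolvence assumption: a polynomial in `ℙ_m` that vanishes at all the collocation points
`I(K)` (the barycenters of the elements of `S(K)`) vanishes on `S(K)`. -/
def Unisolvent (m N : ℕ) : Prop :=
  ∀ K : T.Elem, ∀ p ∈ PolySpace d m,
    (∀ K' ∈ T.patch N K, evalAt p (barycenter K'.1) = 0) → ∀ x ∈ T.patchRegion N K, evalAt p x = 0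

/-- `Λ(m, K) = max_{p ∈ ℙ_m} (max_{S(K)} |p|) / (max_{I(K)} |p|)`. -/
def localLebesgue (m N : ℕ) (K : T.Elem) : ℝ :=
  ⨆ p : PolySpace d m,
    (⨆ x : T.patchRegion N K, |evalAt p.1 x.1|) /
      (⨆ K' : T.patch N K, |evalAt p.1 (barycenter K'.1.1)|)

/-- `Λ_m = max_K Λ(m, K)`. -/
def lebesgueConst (m N : ℕ) : ℝ := ⨆ K : T.Elem, T.localLebesgue m N K

/-- The constrained least squares functional `∑_{x ∈ I(K)} (p(x) - v_h(x))²`, where the piecewise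
constant function `v_h ∈ U_h^0` is given by its values on the elements. -/
def lsqFunctional (N : ℕ) (K : T.Elem) (v : T.Elem → ℝ) (p : MvPolynomial (Fin d) ℝ) : ℝ :=
  ∑ K' ∈ T.patch N K, (evalAt p (barycenter K'.1) - v K') ^ 2

/-- `p` solves the local least squares problem on `S(K)`, constrained at the barycenter `x_K`. -/
def IsLocalFit (m N : ℕ) (K : T.Elem) (v : T.Elem → ℝ) (p : MvPolynomial (Fin d) ℝ) : Prop :=
  p ∈ PolySpace d m ∧ evalAt p (barycenter K.1) = v K ∧
    ∀ q ∈ PolySpace d m, evalAt q (barycenter K.1) = v K →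
      T.lsqFunctional N K v p ≤ T.lsqFunctional N K v q

open scoped Classical in
/-- The reconstruction `ℛ^m v_h`, given on each element `K` by the polynomial `ℛ_K^m v_h`, the
solution of the local problem (which exists always, and is unique under `Unisolvent`). -/
def reconstruct (m N : ℕ) (v : T.Elem → ℝ) (K : T.Elem) : MvPolynomial (Fin d) ℝ :=
  if h : ∃ p, T.IsLocalFit m N K v p then h.choose else 0

/-- The basis functions `λ_K = ℛ^m e_K` of `U_h^m`, where `e_K` is the indicator of `K`. -/
def basisFun (m N : ℕ) (K : T.Elem) : T.Elem → MvPolynomial (Fin d) ℝ :=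
  T.reconstruct m N (Pi.single K 1)

open scoped Classical in
/-- The elements having `e` as a facet: two for an interior face, one for a boundary face. -/
def adjacent (e : Finset (EuclideanSpace ℝ (Fin d))) : Finset T.Elem :=
  Finset.univ.filter fun K => e ⊆ K.1

/-- The jump of a piecewise polynomial on the face `e`: `v⁺ n⁺ + v⁻ n⁻` on an interior face and
`v n` on a boundary face. -/
def jump (u : T.Elem → MvPolynomial (Fin d) ℝ) (e : Finset (EuclideanSpace ℝ (Fin d)))
    (x : EuclideanSpace ℝ (Fin d)) : EuclideanSpace ℝ (Fin d) :=
  ∑ K ∈ T.adjacent e, evalAt (u K) x • outwardNormal K.1 e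

/-- The average of the flux `A∇u` on the face `e`: the mean of the two one-sided values on an
interior face, the one-sided value on a boundary face. -/
def fluxAverage (A : Matrix (Fin d) (Fin d) ℝ) (u : T.Elem → MvPolynomial (Fin d) ℝ)
    (e : Finset (EuclideanSpace ℝ (Fin d))) (x : EuclideanSpace ℝ (Fin d)) :
    EuclideanSpace ℝ (Fin d) :=
  ((T.adjacent e).card : ℝ)⁻¹ • ∑ K ∈ T.adjacent e, Matrix.toEuclideanCLM (𝕜 := ℝ) A (gradAt (u K) x)

/-- The interior penalty bilinear form `a_{h,θ}(u, v)`; the face integrals are with respect to the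
`(d-1)`-dimensional surface measure. -/
def ipForm (A : Matrix (Fin d) (Fin d) ℝ) (μ θ : ℝ) (u v : T.Elem → MvPolynomial (Fin d) ℝ) : ℝ :=
  (∑ K : T.Elem, ∫ x in simplex K.1,
      inner ℝ (Matrix.toEuclideanCLM (𝕜 := ℝ) A (gradAt (u K) x)) (gradAt (v K) x))
    - (∑ e ∈ T.meshFaces, ∫ x in simplex e,
        inner ℝ (T.fluxAverage A u e x) (T.jump v e x) ∂μHE[d - 1])
    + θ * (∑ e ∈ T.meshFaces, ∫ x in simplex e,
        inner ℝ (T.fluxAverage A v e x) (T.jump u e x) ∂μHE[d - 1])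
    + ∑ e ∈ T.meshFaces, ∫ x in simplex e,
        μ * (Metric.diam (simplex e))⁻¹ * inner ℝ (T.jump u e x) (T.jump v e x) ∂μHE[d - 1]

/-- The stiffness matrix `A_{m,θ} = (a_{h,θ}(λ_i, λ_j))`. -/
def stiffnessMatrix (m N : ℕ) (A : Matrix (Fin d) (Fin d) ℝ) (μ θ : ℝ) :
    Matrix T.Elem T.Elem ℝ :=
  Matrix.of fun i j => T.ipForm A μ θ (T.basisFun m N i) (T.basisFun m N j)

/-- The mass matrix `M_m = ((λ_i, λ_j)_{L²(Ω)})`. -/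
def massMatrix (m N : ℕ) : Matrix T.Elem T.Elem ℝ :=
  Matrix.of fun i j => ∑ K : T.Elem, ∫ x in simplex K.1,
    evalAt (T.basisFun m N i K) x * evalAt (T.basisFun m N j K) x

end Triangulation

end RDA

end

/-! Write u_v = ∑ v_i λ_i (`combine`). The forms defined by the two matrices are the L² product and
a_{h,θ} evaluated on such functions (`dotProduct_massMatrix`, `dotProduct_stiffnessMatrix`), so the
theorem follows from estimates for broken polynomials together with a comparison of the L² norm of
u_v with the Euclidean norm of v.

Mass matrix. The constraint gives u_v(x_K) = v_K on K, and an inverse estimate bounds this value by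
h^{-d/2} times the L² norm on K; summing gives the lower bound (`exists_le_l2Sq_combine`). For the
upper bound, comparing the least squares fit with a constant bounds each λ_i at the collocation
points by the patch size, and λ_i vanishes at the points of every patch not containing i. The
Lebesgue constant extends this control to all of K (`QuasiUniform.abs_evalAt_le`), and a patch has
boundedly many elements and an element lies in boundedly many patches (`exists_l2Sq_combine_le`).

Stiffness matrix. If B(v,v) ≥ β|v|² and B(w,v) ≤ b(|w|²+|v|²), the condition number is at most 2b/β
(`isUnit_and_condNumber_le`). Inverse estimates give |a_{h,θ}(u,v)| ≤ C h^{-2}(‖u‖²+‖v‖²)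
(`exists_abs_ipForm_le`). For θ = 1 the flux terms cancel on the diagonal; for θ = -1 a large
penalty absorbs them. Either way the form controls the broken energy, which controls the L² norm by
a discrete Poincaré inequality (`exists_poincare`). The powers h^d from the mass bounds cancel,
leaving Λ² h^{-2}.

Poincaré. Apply the divergence theorem in the first coordinate direction to x₀u² on each element:
the integral of u² equals a boundary term minus that of 2x₀u∂₀u. On an interior face the two normals
are opposite (`outwardNormal_eq_neg`), so only x₀(u²-u'²) = x₀(u-u')(u+u') remains, a jump times a
trace. Young's inequality and an inverse trace estimate absorb the traces into the left side. The
boundary terms are written as integrals over the projection of the facet, so the surface measure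
enters only through the fact that a 1-Lipschitz projection does not increase it.

All inverse estimates come from equivalence of norms on a finite-dimensional polynomial space on one
reference ball, since an element contains a ball of radius comparable to h and lies in a concentric
ball of radius h. -/

namespace RDA

/-! ### Evaluation, differentiation and rescaling of polynomials. -/

section Polynomial

variable {d : ℕ}

@[simp] lemma evalAt_add (p q : MvPolynomial (Fin d) ℝ) (x : EuclideanSpace ℝ (Fin d)) :
    evalAt (p + q) x = evalAt p x + evalAt q x := by simp [evalAt]

@[simp] lemma evalAt_sub (p q : MvPolynomial (Fin d) ℝ) (x : EuclideanSpace ℝ (Fin d)) :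
    evalAt (p - q) x = evalAt p x - evalAt q x := by simp [evalAt]

@[simp] lemma evalAt_mul (p q : MvPolynomial (Fin d) ℝ) (x : EuclideanSpace ℝ (Fin d)) :
    evalAt (p * q) x = evalAt p x * evalAt q x := by simp [evalAt]

@[simp] lemma evalAt_pow (p : MvPolynomial (Fin d) ℝ) (k : ℕ) (x : EuclideanSpace ℝ (Fin d)) :
    evalAt (p ^ k) x = evalAt p x ^ k := by simp [evalAt]

@[simp] lemma evalAt_smul (c : ℝ) (p : MvPolynomial (Fin d) ℝ) (x : EuclideanSpace ℝ (Fin d)) :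
    evalAt (c • p) x = c * evalAt p x := by simp [evalAt]

@[simp] lemma evalAt_zero (x : EuclideanSpace ℝ (Fin d)) : evalAt 0 x = 0 := by simp [evalAt]

@[simp] lemma evalAt_C (c : ℝ) (x : EuclideanSpace ℝ (Fin d)) :
    evalAt (MvPolynomial.C c) x = c := by simp [evalAt]

@[simp] lemma evalAt_X (i : Fin d) (x : EuclideanSpace ℝ (Fin d)) :
    evalAt (MvPolynomial.X i) x = x i := by simp [evalAt]

lemma evalAt_sum {ι : Type*} (s : Finset ι) (f : ι → MvPolynomial (Fin d) ℝ)
    (x : EuclideanSpace ℝ (Fin d)) : evalAt (∑ i ∈ s, f i) x = ∑ i ∈ s, evalAt (f i) x := by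
  simp [evalAt]

lemma gradAt_apply (p : MvPolynomial (Fin d) ℝ) (x : EuclideanSpace ℝ (Fin d)) (i : Fin d) :
    gradAt p x i = evalAt (MvPolynomial.pderiv i p) x := rfl

lemma gradAt_add (p q : MvPolynomial (Fin d) ℝ) (x : EuclideanSpace ℝ (Fin d)) :
    gradAt (p + q) x = gradAt p x + gradAt q x := by
  ext i; simp [gradAt_apply]

lemma gradAt_smul (c : ℝ) (p : MvPolynomial (Fin d) ℝ) (x : EuclideanSpace ℝ (Fin d)) :
    gradAt (c • p) x = c • gradAt p x := by
  ext i; simp [gradAt_apply]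

lemma continuous_evalAt (p : MvPolynomial (Fin d) ℝ) : Continuous (evalAt p) := by
  unfold evalAt
  exact (MvPolynomial.continuous_eval p).comp (by fun_prop)

lemma continuous_gradAt (p : MvPolynomial (Fin d) ℝ) : Continuous (gradAt p) := by
  unfold gradAt
  have := fun i => continuous_evalAt (MvPolynomial.pderiv i p)
  fun_prop

lemma hasDerivAt_evalAt_line (p : MvPolynomial (Fin d) ℝ) (i : Fin d)
    (x : EuclideanSpace ℝ (Fin d)) (t : ℝ) :
    HasDerivAt (fun t => evalAt p (x + t • EuclideanSpace.single i (1 : ℝ)))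
      (evalAt (MvPolynomial.pderiv i p) (x + t • EuclideanSpace.single i (1 : ℝ))) t := by
  induction p using MvPolynomial.induction_on with
  | C a => simpa using hasDerivAt_const t a
  | add p q hp hq => simpa using HasDerivAt.fun_add hp hq
  | mul_X p j hp =>
    have hX : HasDerivAt (fun t : ℝ => (x + t • EuclideanSpace.single i (1 : ℝ)) j)
        (if i = j then 1 else 0) t := by
      by_cases h : i = j
      · subst h; simpa using (hasDerivAt_id t).const_add (x i)
      · simpa [h, Ne.symm h, PiLp.single_apply] using hasDerivAt_const t (x j)
    have := HasDerivAt.fun_mul hp hX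
    have h2 : evalAt ((Pi.single i 1 : Fin d → MvPolynomial (Fin d) ℝ) j)
        (x + t • EuclideanSpace.single i (1 : ℝ)) = if i = j then 1 else 0 := by
      by_cases h : i = j
      · subst h; simp [evalAt]
      · simp [h]
    simpa only [evalAt_mul, evalAt_X, MvPolynomial.pderiv_mul, evalAt_add, MvPolynomial.pderiv_X,
      h2] using this

lemma totalDegree_pderiv_le (i : Fin d) (p : MvPolynomial (Fin d) ℝ) :
    (MvPolynomial.pderiv i p).totalDegree ≤ p.totalDegree := by
  conv_lhs => rw [p.as_sum, map_sum]
  refine MvPolynomial.totalDegree_finsetSum_le fun s hs => ?_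
  rw [MvPolynomial.pderiv_monomial]
  refine (MvPolynomial.totalDegree_monomial_le _ _).trans
    (le_trans ?_ (MvPolynomial.le_totalDegree hs))
  rw [Finsupp.sum_fintype _ _ (fun _ => rfl), Finsupp.sum_fintype _ _ (fun _ => rfl)]
  exact Finset.sum_le_sum fun j _ => by simp

lemma pderiv_mem_polySpace {m : ℕ} {p : MvPolynomial (Fin d) ℝ} (hp : p ∈ PolySpace d m)
    (i : Fin d) : MvPolynomial.pderiv i p ∈ PolySpace d m := by
  rw [MvPolynomial.mem_restrictTotalDegree] at *
  exact (totalDegree_pderiv_le i p).trans hp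

lemma C_mem_polySpace (m : ℕ) (c : ℝ) : MvPolynomial.C c ∈ PolySpace d m := by
  rw [MvPolynomial.mem_restrictTotalDegree]; simp

/-- The polynomial `y ↦ p (z + h y)`. -/
noncomputable def rescale (z : EuclideanSpace ℝ (Fin d)) (h : ℝ) (p : MvPolynomial (Fin d) ℝ) :
    MvPolynomial (Fin d) ℝ :=
  MvPolynomial.aeval (fun i => MvPolynomial.C (z i) + MvPolynomial.C h * MvPolynomial.X i) p

lemma evalAt_rescale (z : EuclideanSpace ℝ (Fin d)) (h : ℝ) (p : MvPolynomial (Fin d) ℝ)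
    (y : EuclideanSpace ℝ (Fin d)) : evalAt (rescale z h p) y = evalAt p (z + h • y) := by
  induction p using MvPolynomial.induction_on with
  | C a => simp [rescale, MvPolynomial.algebraMap_eq]
  | add p q hp hq =>
    have : rescale z h (p + q) = rescale z h p + rescale z h q := by simp [rescale]
    rw [this, evalAt_add, hp, hq, evalAt_add]
  | mul_X p j hp =>
    have : rescale z h (p * MvPolynomial.X j) = rescale z h p *
      (MvPolynomial.C (z j) + MvPolynomial.C h * MvPolynomial.X j) := by simp [rescale]
    rw [this, evalAt_mul, hp]; simp

lemma pderiv_rescale (z : EuclideanSpace ℝ (Fin d)) (h : ℝ) (p : MvPolynomial (Fin d) ℝ)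
    (i : Fin d) : MvPolynomial.pderiv i (rescale z h p) =
      MvPolynomial.C h * rescale z h (MvPolynomial.pderiv i p) := by
  induction p using MvPolynomial.induction_on with
  | C a => simp [rescale, MvPolynomial.algebraMap_eq]
  | add p q hp hq =>
    simp only [rescale, map_add, mul_add] at *
    rw [hp, hq]
  | mul_X p j hp =>
    simp only [rescale, map_mul, MvPolynomial.aeval_X, MvPolynomial.pderiv_mul, hp, map_add,
      MvPolynomial.pderiv_C, MvPolynomial.pderiv_X] at *
    by_cases h : i = j
    · subst h; simp; ring
    · simp [h]; ring

lemma rescale_mem_polySpace {m : ℕ} {p : MvPolynomial (Fin d) ℝ} (hp : p ∈ PolySpace d m)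
    (z : EuclideanSpace ℝ (Fin d)) (h : ℝ) : rescale z h p ∈ PolySpace d m := by
  rw [MvPolynomial.mem_restrictTotalDegree] at *
  rw [rescale, MvPolynomial.aeval_def, MvPolynomial.eval₂_eq']
  refine MvPolynomial.totalDegree_finsetSum_le fun s hs => ?_
  rw [MvPolynomial.algebraMap_eq]
  refine (MvPolynomial.totalDegree_mul _ _).trans ?_
  rw [MvPolynomial.totalDegree_C, zero_add]
  refine (MvPolynomial.totalDegree_finsetProd _ _).trans ?_
  refine le_trans ?_ ((MvPolynomial.le_totalDegree hs).trans hp)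
  rw [Finsupp.sum_fintype _ _ (fun _ => rfl)]
  refine Finset.sum_le_sum fun j _ => ?_
  refine (MvPolynomial.totalDegree_pow _ _).trans ?_
  have : (MvPolynomial.C (z j) + MvPolynomial.C h * MvPolynomial.X j :
      MvPolynomial (Fin d) ℝ).totalDegree ≤ 1 := by
    refine (MvPolynomial.totalDegree_add _ _).trans ?_
    rw [MvPolynomial.totalDegree_C]
    refine max_le (by simp) ((MvPolynomial.totalDegree_mul _ _).trans ?_)
    rw [MvPolynomial.totalDegree_C, MvPolynomial.totalDegree_X]
  nlinarith [Nat.zero_le (s j)]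

/-- The ball contains a product of infinite sets (open intervals), and such a product detects a
nonzero polynomial. -/
lemma eq_zero_of_evalAt_eq_zero_on_ball {p : MvPolynomial (Fin d) ℝ}
    {z : EuclideanSpace ℝ (Fin d)} {r : ℝ} (hr : 0 < r)
    (h : ∀ x ∈ Metric.ball z r, evalAt p x = 0) : p = 0 := by
  have hc : Continuous (fun y : Fin d → ℝ => (WithLp.toLp 2 y : EuclideanSpace ℝ (Fin d))) := by
    fun_prop
  have ho : (fun y : Fin d → ℝ => (WithLp.toLp 2 y : EuclideanSpace ℝ (Fin d))) ⁻¹'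
      Metric.ball z r ∈ nhds (WithLp.ofLp z) :=
    hc.continuousAt.preimage_mem_nhds (by simpa using Metric.ball_mem_nhds z hr)
  obtain ⟨ε, hε, hsub⟩ := Metric.mem_nhds_iff.1 ho
  refine MvPolynomial.funext_set (fun i => Metric.ball (z i) ε)
    (fun i => (Real.ball_eq_Ioo (z i) ε ▸ Set.Ioo_infinite (by linarith))) fun y hy => ?_
  have hy' : y ∈ Metric.ball (WithLp.ofLp z) ε := by
    rw [ball_pi _ hε]; exact hy
  simpa [evalAt] using h _ (hsub hy')

end Polynomial

/-! ### Inverse inequalities on balls, by equivalence of norms and scaling. -/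

section InverseInequality

/-- The map ℓ ∘ ι⁻¹ is defined on the finite-dimensional range of ι, hence continuous. No norm on V
is needed. This is the source of the inverse estimates and of the finiteness of the Lebesgue
constant. -/
lemma exists_norm_le_of_injective {V E F : Type*} [AddCommGroup V] [Module ℝ V]
    [FiniteDimensional ℝ V] [NormedAddCommGroup E] [NormedSpace ℝ E]
    [NormedAddCommGroup F] [NormedSpace ℝ F] (ι : V →ₗ[ℝ] E) (hι : Function.Injective ι)
    (ℓ : V →ₗ[ℝ] F) : ∃ C : ℝ, 0 < C ∧ ∀ v, ‖ℓ v‖ ≤ C * ‖ι v‖ := by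
  let e := LinearEquiv.ofInjective ι hι
  let g := LinearMap.toContinuousLinearMap (ℓ ∘ₗ e.symm.toLinearMap)
  refine ⟨‖g‖ + 1, by positivity, fun v => ?_⟩
  have h1 : g (e v) = ℓ v := by simp [g]
  have h2 : ‖e v‖ = ‖ι v‖ := rfl
  rw [← h1]
  refine (g.le_opNorm _).trans ?_
  rw [h2]
  nlinarith [norm_nonneg (ι v)]

variable {d : ℕ}

/-- Evaluation of polynomials on a compact set, as a linear map to continuous functions. -/
noncomputable def evalOn (s : Set (EuclideanSpace ℝ (Fin d))) : MvPolynomial (Fin d) ℝ →ₗ[ℝ] C(s, ℝ) where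
  toFun p := ⟨fun x => evalAt p x, (continuous_evalAt p).comp continuous_subtype_val⟩
  map_add' p q := by ext; simp
  map_smul' c p := by ext; simp

lemma memLp_evalAt (p : MvPolynomial (Fin d) ℝ) {s : Set (EuclideanSpace ℝ (Fin d))}
    (hs : IsCompact s) : MemLp (evalAt p) 2 (volume.restrict s) := by
  have : IsFiniteMeasure (volume.restrict s) := ⟨by simpa using hs.measure_lt_top⟩
  obtain ⟨C, hC⟩ := hs.exists_bound_of_continuousOn (continuous_evalAt p).continuousOn
  refine MemLp.of_bound (continuous_evalAt p).aestronglyMeasurable C ?_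
  exact (ae_restrict_iff' hs.measurableSet).2 (Filter.Eventually.of_forall hC)

/-- Polynomials as elements of `L²` of a compact set. -/
noncomputable def toL2 {s : Set (EuclideanSpace ℝ (Fin d))} (hs : IsCompact s) :
    MvPolynomial (Fin d) ℝ →ₗ[ℝ] Lp ℝ 2 (volume.restrict s) where
  toFun p := (memLp_evalAt p hs).toLp _
  map_add' p q := by
    rw [← MemLp.toLp_add]; congr 1; ext; simp
  map_smul' c p := by
    rw [RingHom.id_apply, ← MemLp.toLp_const_smul]; congr 1; ext; simp

lemma norm_toL2_sq {s : Set (EuclideanSpace ℝ (Fin d))} (hs : IsCompact s)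
    (p : MvPolynomial (Fin d) ℝ) : ‖toL2 hs p‖ ^ 2 = ∫ x in s, evalAt p x ^ 2 := by
  rw [← real_inner_self_eq_norm_sq, L2.inner_def]
  refine integral_congr_ae ?_
  filter_upwards [MemLp.coeFn_toLp (memLp_evalAt p hs)] with x hx
  have : (toL2 hs p) x = evalAt p x := hx
  rw [this]; simp [pow_two]

lemma toL2_injective {s : Set (EuclideanSpace ℝ (Fin d))} (hs : IsCompact s)
    {z : EuclideanSpace ℝ (Fin d)} {r : ℝ} (hr : 0 < r) (hz : Metric.ball z r ⊆ s) :
    Function.Injective (toL2 hs) := by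
  rw [← LinearMap.ker_eq_bot, LinearMap.ker_eq_bot']
  intro p hp
  have h0 : evalAt p =ᵐ[volume.restrict s] 0 := by
    have := MemLp.coeFn_toLp (memLp_evalAt p hs)
    have h1 : (memLp_evalAt p hs).toLp _ = 0 := hp
    rw [h1] at this
    exact this.symm.trans (Lp.coeFn_zero _ _ _)
  have h1 : evalAt p =ᵐ[volume.restrict (Metric.ball z r)] 0 :=
    ae_mono (Measure.restrict_mono hz le_rfl) h0
  have h2 := Measure.eqOn_open_of_ae_eq h1 Metric.isOpen_ball (continuous_evalAt p).continuousOn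
    continuousOn_const
  exact eq_zero_of_evalAt_eq_zero_on_ball hr fun x hx => h2 hx

/-- Both sides are seminorms on the finite-dimensional space of polynomials, and the L² one is a
norm because its domain contains a ball. The operator D is left general so that the identity and the
partial derivatives are covered at once. -/
lemma exists_reference_bound (m : ℕ) {R : ℝ} (hR : 0 < R)
    (D : MvPolynomial (Fin d) ℝ →ₗ[ℝ] MvPolynomial (Fin d) ℝ) :
    ∃ C : ℝ, 0 < C ∧ ∀ p ∈ PolySpace d m, ∀ x ∈ Metric.closedBall (0 : EuclideanSpace ℝ (Fin d)) 1,
      evalAt (D p) x ^ 2 ≤ C * ∫ y in Metric.closedBall (0 : EuclideanSpace ℝ (Fin d)) (1 / R),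
        evalAt p y ^ 2 := by
  have hc : IsCompact (Metric.closedBall (0 : EuclideanSpace ℝ (Fin d)) (1 / R)) :=
    isCompact_closedBall _ _
  have : CompactSpace (Metric.closedBall (0 : EuclideanSpace ℝ (Fin d)) 1) :=
    isCompact_iff_compactSpace.1 (isCompact_closedBall _ _)
  obtain ⟨C, hC, h⟩ := exists_norm_le_of_injective ((toL2 hc).domRestrict (PolySpace d m))
    ((toL2_injective hc (by positivity) Metric.ball_subset_closedBall).comp
      Subtype.val_injective)
    ((evalOn (Metric.closedBall (0 : EuclideanSpace ℝ (Fin d)) 1) ∘ₗ D).domRestrict (PolySpace d m))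
  refine ⟨C ^ 2, by positivity, fun p hp x hx => ?_⟩
  rw [← norm_toL2_sq hc, ← mul_pow, ← sq_abs]
  refine pow_le_pow_left₀ (abs_nonneg _) ?_ 2
  refine le_trans ?_ (h ⟨p, hp⟩)
  exact ContinuousMap.norm_coe_le_norm (evalOn (Metric.closedBall 0 1) (D p)) ⟨x, hx⟩

open scoped Pointwise in
lemma setIntegral_closedBall_rescale (f : EuclideanSpace ℝ (Fin d) → ℝ)
    (z : EuclideanSpace ℝ (Fin d)) {h : ℝ} (hh : 0 < h) (r : ℝ) :
    ∫ x in Metric.closedBall z (h * r), f x =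
      h ^ d * ∫ y in Metric.closedBall (0 : EuclideanSpace ℝ (Fin d)) r, f (z + h • y) := by
  have h1 := Measure.setIntegral_comp_smul_of_pos (volume : Measure (EuclideanSpace ℝ (Fin d)))
    (fun x => f (z + x)) (Metric.closedBall 0 r) hh
  rw [h1, finrank_euclideanSpace_fin, smul_eq_mul, ← mul_assoc, mul_inv_cancel₀ (by positivity),
    one_mul]
  have h2 : h • Metric.closedBall (0 : EuclideanSpace ℝ (Fin d)) r = Metric.closedBall 0 (h * r) := by
    rw [smul_closedBall' hh.ne']
    simp [abs_of_pos hh]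
  rw [h2]
  have h3 : Metric.closedBall (0 : EuclideanSpace ℝ (Fin d)) (h * r) =
      (fun x => z + x) ⁻¹' Metric.closedBall z (h * r) := by
    ext x; simp
  rw [h3, (measurePreserving_add_left volume z).setIntegral_preimage_emb
    (measurableEmbedding_addLeft z)]

/-- Inverse inequalities for polynomials on a ball, in terms of the mean square on a
concentric smaller ball. -/
lemma exists_inverse_bound (d m : ℕ) {R : ℝ} (hR : 0 < R) :
    ∃ C : ℝ, 0 < C ∧ ∀ p ∈ PolySpace d m, ∀ (z : EuclideanSpace ℝ (Fin d)) (h : ℝ), 0 < h →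
      ∀ x ∈ Metric.closedBall z h,
      evalAt p x ^ 2 ≤ C * (h ^ d)⁻¹ * ∫ y in Metric.closedBall z (h / R), evalAt p y ^ 2 := by
  obtain ⟨C, hC, H⟩ := exists_reference_bound (d := d) m hR LinearMap.id
  refine ⟨C, hC, fun p hp z h hh x hx => ?_⟩
  have hx' : h⁻¹ • (x - z) ∈ Metric.closedBall (0 : EuclideanSpace ℝ (Fin d)) 1 := by
    rw [mem_closedBall_zero_iff, norm_smul, norm_inv, Real.norm_of_nonneg hh.le]
    rw [Metric.mem_closedBall, dist_eq_norm] at hx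
    rw [inv_mul_le_iff₀ hh]; simpa using hx
  have := H _ (rescale_mem_polySpace hp z h) _ hx'
  simp only [LinearMap.id_apply, evalAt_rescale, smul_smul, mul_inv_cancel₀ hh.ne', one_smul,
    add_sub_cancel] at this
  rw [div_eq_mul_one_div h R, setIntegral_closedBall_rescale _ _ hh]
  refine this.trans (le_of_eq ?_)
  field_simp

/-- Under y ↦ z + h y a derivative picks up a factor h, which costs h² in the squared bound; hence
the exponent d + 2. -/
lemma exists_inverse_bound_pderiv (d m : ℕ) {R : ℝ} (hR : 0 < R) :
    ∃ C : ℝ, 0 < C ∧ ∀ p ∈ PolySpace d m, ∀ (z : EuclideanSpace ℝ (Fin d)) (h : ℝ), 0 < h →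
      ∀ x ∈ Metric.closedBall z h, ∀ i,
      evalAt (MvPolynomial.pderiv i p) x ^ 2 ≤
        C * (h ^ (d + 2))⁻¹ * ∫ y in Metric.closedBall z (h / R), evalAt p y ^ 2 := by
  choose C hC H using fun i : Fin d => exists_reference_bound (d := d) m hR
    (MvPolynomial.pderiv i : Derivation ℝ _ _).toLinearMap
  refine ⟨∑ i, C i + 1, add_pos_of_nonneg_of_pos (Finset.sum_nonneg fun i _ => (hC i).le) one_pos,
    fun p hp z h hh x hx i => ?_⟩
  have hx' : h⁻¹ • (x - z) ∈ Metric.closedBall (0 : EuclideanSpace ℝ (Fin d)) 1 := by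
    rw [mem_closedBall_zero_iff, norm_smul, norm_inv, Real.norm_of_nonneg hh.le]
    rw [Metric.mem_closedBall, dist_eq_norm] at hx
    rw [inv_mul_le_iff₀ hh]; simpa using hx
  have h1 := H i _ (rescale_mem_polySpace hp z h) _ hx'
  simp only [Derivation.coeFn_coe, pderiv_rescale, evalAt_mul,
    evalAt_C, evalAt_rescale, smul_smul, mul_inv_cancel₀ hh.ne', one_smul,
    add_sub_cancel] at h1
  rw [div_eq_mul_one_div h R, setIntegral_closedBall_rescale _ _ hh]
  set I := ∫ y in Metric.closedBall (0 : EuclideanSpace ℝ (Fin d)) (1 / R),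
    evalAt p (z + h • y) ^ 2
  have hI : 0 ≤ I := integral_nonneg fun _ => sq_nonneg _
  have h2 : C i ≤ ∑ i, C i + 1 :=
    (Finset.single_le_sum (fun i _ => (hC i).le) (Finset.mem_univ i)).trans (by simp)
  have h3 : (∑ i, C i + 1) * (h ^ (d + 2))⁻¹ * (h ^ d * I) = (∑ i, C i + 1) * I / h ^ 2 := by
    rw [pow_add]; field_simp
  rw [h3, le_div_iff₀ (by positivity)]
  nlinarith

end InverseInequality

/-! ### Barycentric coordinates and outward normals of a simplex. -/

section Barycentric

variable {d : ℕ}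

/-- `lam` is the family of barycentric coordinates of the nondegenerate simplex with vertex
set `K`. -/
structure Barycentric (K : Finset (EuclideanSpace ℝ (Fin d)))
    (lam : EuclideanSpace ℝ (Fin d) → EuclideanSpace ℝ (Fin d) →ᵃ[ℝ] ℝ) : Prop where
  self : ∀ p ∈ K, lam p p = 1
  ne : ∀ p ∈ K, ∀ q ∈ K, p ≠ q → lam p q = 0
  sum_eq_one : ∀ x, ∑ p ∈ K, lam p x = 1
  sum_smul : ∀ x, ∑ p ∈ K, lam p x • p = x

lemma exists_barycentric {K : Finset (EuclideanSpace ℝ (Fin d))}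
    (hK : AffineIndependent ℝ ((↑) : K → EuclideanSpace ℝ (Fin d))) (hc : K.card = d + 1) :
    ∃ lam, Barycentric K lam := by
  classical
  have htop : affineSpan ℝ (Set.range ((↑) : K → EuclideanSpace ℝ (Fin d))) = ⊤ := by
    rw [hK.affineSpan_eq_top_iff_card_eq_finrank_add_one]
    simpa using hc
  let b : AffineBasis K ℝ (EuclideanSpace ℝ (Fin d)) := ⟨(↑), hK, htop⟩
  have hb : ∀ i : K, b i = i := fun _ => rfl
  refine ⟨fun p => if h : p ∈ K then b.coord ⟨p, h⟩ else 0, ?_, ?_, ?_, ?_⟩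
  · intro p hp
    simp only [hp, dite_true]; exact b.coord_apply_eq ⟨p, hp⟩
  · intro p hp q hq hpq
    have := b.coord_apply_ne (i := ⟨p, hp⟩) (j := ⟨q, hq⟩) (by simpa using hpq)
    simp only [hp, dite_true]; exact this
  · intro x
    rw [← b.sum_coord_apply_eq_one x, ← Finset.sum_coe_sort]
    exact Finset.sum_congr rfl fun i _ => by simp
  · intro x
    conv_rhs => rw [← b.linear_combination_coord_eq_self x]
    rw [← Finset.sum_coe_sort]
    exact Finset.sum_congr rfl fun i _ => by simp [hb]

variable {K : Finset (EuclideanSpace ℝ (Fin d))}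
  {lam : EuclideanSpace ℝ (Fin d) → EuclideanSpace ℝ (Fin d) →ᵃ[ℝ] ℝ}

lemma affineMap_eq_linear_add {d : ℕ} (f : EuclideanSpace ℝ (Fin d) →ᵃ[ℝ] ℝ)
    (x : EuclideanSpace ℝ (Fin d)) : f x = f.linear x + f 0 := by
  have := f.map_vadd 0 x
  simpa using this

lemma continuous_affineMap {d : ℕ} (f : EuclideanSpace ℝ (Fin d) →ᵃ[ℝ] ℝ) : Continuous f :=
  f.continuous_of_finiteDimensional

lemma Barycentric.affineMap_apply (hb : Barycentric K lam)
    (f : EuclideanSpace ℝ (Fin d) →ᵃ[ℝ] ℝ) (x : EuclideanSpace ℝ (Fin d)) :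
    f x = ∑ p ∈ K, lam p x * f p := by
  rw [affineMap_eq_linear_add f x]
  conv_lhs => rw [← hb.sum_smul x]
  simp only [map_sum, map_smul, smul_eq_mul]
  rw [← one_mul (f 0), ← hb.sum_eq_one x, Finset.sum_mul, ← Finset.sum_add_distrib]
  exact Finset.sum_congr rfl fun p _ => by rw [affineMap_eq_linear_add f p]; ring

lemma Barycentric.mem_simplex_iff (hb : Barycentric K lam)
    {s : Finset (EuclideanSpace ℝ (Fin d))} (hs : s ⊆ K) (x : EuclideanSpace ℝ (Fin d)) :
    x ∈ simplex s ↔ (∀ p ∈ K, 0 ≤ lam p x) ∧ ∀ p ∈ K, p ∉ s → lam p x = 0 := by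
  constructor
  · intro hx
    have hsub : simplex s ⊆ ⋂ p ∈ K, lam p ⁻¹' {y | 0 ≤ y ∧ (p ∉ s → y = 0)} := by
      refine convexHull_min ?_ ?_
      · intro q hq
        simp only [Set.mem_iInter, Set.mem_preimage, Set.mem_ofPred_eq]
        intro p hp
        by_cases h : p = q
        · subst h
          refine ⟨by rw [hb.self p hp]; norm_num, fun hn => absurd hq hn⟩
        · rw [hb.ne p hp q (hs hq) h]; simp
      · refine convex_iInter₂ fun p _ => Convex.affine_preimage (lam p) ?_
        intro a ha b hb' u v hu hv huv
        simp only [Set.mem_ofPred_eq, smul_eq_mul] at *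
        refine ⟨by nlinarith [mul_nonneg hu ha.1, mul_nonneg hv hb'.1], fun hn => ?_⟩
        rw [ha.2 hn, hb'.2 hn]; ring
    have := hsub hx
    simp only [Set.mem_iInter, Set.mem_preimage, Set.mem_ofPred_eq] at this
    exact ⟨fun p hp => (this p hp).1, fun p hp => (this p hp).2⟩
  · rintro ⟨h0, h1⟩
    have e1 : ∑ p ∈ s, lam p x = 1 := by
      rw [← hb.sum_eq_one x]
      exact Finset.sum_subset hs fun p hp hn => h1 p hp hn
    have e2 : ∑ p ∈ s, lam p x • p = x := by
      conv_rhs => rw [← hb.sum_smul x]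
      exact Finset.sum_subset hs fun p hp hn => by rw [h1 p hp hn, zero_smul]
    rw [← e2]
    exact (convex_convexHull ℝ _).sum_mem (fun p hp => h0 p (hs hp)) e1
      fun p hp => subset_convexHull ℝ _ hp

lemma Barycentric.mem_simplex_self_iff (hb : Barycentric K lam) (x : EuclideanSpace ℝ (Fin d)) :
    x ∈ simplex K ↔ ∀ p ∈ K, 0 ≤ lam p x := by
  rw [hb.mem_simplex_iff subset_rfl]
  exact ⟨fun h => h.1, fun h => ⟨h, fun p hp hn => absurd hp hn⟩⟩

lemma Barycentric.mem_simplex_erase_iff [DecidableEq (EuclideanSpace ℝ (Fin d))]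
    (hb : Barycentric K lam) {p : EuclideanSpace ℝ (Fin d)}
    (hp : p ∈ K) (x : EuclideanSpace ℝ (Fin d)) :
    x ∈ simplex (K.erase p) ↔ x ∈ simplex K ∧ lam p x = 0 := by
  rw [hb.mem_simplex_iff (Finset.erase_subset p K), hb.mem_simplex_self_iff]
  refine and_congr_right fun _ => ⟨fun h => h p hp (by simp), fun h q hq hn => ?_⟩
  have : q = p := by simpa [hq] using hn
  rw [this, h]

lemma Barycentric.le_one (hb : Barycentric K lam) {x : EuclideanSpace ℝ (Fin d)}
    (hx : x ∈ simplex K) {p : EuclideanSpace ℝ (Fin d)} (hp : p ∈ K) : lam p x ≤ 1 := by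
  rw [← hb.sum_eq_one x]
  exact Finset.single_le_sum (fun q hq => (hb.mem_simplex_self_iff x).1 hx q hq) hp

lemma linear_sub_eq (f : EuclideanSpace ℝ (Fin d) →ᵃ[ℝ] ℝ) (x y : EuclideanSpace ℝ (Fin d)) :
    f.linear (x - y) = f x - f y := by
  rw [map_sub, affineMap_eq_linear_add f x, affineMap_eq_linear_add f y]; ring

lemma affineMap_add (f : EuclideanSpace ℝ (Fin d) →ᵃ[ℝ] ℝ) (x v : EuclideanSpace ℝ (Fin d)) :
    f (x + v) = f x + f.linear v := by
  rw [affineMap_eq_linear_add f x, affineMap_eq_linear_add f (x + v), map_add]; ring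

/-- The coordinate of p increases by 1 over the vector p - q, yet stays in [0,1] along the diameter
of the inscribed ball parallel to p - q. This bounds edge lengths, and so face diameters, from
below. -/
lemma Barycentric.two_mul_le_dist (hb : Barycentric K lam) {c : EuclideanSpace ℝ (Fin d)}
    {r : ℝ} (hr : 0 ≤ r) (hc : Metric.closedBall c r ⊆ simplex K)
    {p q : EuclideanSpace ℝ (Fin d)} (hp : p ∈ K) (hq : q ∈ K) (hpq : p ≠ q) :
    2 * r ≤ dist p q := by
  have hpos : 0 < ‖p - q‖ := norm_pos_iff.2 (sub_ne_zero.2 hpq)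
  have hL : (lam p).linear (p - q) = 1 := by
    rw [linear_sub_eq, hb.self p hp, hb.ne p hp q hq hpq]; norm_num
  set u := (r / ‖p - q‖) • (p - q) with hu
  have hun : ‖u‖ = r := by
    rw [hu, norm_smul, Real.norm_of_nonneg (by positivity), div_mul_cancel₀ _ hpos.ne']
  have h1 : c + u ∈ simplex K := hc (by simp [hun])
  have h2 : c + -u ∈ simplex K := hc (by simp [hun])
  have h3 := hb.le_one h1 hp
  have h4 := (hb.mem_simplex_self_iff _).1 h2 p hp
  rw [affineMap_add, map_smul, hL] at h3
  rw [affineMap_add, map_neg, map_smul, hL] at h4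
  rw [dist_eq_norm]
  have h5 : 2 * (r / ‖p - q‖) ≤ 1 := by
    simp only [smul_eq_mul, mul_one] at h3 h4; linarith
  have h6 : 2 * r / ‖p - q‖ ≤ 1 := by rw [mul_div_assoc]; exact h5
  rwa [div_le_one hpos] at h6

lemma volume_zeros_affineMap {f : EuclideanSpace ℝ (Fin d) →ᵃ[ℝ] ℝ}
    {x₀ : EuclideanSpace ℝ (Fin d)} (h : f x₀ ≠ 0) : volume {x | f x = 0} = 0 := by
  have h1 : {x | f x = 0} = ((affineSpan ℝ ({0} : Set ℝ)).comap f : Set _) := by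
    ext x; simp
  rw [h1]
  refine Measure.addHaar_affineSubspace _ _ fun htop => h ?_
  have : x₀ ∈ (affineSpan ℝ ({0} : Set ℝ)).comap f := by rw [htop]; trivial
  simpa using this

lemma barycenter_mem_simplex {s : Finset (EuclideanSpace ℝ (Fin d))} (hs : s.Nonempty) :
    barycenter s ∈ simplex s := by
  have hc : (0 : ℝ) < s.card := by exact_mod_cast hs.card_pos
  rw [barycenter, Finset.smul_sum]
  refine (convex_convexHull ℝ _).sum_mem (fun p hp => by positivity) ?_
    fun p hp => subset_convexHull ℝ _ hp
  rw [Finset.sum_const, nsmul_eq_mul, mul_inv_cancel₀ hc.ne']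

lemma affineMap_barycenter {s : Finset (EuclideanSpace ℝ (Fin d))} (hs : s.Nonempty)
    (f : EuclideanSpace ℝ (Fin d) →ᵃ[ℝ] ℝ) : f (barycenter s) = (s.card : ℝ)⁻¹ * ∑ p ∈ s, f p := by
  have hc : (0 : ℝ) < s.card := by exact_mod_cast hs.card_pos
  rw [affineMap_eq_linear_add f, barycenter, map_smul, map_sum]
  rw [Finset.sum_congr rfl fun p _ => affineMap_eq_linear_add f p, Finset.sum_add_distrib,
    Finset.sum_const, nsmul_eq_mul, smul_eq_mul]
  field_simp

variable [DecidableEq (EuclideanSpace ℝ (Fin d))]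

/-- The outward normal is a unit vector, opposite to the gradient of the barycentric coordinate
of the vertex opposite to the facet. -/
lemma Barycentric.outwardNormal_spec (hb : Barycentric K lam)
    {p : EuclideanSpace ℝ (Fin d)} (hp : p ∈ K) (hne : (K.erase p).Nonempty) :
    ‖outwardNormal K (K.erase p)‖ = 1 ∧ ∃ κ : ℝ, 0 < κ ∧ ∀ v,
      (lam p).linear v = -κ * inner ℝ (outwardNormal K (K.erase p)) v := by
  set e := K.erase p with he
  obtain ⟨q₀, hq₀⟩ := hne
  have hq₀K : q₀ ∈ K := Finset.mem_of_mem_erase hq₀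
  have hpe : ∀ q ∈ e, lam p q = 0 := fun q hq =>
    hb.ne p hp q (Finset.mem_of_mem_erase hq) (Finset.ne_of_mem_erase hq).symm
  obtain ⟨g, hg⟩ : ∃ g : EuclideanSpace ℝ (Fin d), ∀ v, (lam p).linear v = inner ℝ g v :=
    ⟨(InnerProductSpace.toDual ℝ _).symm (LinearMap.toContinuousLinearMap (lam p).linear),
      fun v => by rw [InnerProductSpace.toDual_symm_apply]; rfl⟩
  set W := vectorSpan ℝ (e : Set (EuclideanSpace ℝ (Fin d))) with hW
  have hgW : g ∈ Wᗮ := by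
    rw [Submodule.mem_orthogonal']
    intro u hu
    rw [← hg]
    have : W ≤ LinearMap.ker (lam p).linear := by
      rw [hW, vectorSpan, Submodule.span_le]
      rintro _ ⟨a, ha, b, hb', rfl⟩
      simp [-map_sub, linear_sub_eq, hpe a ha, hpe b hb']
    exact this hu
  have hg0 : g ≠ 0 := by
    rintro rfl
    have := hg (p - q₀)
    rw [linear_sub_eq, hb.self p hp, hpe q₀ hq₀] at this
    simp at this
  have hgn : 0 < ‖g‖ := norm_pos_iff.2 hg0
  set w := Wᗮ.starProjection (barycenter e - barycenter K) with hw
  have hwW : w ∈ Wᗮ := Submodule.starProjection_apply_mem _ _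
  have hK0 : (0 : ℝ) < K.card := by exact_mod_cast Finset.card_pos.2 ⟨p, hp⟩
  have hgw : inner ℝ g w = -(K.card : ℝ)⁻¹ := by
    have h1 : inner ℝ g w = inner ℝ g (barycenter e - barycenter K) := by
      rw [hw, ← Submodule.inner_starProjection_left_eq_right,
        Submodule.starProjection_eq_self_iff.2 hgW]
    rw [h1, ← hg, linear_sub_eq, affineMap_barycenter ⟨q₀, hq₀⟩, affineMap_barycenter ⟨p, hp⟩,
      Finset.sum_eq_zero hpe, Finset.sum_eq_single p (fun q hq hqp => hb.ne p hp q hq hqp.symm)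
        (fun h => absurd hp h), hb.self p hp]
    simp
  -- The orthogonal complement of the facet directions is the line through g: the difference v of
  -- the two sides is orthogonal to those directions and to g, but a vector killed by g is a
  -- combination of edges of the facet, so v lies in W and in its complement.
  have hwg : w = -((K.card : ℝ)⁻¹ / ‖g‖ ^ 2) • g := by
    set v := w + ((K.card : ℝ)⁻¹ / ‖g‖ ^ 2) • g with hv
    have hvW : v ∈ Wᗮ := Submodule.add_mem _ hwW (Submodule.smul_mem _ _ hgW)
    have hgv : (lam p).linear v = 0 := by
      rw [hg, hv, inner_add_right, inner_smul_right, real_inner_self_eq_norm_sq, hgw]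
      field_simp; ring
    have hvV : v ∈ W := by
      have h0 : lam p (q₀ + v) = 0 := by rw [affineMap_add, hgv, hpe q₀ hq₀, add_zero]
      have h1 := hb.sum_smul (q₀ + v)
      have h2 := hb.sum_eq_one (q₀ + v)
      rw [← Finset.add_sum_erase _ _ hp, h0] at h1 h2
      have h3 : v = ∑ q ∈ e, lam q (q₀ + v) • (q - q₀) := by
        simp only [smul_sub, Finset.sum_sub_distrib, ← Finset.sum_smul]
        rw [zero_smul, zero_add] at h1
        rw [zero_add] at h2
        rw [h1, h2, one_smul, add_sub_cancel_left]
      rw [h3]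
      exact Submodule.sum_mem _ fun q hq => Submodule.smul_mem _ _
        (vsub_mem_vectorSpan ℝ hq hq₀)
    have hv0 : v = 0 := by
      have := (Submodule.mem_orthogonal' W v).1 hvW v hvV
      exact inner_self_eq_zero.1 this
    rw [neg_smul]
    exact eq_neg_of_add_eq_zero_left hv0
  have hc : 0 < (K.card : ℝ)⁻¹ / ‖g‖ ^ 2 := by positivity
  have hn : outwardNormal K e = -(‖g‖⁻¹ • g) := by
    change ‖w‖⁻¹ • w = _
    rw [hwg, norm_smul, norm_neg, Real.norm_of_nonneg hc.le, smul_smul, ← neg_smul]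
    congr 1
    field_simp
  refine ⟨?_, ‖g‖, hgn, fun v => ?_⟩
  · rw [hn, norm_neg, norm_smul, norm_inv, norm_norm, inv_mul_cancel₀ hgn.ne']
  · rw [hn, hg, inner_neg_left, real_inner_smul_left]
    field_simp

end Barycentric

/-! ### Elements of a conforming mesh, their overlaps and their common facets. -/

lemma isCompact_simplex {d : ℕ} (s : Finset (EuclideanSpace ℝ (Fin d))) :
    IsCompact (simplex s) := s.finite_toSet.isCompact_convexHull ℝ

lemma measurableSet_simplex {d : ℕ} (s : Finset (EuclideanSpace ℝ (Fin d))) :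
    MeasurableSet (simplex s) := (isCompact_simplex s).measurableSet

lemma simplex_mono {d : ℕ} {s t : Finset (EuclideanSpace ℝ (Fin d))} (h : s ⊆ t) :
    simplex s ⊆ simplex t := convexHull_mono (by exact_mod_cast h)

lemma volume_simplex_ne_top {d : ℕ} (s : Finset (EuclideanSpace ℝ (Fin d))) :
    volume (simplex s) ≠ ⊤ := (isCompact_simplex s).measure_lt_top.ne

lemma card_mul_le_of_pairwise_ae_disjoint {α ι : Type*} [MeasurableSpace α] {μ : Measure α}
    (s : Finset ι) (f : ι → Set α) (hm : ∀ i ∈ s, MeasurableSet (f i))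
    (hd : ∀ i ∈ s, ∀ j ∈ s, i ≠ j → μ (f i ∩ f j) = 0) {B : Set α} (hB : ∀ i ∈ s, f i ⊆ B)
    (hBt : μ B ≠ ⊤) {c : ℝ} (hc : ∀ i ∈ s, c ≤ μ.real (f i)) :
    s.card * c ≤ μ.real B := by
  have h1 : ∑ i ∈ s, μ.real (f i) = μ.real (⋃ i ∈ s, f i) := by
    rw [measureReal_biUnion_finset₀ (fun i hi j hj hij => hd i hi j hj hij)
      (fun i hi => (hm i hi).nullMeasurableSet)
      (fun i hi => ne_top_of_le_ne_top hBt (measure_mono (hB i hi)))]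
  calc s.card * c = ∑ i ∈ s, c := by simp
    _ ≤ ∑ i ∈ s, μ.real (f i) := Finset.sum_le_sum hc
    _ = μ.real (⋃ i ∈ s, f i) := h1
    _ ≤ μ.real B := measureReal_mono (Set.iUnion₂_subset hB) hBt

namespace Triangulation

variable {d : ℕ} {Ω : Set (EuclideanSpace ℝ (Fin d))} (T : Triangulation Ω)

lemma mem_elements {K : Finset (EuclideanSpace ℝ (Fin d))} :
    K ∈ T.elements ↔ K ∈ T.complex.faces ∧ K.card = d + 1 := by
  simp [elements]

lemma mem_meshFaces {e : Finset (EuclideanSpace ℝ (Fin d))} :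
    e ∈ T.meshFaces ↔ e ∈ T.complex.faces ∧ e.card = d := by
  simp [meshFaces]

lemma Elem.mem_faces (K : T.Elem) : K.1 ∈ T.complex.faces := (T.mem_elements.1 K.2).1

lemma Elem.card_eq (K : T.Elem) : K.1.card = d + 1 := (T.mem_elements.1 K.2).2

lemma Elem.nonempty (K : T.Elem) : K.1.Nonempty := by
  rw [← Finset.card_pos, Elem.card_eq]; omega

lemma Elem.exists_barycentric (K : T.Elem) : ∃ lam, Barycentric K.1 lam :=
  RDA.exists_barycentric (T.complex.indep (Elem.mem_faces T K)) (Elem.card_eq T K)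

lemma Elem.not_subset {K K' : T.Elem} (h : K ≠ K') : ¬ K.1 ⊆ K'.1 := fun hs =>
  h (Subtype.ext (Finset.eq_of_subset_of_card_le hs (by rw [Elem.card_eq, Elem.card_eq])))

lemma nonempty_elem (hΩ : Ω.Nonempty) : Nonempty T.Elem := by
  obtain ⟨x, hx⟩ := hΩ
  have h1 : x ∈ T.complex.space := by rw [T.space_eq]; exact subset_closure hx
  obtain ⟨s, hs, -⟩ := Geometry.SimplicialComplex.mem_space_iff.1 h1
  obtain ⟨t, ht, -, hc⟩ := T.pure s hs
  exact ⟨⟨t, T.mem_elements.2 ⟨ht, hc⟩⟩⟩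

lemma simplex_subset_closure (K : T.Elem) : simplex K.1 ⊆ closure Ω := by
  rw [← T.space_eq]
  exact Geometry.SimplicialComplex.convexHull_subset_space (Elem.mem_faces T K)

lemma diam_le_meshSize (K : T.Elem) : Metric.diam (simplex K.1) ≤ T.meshSize :=
  le_ciSup (f := fun K : T.Elem => Metric.diam (simplex K.1)) (Set.finite_range _).bddAbove K

lemma dist_le_meshSize (K : T.Elem) {x y : EuclideanSpace ℝ (Fin d)} (hx : x ∈ simplex K.1)
    (hy : y ∈ simplex K.1) : dist x y ≤ T.meshSize :=
  (Metric.dist_le_diam_of_mem (isCompact_simplex _).isBounded hx hy).trans (T.diam_le_meshSize K)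

lemma meshSize_pos (hd : 1 ≤ d) [Nonempty T.Elem] : 0 < T.meshSize := by
  obtain ⟨K⟩ := ‹Nonempty T.Elem›
  obtain ⟨p, hp, q, hq, hpq⟩ := Finset.one_lt_card.1
    (show 1 < K.1.card by rw [Elem.card_eq]; omega)
  exact (dist_pos.2 hpq).trans_le
    (T.dist_le_meshSize K (subset_convexHull ℝ _ hp) (subset_convexHull ℝ _ hq))

/-- Conformity puts the intersection in the hull of the common vertices. Some vertex of K is not
common, so the intersection lies in the zero set of its coordinate, a hyperplane. -/
lemma volume_inter_eq_zero {K K' : T.Elem} (h : K ≠ K') :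
    volume (simplex K.1 ∩ simplex K'.1) = 0 := by
  obtain ⟨lam, hb⟩ := Elem.exists_barycentric T K
  obtain ⟨p, hp, hp'⟩ := Finset.not_subset.1 (Elem.not_subset T h)
  classical
  refine measure_mono_null (fun x hx => ?_)
    (volume_zeros_affineMap (f := lam p) (x₀ := p) (by rw [hb.self p hp]; norm_num))
  have h1 := T.complex.inter_subset_convexHull (Elem.mem_faces T K) (Elem.mem_faces T K') hx
  rw [← Finset.coe_inter] at h1
  exact ((hb.mem_simplex_iff Finset.inter_subset_left x).1 h1).2 p hp
    (fun h => hp' (Finset.mem_inter.1 h).2)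

lemma exists_erase_eq {K : T.Elem} {e : Finset (EuclideanSpace ℝ (Fin d))}
    [DecidableEq (EuclideanSpace ℝ (Fin d))] (he : e.card = d) (hK : e ⊆ K.1) :
    ∃ p ∈ K.1, K.1.erase p = e := by
  obtain ⟨p, hp⟩ := Finset.card_eq_one.1 (show (K.1 \ e).card = 1 by
    rw [Finset.card_sdiff_of_subset hK, Elem.card_eq, he]; omega)
  refine ⟨p, (Finset.mem_sdiff.1 (hp ▸ Finset.mem_singleton_self p)).1, ?_⟩
  rw [Finset.erase_eq, ← hp, Finset.sdiff_sdiff_eq_self hK]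

/-- Two distinct elements with a common facet have opposite normals there. -/
lemma outwardNormal_eq_neg {K K' : T.Elem} (h : K ≠ K')
    {e : Finset (EuclideanSpace ℝ (Fin d))} (hd : 1 ≤ d) (he : e.card = d) (hK : e ⊆ K.1)
    (hK' : e ⊆ K'.1) : outwardNormal K'.1 e = -outwardNormal K.1 e := by
  classical
  obtain ⟨p, hp, hpe⟩ := T.exists_erase_eq he hK
  obtain ⟨p', hp', hpe'⟩ := T.exists_erase_eq he hK'
  have hene : e.Nonempty := Finset.card_pos.1 (by omega)
  obtain ⟨lam, hb⟩ := Elem.exists_barycentric T K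
  obtain ⟨lam', hb'⟩ := Elem.exists_barycentric T K'
  obtain ⟨hn, κ, hκ, hL⟩ := hb.outwardNormal_spec hp (hpe ▸ hene)
  obtain ⟨hn', κ', hκ', hL'⟩ := hb'.outwardNormal_spec hp' (hpe' ▸ hene)
  rw [hpe] at hn hL
  rw [hpe'] at hn' hL'
  have hpn : p ∉ e := by rw [← hpe]; simp
  have hpn' : p' ∉ e := by rw [← hpe']; simp
  have hpK' : p ∉ K'.1 := fun hmem => Elem.not_subset T h fun q hq => by
    by_cases hqp : q = p
    · exact hqp ▸ hmem
    · exact hK' (hpe ▸ Finset.mem_erase.2 ⟨hqp, hq⟩)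
  -- Both coordinates vanish on the common facet, so they are proportional; the normals are opposite
  -- exactly when the factor is negative.
  have hprop : ∀ x, lam p x = lam p p' * lam' p' x := by
    intro x
    rw [hb'.affineMap_apply (lam p) x, Finset.sum_eq_single p', mul_comm]
    · intro q hq hqp
      have hqe : q ∈ e := hpe' ▸ Finset.mem_erase.2 ⟨hqp, hq⟩
      rw [hb.ne p hp q (hK hqe) (fun h => hpn (h ▸ hqe)), mul_zero]
    · exact fun hn => absurd hp' hn
  -- Were the factor positive, K and K' would lie on the same side of e. A short step from the
  -- barycenter of e towards p' would then stay in both elements with a positive coordinate at p,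
  -- while conformity confines the intersection to a face without p.
  have hneg : lam p p' < 0 := by
    by_contra hge
    have hc : 0 < lam p p' := by
      refine lt_of_le_of_ne (not_lt.1 hge) fun h0 => ?_
      have := hprop p
      rw [hb.self p hp, ← h0] at this
      norm_num at this
    -- a point near the barycenter of `e`, in the direction of `p'`
    have hbe : ∀ q ∈ e, lam q (barycenter e) = (d : ℝ)⁻¹ := by
      intro q hq
      rw [affineMap_barycenter hene, he, Finset.sum_eq_single q, hb.self q (hK hq), mul_one]
      · exact fun r hr hrq => hb.ne q (hK hq) r (hK hr) hrq.symm
      · exact fun hn => absurd hq hn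
    have hbp : lam p (barycenter e) = 0 := by
      rw [affineMap_barycenter hene, Finset.sum_eq_zero, mul_zero]
      exact fun q hq => hb.ne p hp q (hK hq) fun h => hpn (h ▸ hq)
    set S := ∑ q ∈ K.1, |lam q p'| with hS
    have hS0 : 0 ≤ S := Finset.sum_nonneg fun _ _ => abs_nonneg _
    have hd0 : (0 : ℝ) < d := by exact_mod_cast hd
    -- This makes ε(1 + S) = (1 - ε)/d: the coordinates 1/d at the barycenter of e outweigh any
    -- negative coordinate of p', each at least -S.
    set ε := (d * (1 + S) + 1)⁻¹ with hε
    have hε0 : 0 < ε := by positivity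
    have hε1 : ε * (d * (1 + S) + 1) = 1 := inv_mul_cancel₀ (by positivity)
    have hεle : ε ≤ 1 := inv_le_one_of_one_le₀ (by nlinarith)
    set x := barycenter e + ε • (p' - barycenter e) with hx
    have hlx : ∀ q, lam q x = (1 - ε) * lam q (barycenter e) + ε * lam q p' := by
      intro q
      rw [hx, affineMap_add, map_smul, linear_sub_eq, smul_eq_mul]; ring
    have hxK : x ∈ simplex K.1 := by
      rw [hb.mem_simplex_self_iff]
      intro q hq
      rw [hlx]
      by_cases hqp : q = p
      · rw [hqp, hbp]; positivity
      · rw [hbe q (hpe ▸ Finset.mem_erase.2 ⟨hqp, hq⟩)]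
        have h1 : -S ≤ lam q p' := by
          have := Finset.single_le_sum (f := fun q => |lam q p'|) (fun q _ => abs_nonneg _) hq
          linarith [neg_abs_le (lam q p')]
        have h2 : ε * S ≤ (1 - ε) * (d : ℝ)⁻¹ := by
          rw [← div_eq_mul_inv, le_div_iff₀ hd0]
          nlinarith
        nlinarith
    have hxK' : x ∈ simplex K'.1 := by
      have hconv : Convex ℝ (simplex K'.1) := convex_convexHull ℝ _
      exact hconv.add_smul_sub_mem (simplex_mono hK' (barycenter_mem_simplex hene))
        (subset_convexHull ℝ _ hp') ⟨hε0.le, hεle⟩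
    have h1 := T.complex.inter_subset_convexHull (Elem.mem_faces T K) (Elem.mem_faces T K')
      ⟨hxK, hxK'⟩
    rw [← Finset.coe_inter] at h1
    have h2 := ((hb.mem_simplex_iff Finset.inter_subset_left x).1 h1).2 p hp
      (fun h => hpK' (Finset.mem_inter.1 h).2)
    rw [hlx, hbp, mul_zero, zero_add] at h2
    exact (mul_pos hε0 hc).ne' h2
  have hlin : ∀ v, (lam p).linear v = lam p p' * (lam' p').linear v := by
    intro v
    have h1 := affineMap_add (lam p) 0 v
    have h2 := affineMap_add (lam' p') 0 v
    have h3 := hprop (0 + v)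
    have h4 := hprop 0
    rw [h1, h2, h4] at h3
    linarith
  have hvec : κ • outwardNormal K.1 e = (lam p p' * κ') • outwardNormal K'.1 e := by
    refine ext_inner_right ℝ fun v => ?_
    rw [real_inner_smul_left, real_inner_smul_left]
    have := hlin v
    rw [hL, hL'] at this
    linarith
  have hκeq : κ = -(lam p p' * κ') := by
    have := congrArg norm hvec
    rw [norm_smul, norm_smul, hn, hn', mul_one, mul_one, Real.norm_of_nonneg hκ.le,
      Real.norm_of_nonpos (mul_nonpos_of_nonpos_of_nonneg hneg.le hκ'.le)] at this
    exact this
  have h5 : κ • (outwardNormal K'.1 e) = κ • (-outwardNormal K.1 e) := by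
    rw [smul_neg, hvec, hκeq, neg_smul]
  exact smul_right_injective _ hκ.ne' h5

lemma norm_outwardNormal {K : T.Elem} {e : Finset (EuclideanSpace ℝ (Fin d))} (hd : 1 ≤ d)
    (he : e.card = d) (hK : e ⊆ K.1) : ‖outwardNormal K.1 e‖ = 1 := by
  classical
  obtain ⟨p, hp, rfl⟩ := T.exists_erase_eq he hK
  obtain ⟨lam, hb⟩ := Elem.exists_barycentric T K
  exact (hb.outwardNormal_spec hp (Finset.card_pos.1 (by omega))).1

lemma mem_adjacent {e : Finset (EuclideanSpace ℝ (Fin d))} {K : T.Elem} :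
    K ∈ T.adjacent e ↔ e ⊆ K.1 := by simp [adjacent]

/-- A facet belongs to at most two elements. -/
lemma adjacent_cases {e : Finset (EuclideanSpace ℝ (Fin d))} (hd : 1 ≤ d) (he : e.card = d) :
    T.adjacent e = ∅ ∨ (∃ K, T.adjacent e = {K}) ∨ ∃ K K', K ≠ K' ∧ T.adjacent e = {K, K'} := by
  rcases (T.adjacent e).eq_empty_or_nonempty with h | ⟨K, hK⟩
  · exact Or.inl h
  right
  by_cases h1 : ∀ K' ∈ T.adjacent e, K' = K
  · exact Or.inl ⟨K, Finset.eq_singleton_iff_unique_mem.2 ⟨hK, h1⟩⟩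
  push Not at h1
  obtain ⟨K', hK', hne⟩ := h1
  refine Or.inr ⟨K, K', hne.symm, ?_⟩
  ext L
  rw [Finset.mem_insert, Finset.mem_singleton]
  refine ⟨fun hL => ?_, by rintro (rfl | rfl) <;> assumption⟩
  -- Three elements on one facet would have pairwise opposite unit normals, forcing n = -n.
  by_contra hcon
  push Not at hcon
  rw [mem_adjacent] at hK hK' hL
  have a1 := T.outwardNormal_eq_neg hne.symm hd he hK hK'
  have a2 := T.outwardNormal_eq_neg hcon.1 hd he hL hK
  have a3 := T.outwardNormal_eq_neg hcon.2 hd he hL hK'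
  have a4 : outwardNormal K.1 e = -outwardNormal K.1 e := by rw [← a1, a3, ← a2]
  have a5 := T.norm_outwardNormal hd he hK
  have a6 : (2 : ℝ) • outwardNormal K.1 e = 0 := by
    rw [two_smul]; nth_rewrite 1 [a4]; simp
  rw [(smul_eq_zero.1 a6).resolve_left two_ne_zero] at a5
  simp at a5

end Triangulation

/-! ### Inverse estimates on the elements of a quasi-uniform mesh. -/

lemma continuous_evalAt_sq {d : ℕ} (p : MvPolynomial (Fin d) ℝ) :
    Continuous fun x => evalAt p x ^ 2 := (continuous_evalAt p).pow 2

lemma volume_real_closedBall {d : ℕ} (z : EuclideanSpace ℝ (Fin d)) {r : ℝ} (hr : 0 ≤ r) :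
    volume.real (Metric.closedBall z r) =
      r ^ d * volume.real (Metric.closedBall (0 : EuclideanSpace ℝ (Fin d)) 1) := by
  rw [Measure.real, Measure.real, Measure.addHaar_closedBall' _ _ hr, ENNReal.toReal_mul,
    ENNReal.toReal_ofReal (by positivity), finrank_euclideanSpace_fin]

namespace Triangulation

variable {d : ℕ} {Ω : Set (EuclideanSpace ℝ (Fin d))} (T : Triangulation Ω)

/-- The factor 2 leaves strict room below the supremum defining the inradius, so an inscribed ball
exists without showing that the supremum is attained. -/
lemma QuasiUniform.exists_center {T : Triangulation Ω} {Cσ : ℝ} (hT : T.QuasiUniform Cσ)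
    (hd : 1 ≤ d) (hCσ : 0 < Cσ) (K : T.Elem) :
    ∃ z, Metric.closedBall z (T.meshSize / (2 * Cσ)) ⊆ simplex K.1 := by
  have : Nonempty T.Elem := ⟨K⟩
  have hh := T.meshSize_pos hd
  have h1 : T.meshSize / (2 * Cσ) < inradius K.1 := by
    rw [div_lt_iff₀ (by positivity)]
    nlinarith [hT K]
  obtain ⟨r, ⟨-, z, hz⟩, hr⟩ := exists_lt_of_lt_csSup (s := {r : ℝ | 0 ≤ r ∧ ∃ x,
    Metric.closedBall x r ⊆ simplex K.1}) ⟨0, le_rfl, _, by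
      rw [Metric.closedBall_zero]
      exact Set.singleton_subset_iff.2 (barycenter_mem_simplex (Elem.nonempty T K))⟩ h1
  exact ⟨z, (Metric.closedBall_subset_closedBall hr.le).trans hz⟩

lemma simplex_subset_closedBall (K : T.Elem) {z : EuclideanSpace ℝ (Fin d)}
    (hz : z ∈ simplex K.1) : simplex K.1 ⊆ Metric.closedBall z T.meshSize :=
  fun _ hx => T.dist_le_meshSize K hx hz

lemma setIntegral_mono_simplex {f : EuclideanSpace ℝ (Fin d) → ℝ} (hf : Continuous f)
    (h0 : ∀ x, 0 ≤ f x) {s : Set (EuclideanSpace ℝ (Fin d))} {K : T.Elem}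
    (hs : s ⊆ simplex K.1) : ∫ x in s, f x ≤ ∫ x in simplex K.1, f x :=
  setIntegral_mono_set (hf.continuousOn.integrableOn_compact (isCompact_simplex _))
    (Filter.Eventually.of_forall h0) hs.eventuallyLE

end Triangulation

/-- The element lies between concentric balls of radii h/(2Cσ) and h, so the estimate on balls
applies with R = 2Cσ. Being pointwise on the closed element, the bound serves as an inverse trace
estimate on the faces too. -/
lemma exists_inverse_estimate (d m : ℕ) (hd : 1 ≤ d) {Cσ : ℝ} (hCσ : 0 < Cσ) :
    ∃ C : ℝ, 0 < C ∧ ∀ (Ω : Set (EuclideanSpace ℝ (Fin d))) (T : Triangulation Ω),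
      T.QuasiUniform Cσ → ∀ K : T.Elem, ∀ p ∈ PolySpace d m, ∀ x ∈ simplex K.1,
      evalAt p x ^ 2 ≤ C * (T.meshSize ^ d)⁻¹ * ∫ y in simplex K.1, evalAt p y ^ 2 := by
  obtain ⟨C, hC, H⟩ := exists_inverse_bound d m (R := 2 * Cσ) (by positivity)
  refine ⟨C, hC, fun Ω T hT K p hp x hx => ?_⟩
  have : Nonempty T.Elem := ⟨K⟩
  have hh := T.meshSize_pos hd
  obtain ⟨z, hz⟩ := hT.exists_center hd hCσ K
  have hzK := hz (Metric.mem_closedBall_self (by positivity))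
  refine (H p hp z _ hh x (T.simplex_subset_closedBall K hzK hx)).trans ?_
  exact mul_le_mul_of_nonneg_left
    (T.setIntegral_mono_simplex (continuous_evalAt_sq p) (fun _ => sq_nonneg _) hz) (by positivity)

lemma norm_gradAt_sq {d : ℕ} (p : MvPolynomial (Fin d) ℝ) (x : EuclideanSpace ℝ (Fin d)) :
    ‖gradAt p x‖ ^ 2 = ∑ i, evalAt (MvPolynomial.pderiv i p) x ^ 2 := by
  rw [EuclideanSpace.norm_sq_eq]
  simp [gradAt_apply]

lemma exists_inverse_estimate_gradAt (d m : ℕ) (hd : 1 ≤ d) {Cσ : ℝ} (hCσ : 0 < Cσ) :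
    ∃ C : ℝ, 0 < C ∧ ∀ (Ω : Set (EuclideanSpace ℝ (Fin d))) (T : Triangulation Ω),
      T.QuasiUniform Cσ → ∀ K : T.Elem, ∀ p ∈ PolySpace d m, ∀ x ∈ simplex K.1,
      ‖gradAt p x‖ ^ 2 ≤ C * (T.meshSize ^ (d + 2))⁻¹ * ∫ y in simplex K.1, evalAt p y ^ 2 := by
  obtain ⟨C, hC, H⟩ := exists_inverse_bound_pderiv d m (R := 2 * Cσ) (by positivity)
  refine ⟨d * C, by positivity, fun Ω T hT K p hp x hx => ?_⟩
  have : Nonempty T.Elem := ⟨K⟩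
  have hh := T.meshSize_pos hd
  obtain ⟨z, hz⟩ := hT.exists_center hd hCσ K
  have hzK := hz (Metric.mem_closedBall_self (by positivity))
  have hm := T.setIntegral_mono_simplex (continuous_evalAt_sq p) (fun _ => sq_nonneg _) hz
  rw [norm_gradAt_sq]
  calc _ ≤ ∑ _i : Fin d, C * (T.meshSize ^ (d + 2))⁻¹ * ∫ y in simplex K.1, evalAt p y ^ 2 := by
        refine Finset.sum_le_sum fun i _ => ?_
        refine (H p hp z _ hh x (T.simplex_subset_closedBall K hzK hx) i).trans ?_
        exact mul_le_mul_of_nonneg_left hm (by positivity)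
    _ = _ := by simp; ring

lemma exists_inverse_estimate_gradAt_gradAt (d m : ℕ) (hd : 1 ≤ d) {Cσ : ℝ} (hCσ : 0 < Cσ) :
    ∃ C : ℝ, 0 < C ∧ ∀ (Ω : Set (EuclideanSpace ℝ (Fin d))) (T : Triangulation Ω),
      T.QuasiUniform Cσ → ∀ K : T.Elem, ∀ p ∈ PolySpace d m, ∀ x ∈ simplex K.1,
      ‖gradAt p x‖ ^ 2 ≤ C * (T.meshSize ^ d)⁻¹ * ∫ y in simplex K.1, ‖gradAt p y‖ ^ 2 := by
  obtain ⟨C, hC, H⟩ := exists_inverse_estimate d m hd hCσ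
  refine ⟨C, hC, fun Ω T hT K p hp x hx => ?_⟩
  simp only [norm_gradAt_sq]
  rw [integral_finsetSum _ fun i _ =>
    (continuous_evalAt_sq _).continuousOn.integrableOn_compact (isCompact_simplex _), Finset.mul_sum]
  exact Finset.sum_le_sum fun i _ => H Ω T hT K _ (pderiv_mem_polySpace hp i) x hx

/-! ### Volumes, neighbours, patches and face diameters under quasi-uniformity. -/

namespace Triangulation

variable {d : ℕ} {Ω : Set (EuclideanSpace ℝ (Fin d))} {T : Triangulation Ω} {Cσ : ℝ}

lemma volume_simplex_le (hd : 1 ≤ d) (K : T.Elem) :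
    volume.real (simplex K.1) ≤
      volume.real (Metric.closedBall (0 : EuclideanSpace ℝ (Fin d)) 1) * T.meshSize ^ d := by
  have : Nonempty T.Elem := ⟨K⟩
  have hh := T.meshSize_pos hd
  refine (measureReal_mono (T.simplex_subset_closedBall K
    (barycenter_mem_simplex (Elem.nonempty T K))) (measure_closedBall_lt_top.ne)).trans ?_
  rw [volume_real_closedBall _ hh.le, mul_comm]

lemma QuasiUniform.le_volume_simplex (hT : T.QuasiUniform Cσ) (hd : 1 ≤ d) (hCσ : 0 < Cσ)
    (K : T.Elem) : (T.meshSize / (2 * Cσ)) ^ d *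
      volume.real (Metric.closedBall (0 : EuclideanSpace ℝ (Fin d)) 1) ≤
      volume.real (simplex K.1) := by
  have : Nonempty T.Elem := ⟨K⟩
  have hh := T.meshSize_pos hd
  obtain ⟨z, hz⟩ := hT.exists_center hd hCσ K
  refine le_trans (le_of_eq ?_) (measureReal_mono hz (volume_simplex_ne_top _))
  rw [volume_real_closedBall z (by positivity)]

lemma mem_neighbours {K K' : T.Elem} :
    K' ∈ T.neighbours K ↔ (simplex K.1 ∩ simplex K'.1).Nonempty := by simp [neighbours]

lemma self_mem_neighbours (K : T.Elem) : K ∈ T.neighbours K := by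
  rw [mem_neighbours, Set.inter_self]
  exact ⟨_, barycenter_mem_simplex (Elem.nonempty T K)⟩

lemma mem_neighbours_comm {K K' : T.Elem} : K' ∈ T.neighbours K ↔ K ∈ T.neighbours K' := by
  rw [mem_neighbours, mem_neighbours, Set.inter_comm]

/-- A packing argument: the neighbours overlap in null sets, lie in a ball of radius 2h, and each
has at least the volume of a ball of radius h/(2Cσ). -/
lemma QuasiUniform.card_neighbours_le (hT : T.QuasiUniform Cσ) (hd : 1 ≤ d) (hCσ : 0 < Cσ)
    (K : T.Elem) : (T.neighbours K).card ≤ ⌈(4 * Cσ) ^ d⌉₊ := by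
  have : Nonempty T.Elem := ⟨K⟩
  have hh := T.meshSize_pos hd
  have hzK := barycenter_mem_simplex (Elem.nonempty T K)
  have h1 := card_mul_le_of_pairwise_ae_disjoint (μ := volume) (T.neighbours K)
    (fun K' => simplex K'.1) (fun _ _ => measurableSet_simplex _)
    (fun i _ j _ hij => T.volume_inter_eq_zero hij)
    (B := Metric.closedBall (barycenter K.1) (2 * T.meshSize)) (fun K' hK' x hx => by
      obtain ⟨y, hyK, hyK'⟩ := mem_neighbours.1 hK'
      have a1 := T.dist_le_meshSize K' hx hyK'
      have a2 := T.dist_le_meshSize K hyK hzK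
      rw [Metric.mem_closedBall]
      linarith [dist_triangle x y (barycenter K.1)]) measure_closedBall_lt_top.ne
    (fun K' _ => hT.le_volume_simplex hd hCσ K')
  rw [volume_real_closedBall (barycenter K.1) (by positivity), ← mul_assoc] at h1
  have hω : 0 < volume.real (Metric.closedBall (0 : EuclideanSpace ℝ (Fin d)) 1) :=
    ENNReal.toReal_pos (Metric.measure_closedBall_pos _ _ one_pos).ne'
      measure_closedBall_lt_top.ne
  have h2 := le_of_mul_le_mul_right h1 hω
  have h3 : (2 * T.meshSize) ^ d = (4 * Cσ) ^ d * (T.meshSize / (2 * Cσ)) ^ d := by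
    rw [← mul_pow]; congr 1; field_simp; norm_num
  rw [h3] at h2
  have h4 := le_of_mul_le_mul_right h2 (by positivity)
  exact_mod_cast h4.trans (Nat.le_ceil _)

lemma layer_subset_succ (K : T.Elem) (t : ℕ) : T.layer K t ⊆ T.layer K (t + 1) := fun K' hK' =>
  Finset.mem_biUnion.2 ⟨K', hK', self_mem_neighbours K'⟩

lemma layer_mono (K : T.Elem) : Monotone (T.layer K) :=
  monotone_nat_of_le_succ (layer_subset_succ K)

lemma card_layer_le {D : ℕ} (hD : ∀ K, (T.neighbours K).card ≤ D) (K : T.Elem) (t : ℕ) :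
    (T.layer K t).card ≤ D ^ t := by
  induction t with
  | zero => simp [layer]
  | succ t ih =>
    refine (Finset.card_biUnion_le_card_mul _ _ D fun K' _ => hD K').trans ?_
    rw [pow_succ]
    exact Nat.mul_le_mul_right _ ih

/-- Touching is symmetric, so a chain of t neighbours can be read backwards. This bounds the overlap
of patches. -/
lemma card_filter_mem_layer_le {D : ℕ} (hD : ∀ K, (T.neighbours K).card ≤ D) (K' : T.Elem)
    (t : ℕ) : (Finset.univ.filter fun K => K' ∈ T.layer K t).card ≤ D ^ t := by
  induction t generalizing K' with
  | zero => simp [layer, Finset.filter_eq, -Finset.univ_eq_attach]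
  | succ t ih =>
    have hsub : (Finset.univ.filter fun K => K' ∈ T.layer K (t + 1)) ⊆
        (T.neighbours K').biUnion fun L => Finset.univ.filter fun K => L ∈ T.layer K t := by
      intro K hK
      obtain ⟨L, hL, hL'⟩ := Finset.mem_biUnion.1 (Finset.mem_filter.1 hK).2
      exact Finset.mem_biUnion.2 ⟨L, mem_neighbours_comm.1 hL', by simpa using hL⟩
    refine (Finset.card_le_card hsub).trans
      ((Finset.card_biUnion_le_card_mul _ _ (D ^ t) fun L _ => ih L).trans ?_)
    rw [pow_succ, mul_comm]
    exact Nat.mul_le_mul_left _ (hD K')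

/-- Before the threshold is reached each layer is strictly larger than the previous one, as a
stationary layer stays stationary; so layer t has at least t + 1 elements and at most N steps are
taken. -/
lemma patch_subset_layer (N : ℕ) (K : T.Elem) : T.patch N K ⊆ T.layer K N := by
  refine layer_mono K ?_
  -- If no layer reaches the threshold, `sInf ∅ = 0` and the patch is {K}.
  rcases Set.eq_empty_or_nonempty {t : ℕ | N ≤ (T.layer K t).card} with h | h
  · rw [h]; simp
  set t₀ := sInf {t : ℕ | N ≤ (T.layer K t).card} with ht₀
  have hmem : N ≤ (T.layer K t₀).card := Nat.sInf_mem h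
  have hlt : ∀ t < t₀, (T.layer K t).card < N := fun t ht => by
    simpa using Nat.notMem_of_lt_sInf ht
  have hstrict : ∀ t < t₀, T.layer K t ≠ T.layer K (t + 1) := by
    intro t ht heq
    have hst : ∀ s, T.layer K (t + s) = T.layer K t := by
      intro s
      induction s with
      | zero => rfl
      | succ s ih =>
        change (T.layer K (t + s)).biUnion T.neighbours = _
        rw [ih]; exact heq.symm
    have := hst (t₀ - t)
    rw [Nat.add_sub_cancel' ht.le] at this
    have h1 := hlt t ht
    rw [← this] at h1
    omega
  have hgrow : ∀ t ≤ t₀, t + 1 ≤ (T.layer K t).card := by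
    intro t
    induction t with
    | zero => intro _; simp [layer]
    | succ t ih =>
      intro ht
      have h1 := ih (by omega)
      have h2 := Finset.card_lt_card
        (Finset.ssubset_iff_subset_ne.2 ⟨layer_subset_succ K t, hstrict t (by omega)⟩)
      omega
  by_contra hcon
  have h1 := hlt N (by omega)
  have h2 := hgrow N (by omega)
  omega

lemma self_mem_patch (N : ℕ) (K : T.Elem) : K ∈ T.patch N K :=
  layer_mono K (Nat.zero_le _) (by simp [layer])

lemma QuasiUniform.card_patch_le (hT : T.QuasiUniform Cσ) (hd : 1 ≤ d) (hCσ : 0 < Cσ) (N : ℕ)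
    (K : T.Elem) : (T.patch N K).card ≤ ⌈(4 * Cσ) ^ d⌉₊ ^ N :=
  (Finset.card_le_card (patch_subset_layer N K)).trans
    (card_layer_le (hT.card_neighbours_le hd hCσ) K N)

lemma QuasiUniform.card_filter_mem_patch_le (hT : T.QuasiUniform Cσ) (hd : 1 ≤ d) (hCσ : 0 < Cσ)
    (N : ℕ) (K' : T.Elem) :
    (Finset.univ.filter fun K => K' ∈ T.patch N K).card ≤ ⌈(4 * Cσ) ^ d⌉₊ ^ N :=
  (Finset.card_le_card fun K hK => by
      simp only [Finset.mem_filter, Finset.mem_univ, true_and] at hK ⊢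
      exact patch_subset_layer N K hK).trans
    (card_filter_mem_layer_le (hT.card_neighbours_le hd hCσ) K' N)

lemma QuasiUniform.le_diam_face (hT : T.QuasiUniform Cσ) (hd : 2 ≤ d) (hCσ : 0 < Cσ)
    {e : Finset (EuclideanSpace ℝ (Fin d))} (he : e.card = d) {K : T.Elem} (hK : e ⊆ K.1) :
    T.meshSize / Cσ ≤ Metric.diam (simplex e) := by
  have : Nonempty T.Elem := ⟨K⟩
  have hh := T.meshSize_pos (by omega)
  obtain ⟨z, hz⟩ := hT.exists_center (by omega) hCσ K
  obtain ⟨lam, hb⟩ := Elem.exists_barycentric T K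
  obtain ⟨p, hp, q, hq, hpq⟩ := Finset.one_lt_card.1 (show 1 < e.card by omega)
  have h1 := hb.two_mul_le_dist (by positivity) hz (hK hp) (hK hq) hpq
  have h2 := Metric.dist_le_diam_of_mem (isCompact_simplex e).isBounded
    (subset_convexHull ℝ _ hp) (subset_convexHull ℝ _ hq)
  refine le_trans (le_of_eq ?_) (h1.trans h2)
  field_simp

lemma diam_face_le {e : Finset (EuclideanSpace ℝ (Fin d))} {K : T.Elem} (hK : e ⊆ K.1) :
    Metric.diam (simplex e) ≤ T.meshSize :=
  (Metric.diam_mono (simplex_mono hK) (isCompact_simplex _).isBounded).trans (T.diam_le_meshSize K)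

end Triangulation

/-! ### The fundamental theorem of calculus on a slice. -/

section OneDimensional

/-- The fundamental theorem of calculus on a segment given by linear inequalities with distinct
roots: only the feasible roots contribute. -/
lemma setIntegral_deriv_inequalities {ι : Type*} (s : Finset ι) (c l : ι → ℝ)
    (hpos : ∃ i ∈ s, 0 < c i) (hneg : ∃ i ∈ s, c i < 0)
    (hne : ∀ i ∈ s, ∀ j ∈ s, i ≠ j → c i ≠ 0 → c j ≠ 0 → c j * l i ≠ c i * l j)
    {f f' : ℝ → ℝ} (hf : ∀ t, HasDerivAt f (f' t) t) (hf' : Continuous f') :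
    ∫ t in {t | ∀ i ∈ s, 0 ≤ c i * t + l i}, f' t =
      ∑ i ∈ s, -(SignType.sign (c i) : ℝ) *
        {t | ∀ j ∈ s, 0 ≤ c j * t + l j}.indicator f (-l i / c i) := by
  classical
  set S := {t | ∀ i ∈ s, 0 ≤ c i * t + l i} with hS
  rcases S.eq_empty_or_nonempty with h | ⟨t₀, ht₀⟩
  · simp [h]
  obtain ⟨a, ha, hamax⟩ := (s.filter fun i => 0 < c i).exists_max_image (fun i => -l i / c i)
    (by obtain ⟨i, hi, h⟩ := hpos; exact ⟨i, Finset.mem_filter.2 ⟨hi, h⟩⟩)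
  obtain ⟨b, hb, hbmin⟩ := (s.filter fun i => c i < 0).exists_min_image (fun i => -l i / c i)
    (by obtain ⟨i, hi, h⟩ := hneg; exact ⟨i, Finset.mem_filter.2 ⟨hi, h⟩⟩)
  obtain ⟨has, hca⟩ := Finset.mem_filter.1 ha
  obtain ⟨hbs, hcb⟩ := Finset.mem_filter.1 hb
  set α := -l a / c a with hα
  set β := -l b / c b with hβ
  have hge : ∀ i, 0 < c i → ∀ t, 0 ≤ c i * t + l i ↔ -l i / c i ≤ t := by
    intro i hi t
    rw [div_le_iff₀ hi]
    constructor <;> intro h <;> linarith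
  have hle : ∀ i, c i < 0 → ∀ t, 0 ≤ c i * t + l i ↔ t ≤ -l i / c i := by
    intro i hi t
    rw [le_div_iff_of_neg hi]
    constructor <;> intro h <;> linarith
  have hSI : S = Set.Icc α β := by
    ext t
    refine ⟨fun h => ⟨(hge a hca t).1 (h a has), (hle b hcb t).1 (h b hbs)⟩, fun h i hi => ?_⟩
    rcases lt_trichotomy (c i) 0 with hc | hc | hc
    · exact (hle i hc t).2 (h.2.trans (hbmin i (Finset.mem_filter.2 ⟨hi, hc⟩)))
    · have := ht₀ i hi
      rw [hc] at this ⊢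
      simpa using this
    · exact (hge i hc t).2 ((hamax i (Finset.mem_filter.2 ⟨hi, hc⟩)).trans h.1)
  have hαβ : α ≤ β := by
    rw [hSI] at ht₀; exact ht₀.1.trans ht₀.2
  have hab : a ≠ b := by rintro rfl; exact absurd hca (not_lt.2 hcb.le)
  have hterm : ∀ i ∈ s, -(SignType.sign (c i) : ℝ) * S.indicator f (-l i / c i) =
      (if i = a then -f α else 0) + (if i = b then f β else 0) := by
    intro i hi
    have hroot : ∀ j ∈ s, i ≠ j → c i ≠ 0 → c j ≠ 0 → -l i / c i ≠ -l j / c j := by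
      intro j hj hij hi0 hj0 h
      rw [div_eq_div_iff hi0 hj0] at h
      exact hne i hi j hj hij hi0 hj0 (by linarith)
    rcases lt_trichotomy (c i) 0 with hc | hc | hc
    · have hia : i ≠ a := by rintro rfl; exact absurd hca (not_lt.2 hc.le)
      rw [sign_neg hc, if_neg hia]
      by_cases hib : i = b
      · subst hib
        rw [hSI, Set.indicator_of_mem (Set.right_mem_Icc.2 hαβ)]
        simp
      · rw [if_neg hib, Set.indicator_of_notMem]
        · simp
        · rw [hSI]
          exact fun h => hroot b hbs hib hc.ne hcb.ne
            (le_antisymm h.2 (hbmin i (Finset.mem_filter.2 ⟨hi, hc⟩)))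
    -- A zero slope gives sign 0, so the meaningless root -l/0 never contributes.
    · have hia : i ≠ a := by rintro rfl; exact hca.ne' hc
      have hib : i ≠ b := by rintro rfl; exact hcb.ne hc
      simp [hc, hia, hib]
    · have hib : i ≠ b := by rintro rfl; exact absurd hc (not_lt.2 hcb.le)
      rw [sign_pos hc, if_neg hib]
      by_cases hia : i = a
      · subst hia
        rw [hSI, Set.indicator_of_mem (Set.left_mem_Icc.2 hαβ)]
        simp
      · rw [if_neg hia, Set.indicator_of_notMem]
        · simp
        · rw [hSI]
          exact fun h => hroot a has hia hc.ne' hca.ne'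
            (le_antisymm (hamax i (Finset.mem_filter.2 ⟨hi, hc⟩)) h.1)
  rw [Finset.sum_congr rfl hterm, Finset.sum_add_distrib, Finset.sum_ite_eq', Finset.sum_ite_eq',
    if_pos has, if_pos hbs, hSI, integral_Icc_eq_integral_Ioc,
    ← intervalIntegral.integral_of_le hαβ,
    intervalIntegral.integral_eq_sub_of_hasDerivAt (fun t _ => hf t)
      (hf'.intervalIntegrable _ _)]
  ring

end OneDimensional

/-! ### Fubini along the first coordinate. -/

section Slicing

variable {n : ℕ}

/-- The point with first coordinate `t` and remaining coordinates `y`. -/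
noncomputable def consPt (t : ℝ) (y : EuclideanSpace ℝ (Fin n)) : EuclideanSpace ℝ (Fin (n + 1)) :=
  WithLp.toLp 2 (Fin.cons t fun i => y i)

/-- The projection forgetting the first coordinate. -/
noncomputable def tailPt (x : EuclideanSpace ℝ (Fin (n + 1))) : EuclideanSpace ℝ (Fin n) :=
  WithLp.toLp 2 fun i => x i.succ

@[simp] lemma tailPt_consPt (t : ℝ) (y : EuclideanSpace ℝ (Fin n)) : tailPt (consPt t y) = y := by
  ext i; simp [tailPt, consPt]

lemma consPt_tailPt (x : EuclideanSpace ℝ (Fin (n + 1))) : consPt (x 0) (tailPt x) = x := by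
  ext i
  refine Fin.cases ?_ (fun i => ?_) i <;> simp [tailPt, consPt]

lemma consPt_eq (t : ℝ) (y : EuclideanSpace ℝ (Fin n)) :
    consPt t y = consPt 0 y + t • EuclideanSpace.single 0 (1 : ℝ) := by
  ext i
  refine Fin.cases ?_ (fun i => ?_) i <;> simp [consPt]

lemma continuous_consPt :
    Continuous fun z : ℝ × EuclideanSpace ℝ (Fin n) => consPt z.1 z.2 := by
  unfold consPt
  refine (PiLp.continuous_toLp 2 _).comp (continuous_pi fun i => ?_)
  refine Fin.cases ?_ (fun i => ?_) i
  · simpa using continuous_fst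
  · simp only [Fin.cons_succ]; fun_prop

lemma continuous_tailPt : Continuous (tailPt (n := n)) := by
  unfold tailPt; fun_prop

lemma lipschitzWith_tailPt : LipschitzWith 1 (tailPt (n := n)) := by
  refine LipschitzWith.of_dist_le_mul fun x y => ?_
  rw [NNReal.coe_one, one_mul, EuclideanSpace.dist_eq, EuclideanSpace.dist_eq, Fin.sum_univ_succ]
  refine Real.sqrt_le_sqrt ?_
  simp only [tailPt]
  linarith [sq_nonneg (dist (x 0) (y 0))]

/-- `consPt 0` as a linear map. -/
noncomputable def consZero (n : ℕ) :
    EuclideanSpace ℝ (Fin n) →ₗ[ℝ] EuclideanSpace ℝ (Fin (n + 1)) where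
  toFun := consPt 0
  map_add' x y := by
    ext i
    refine Fin.cases ?_ (fun i => ?_) i <;> simp [consPt]
  map_smul' c y := by
    ext i
    refine Fin.cases ?_ (fun i => ?_) i <;> simp [consPt]

/-- `consPt` as a measurable equivalence. -/
noncomputable def consEquiv (n : ℕ) :
    ℝ × EuclideanSpace ℝ (Fin n) ≃ᵐ EuclideanSpace ℝ (Fin (n + 1)) :=
  ((MeasurableEquiv.refl ℝ).prodCongr (MeasurableEquiv.toLp 2 (Fin n → ℝ)).symm).trans
    ((MeasurableEquiv.piFinSuccAbove (fun _ : Fin (n + 1) => ℝ) 0).symm.trans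
      (MeasurableEquiv.toLp 2 (Fin (n + 1) → ℝ)))

lemma consEquiv_apply (t : ℝ) (y : EuclideanSpace ℝ (Fin n)) :
    consEquiv n (t, y) = consPt t y := by
  ext i
  refine Fin.cases ?_ (fun i => ?_) i <;> simp [consEquiv, consPt] <;> rfl

lemma measurePreserving_consEquiv (n : ℕ) :
    MeasurePreserving (consEquiv n) (volume.prod volume) volume := by
  have h1 : MeasurePreserving ((MeasurableEquiv.refl ℝ).prodCongr
      (MeasurableEquiv.toLp 2 (Fin n → ℝ)).symm) (volume.prod volume) (volume.prod volume) :=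
    (MeasurePreserving.id volume).prod
      (EuclideanSpace.volume_preserving_symm_measurableEquiv_toLp (Fin n))
  exact h1.trans (((volume_preserving_piFinSuccAbove (fun _ : Fin (n + 1) => ℝ) 0).symm _).trans
    (EuclideanSpace.volume_preserving_symm_measurableEquiv_toLp (Fin (n + 1))).symm)

lemma setIntegral_eq_integral_slices {s : Set (EuclideanSpace ℝ (Fin (n + 1)))}
    (hs : IsCompact s) {f : EuclideanSpace ℝ (Fin (n + 1)) → ℝ} (hf : Continuous f) :
    ∫ x in s, f x = ∫ y, ∫ t in {t | consPt t y ∈ s}, f (consPt t y) := by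
  have hint : Integrable (s.indicator f) :=
    (integrable_indicator_iff hs.measurableSet).2 (hf.continuousOn.integrableOn_compact hs)
  have hint' : Integrable (fun z => s.indicator f (consEquiv n z)) (volume.prod volume) :=
    ((measurePreserving_consEquiv n).integrable_comp_emb (consEquiv n).measurableEmbedding).2 hint
  rw [← integral_indicator hs.measurableSet,
    ← (measurePreserving_consEquiv n).integral_comp' (s.indicator f), integral_prod_symm _ hint']
  refine integral_congr_ae (Filter.Eventually.of_forall fun y => ?_)
  have hm : MeasurableSet {t | consPt t y ∈ s} :=
    (continuous_consPt.comp (by fun_prop : Continuous fun t : ℝ => (t, y))).measurable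
      hs.measurableSet
  simp only [consEquiv_apply]
  rw [← integral_indicator hm]
  rfl

end Slicing

/-! ### The divergence theorem on a simplex, by slicing. -/

section Divergence

variable {n : ℕ}

/-- The integral of `F` over the projection of the facet `e`, along the facet. -/
noncomputable def shadowIntegral (e : Finset (EuclideanSpace ℝ (Fin (n + 1))))
    (F : EuclideanSpace ℝ (Fin (n + 1)) → ℝ) : ℝ :=
  ∫ y in tailPt '' simplex e, F (Function.invFunOn tailPt (simplex e) y)

/-- The simplex `e` is contained in the graph of a continuous function of the last coordinates. -/
def IsGraph (e : Finset (EuclideanSpace ℝ (Fin (n + 1)))) : Prop :=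
  ∃ g : EuclideanSpace ℝ (Fin n) → EuclideanSpace ℝ (Fin (n + 1)), Continuous g ∧
    ∀ x ∈ simplex e, g (tailPt x) = x

lemma measurableSet_shadow (e : Finset (EuclideanSpace ℝ (Fin (n + 1)))) :
    MeasurableSet (tailPt '' simplex e) :=
  ((isCompact_simplex e).image continuous_tailPt).measurableSet

/-- On a graph the preimage under the projection is unique, so the choice made by
`Function.invFunOn` is harmless. The value depends on the facet alone, not on an adjacent element,
which is what permits cancellation across interior faces. -/
lemma shadowIntegral_eq {e : Finset (EuclideanSpace ℝ (Fin (n + 1)))}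
    {g : EuclideanSpace ℝ (Fin n) → EuclideanSpace ℝ (Fin (n + 1))}
    (hg : ∀ x ∈ simplex e, g (tailPt x) = x) (F : EuclideanSpace ℝ (Fin (n + 1)) → ℝ) :
    shadowIntegral e F = ∫ y in tailPt '' simplex e, F (g y) := by
  refine setIntegral_congr_fun (measurableSet_shadow e) fun y hy => ?_
  have h1 := Function.invFunOn_mem hy
  have h2 := Function.invFunOn_eq hy
  have h3 := hg _ h1
  rw [h2] at h3
  simp only [h3]

variable {K : Finset (EuclideanSpace ℝ (Fin (n + 1)))}
  {lam : EuclideanSpace ℝ (Fin (n + 1)) → EuclideanSpace ℝ (Fin (n + 1)) →ᵃ[ℝ] ℝ}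

lemma affineMap_consPt (f : EuclideanSpace ℝ (Fin (n + 1)) →ᵃ[ℝ] ℝ) (t : ℝ)
    (y : EuclideanSpace ℝ (Fin n)) :
    f (consPt t y) = f.linear (EuclideanSpace.single 0 1) * t + f (consPt 0 y) := by
  rw [consPt_eq, affineMap_add, map_smul, smul_eq_mul]; ring

lemma continuous_graph (f : EuclideanSpace ℝ (Fin (n + 1)) →ᵃ[ℝ] ℝ) (c : ℝ) :
    Continuous fun y : EuclideanSpace ℝ (Fin n) => consPt (-f (consPt 0 y) / c) y := by
  have h1 : Continuous fun y : EuclideanSpace ℝ (Fin n) => f (consPt 0 y) :=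
    (continuous_affineMap f).comp
      (continuous_consPt.comp (by fun_prop : Continuous fun y => ((0 : ℝ), y)))
  exact continuous_consPt.comp ((h1.neg.div_const c).prodMk continuous_id)

lemma Barycentric.sum_linear (hb : Barycentric K lam) (v : EuclideanSpace ℝ (Fin (n + 1))) :
    ∑ p ∈ K, (lam p).linear v = 0 := by
  have h1 := hb.sum_eq_one (0 + v)
  simp only [affineMap_add, Finset.sum_add_distrib] at h1
  rw [hb.sum_eq_one] at h1
  linarith

lemma Barycentric.exists_linear_ne_zero (hb : Barycentric K lam)
    {v : EuclideanSpace ℝ (Fin (n + 1))} (hv : v ≠ 0) : ∃ p ∈ K, (lam p).linear v ≠ 0 := by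
  by_contra! h
  refine hv ?_
  have h1 := hb.sum_smul (0 + v)
  rw [Finset.sum_congr rfl fun p hp => by rw [affineMap_add, h p hp, add_zero],
    hb.sum_smul 0] at h1
  simpa using h1.symm

variable [DecidableEq (EuclideanSpace ℝ (Fin (n + 1)))]

lemma Barycentric.graph_spec (hb : Barycentric K lam) {p : EuclideanSpace ℝ (Fin (n + 1))}
    (hp : p ∈ K) (hc : (lam p).linear (EuclideanSpace.single 0 1) ≠ 0)
    {x : EuclideanSpace ℝ (Fin (n + 1))} (hx : x ∈ simplex (K.erase p)) :
    consPt (-lam p (consPt 0 (tailPt x)) / (lam p).linear (EuclideanSpace.single 0 1)) (tailPt x) =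
      x := by
  have h1 := ((hb.mem_simplex_erase_iff hp x).1 hx).2
  rw [← consPt_tailPt x, affineMap_consPt] at h1
  have h2 : -lam p (consPt 0 (tailPt x)) / (lam p).linear (EuclideanSpace.single 0 1) = x 0 := by
    rw [div_eq_iff hc]; linarith
  rw [h2, consPt_tailPt]

lemma Barycentric.isGraph (hb : Barycentric K lam) {p : EuclideanSpace ℝ (Fin (n + 1))}
    (hp : p ∈ K) (hc : (lam p).linear (EuclideanSpace.single 0 1) ≠ 0) :
    IsGraph (K.erase p) :=
  ⟨_, continuous_graph _ _, fun _ hx => hb.graph_spec hp hc hx⟩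

lemma Barycentric.shadow_eq (hb : Barycentric K lam) {p : EuclideanSpace ℝ (Fin (n + 1))}
    (hp : p ∈ K) (hc : (lam p).linear (EuclideanSpace.single 0 1) ≠ 0) :
    tailPt '' simplex (K.erase p) = {y | consPt (-lam p (consPt 0 y) /
      (lam p).linear (EuclideanSpace.single 0 1)) y ∈ simplex K} := by
  ext y
  constructor
  · rintro ⟨x, hx, rfl⟩
    simp only [Set.mem_ofPred_eq]
    rw [hb.graph_spec hp hc hx]
    exact ((hb.mem_simplex_erase_iff hp x).1 hx).1
  · intro hy
    refine ⟨_, (hb.mem_simplex_erase_iff hp _).2 ⟨hy, ?_⟩, tailPt_consPt _ _⟩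
    rw [affineMap_consPt, mul_div_cancel₀ _ hc]; ring

/-- The divergence theorem on a simplex, in the first coordinate direction. -/
lemma Barycentric.integral_pderiv (hb : Barycentric K lam) (hK : 2 ≤ K.card)
    (F : MvPolynomial (Fin (n + 1)) ℝ) :
    ∫ x in simplex K, evalAt (MvPolynomial.pderiv 0 F) x =
      ∑ p ∈ K, (SignType.sign (outwardNormal K (K.erase p) 0) : ℝ) *
        shadowIntegral (K.erase p) (evalAt F) := by
  set e₀ : EuclideanSpace ℝ (Fin (n + 1)) := EuclideanSpace.single 0 1 with he₀
  set c := fun p => (lam p).linear e₀ with hc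
  have hsum := hb.sum_linear e₀
  obtain ⟨p₀, hp₀, hcp₀⟩ := hb.exists_linear_ne_zero (v := e₀) (by
    intro h; have := congrArg (fun x => x 0) h; simp [he₀] at this)
  -- The slopes of the barycentric coordinates sum to zero and do not all vanish, so both signs
  -- occur and every slice is bounded.
  have hpos : ∃ p ∈ K, 0 < c p := by
    by_contra! h
    exact hcp₀ ((Finset.sum_eq_zero_iff_of_nonpos h).1 hsum p₀ hp₀)
  have hneg : ∃ p ∈ K, c p < 0 := by
    by_contra! h
    exact hcp₀ ((Finset.sum_eq_zero_iff_of_nonneg h).1 hsum p₀ hp₀)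
  -- For almost every line the roots of the different coordinates are distinct. Two roots agree only
  -- on an affine subspace of the y-space, which is proper because the function f defining it takes
  -- the value c q ≠ 0 at the projection of p.
  have hgen : ∀ᵐ y : EuclideanSpace ℝ (Fin n), ∀ p ∈ K, ∀ q ∈ K, p ≠ q → c p ≠ 0 → c q ≠ 0 →
      c q * lam p (consPt 0 y) ≠ c p * lam q (consPt 0 y) := by
    refine (Filter.eventually_all_finset K).2 fun p hp =>
      (Filter.eventually_all_finset K).2 fun q hq => ?_
    by_cases hpq : p = q
    · exact Filter.Eventually.of_forall fun y h => absurd hpq h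
    by_cases hcq : c q = 0
    · exact Filter.Eventually.of_forall fun y _ _ h => absurd hcq h
    let f : EuclideanSpace ℝ (Fin (n + 1)) →ᵃ[ℝ] ℝ := c q • lam p - c p • lam q
    have hf : ∀ x, f x = c q * lam p x - c p * lam q x := fun x => by simp [f]
    have hf0 : f.linear e₀ = 0 := by
      simp only [f, AffineMap.sub_linear, AffineMap.smul_linear, LinearMap.sub_apply,
        LinearMap.smul_apply, smul_eq_mul, hc]
      ring
    have hne : (f.comp (consZero n).toAffineMap) (tailPt p) ≠ 0 := by
      have h1 := affineMap_consPt f (p 0) (tailPt p)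
      rw [hf0, consPt_tailPt, zero_mul, zero_add, hf, hb.self p hp, hb.ne q hq p hp (Ne.symm hpq)]
        at h1
      change f (consPt 0 (tailPt p)) ≠ 0
      rw [← h1]; simpa using hcq
    filter_upwards [compl_mem_ae_iff.2 (volume_zeros_affineMap hne)] with y hy _ _ _ heq
    refine hy ?_
    change f (consPt 0 y) = 0
    rw [hf, heq, sub_self]
  have hslice : ∀ y, {t | consPt t y ∈ simplex K} =
      {t | ∀ p ∈ K, 0 ≤ c p * t + lam p (consPt 0 y)} := by
    intro y; ext t
    simp only [Set.mem_ofPred_eq]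
    rw [hb.mem_simplex_self_iff]
    simp only [affineMap_consPt (lam _) t y, hc, he₀]
  have hderiv : ∀ y t, HasDerivAt (fun t => evalAt F (consPt t y))
      (evalAt (MvPolynomial.pderiv 0 F) (consPt t y)) t := by
    intro y t
    have := hasDerivAt_evalAt_line F 0 (consPt 0 y) t
    rw [← consPt_eq] at this
    exact this.congr_of_eventuallyEq (Filter.Eventually.of_forall fun s =>
      congrArg (evalAt F) (consPt_eq s y))
  have hcont : ∀ y, Continuous fun t => evalAt (MvPolynomial.pderiv 0 F) (consPt t y) := fun y =>
    (continuous_evalAt _).comp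
      (continuous_consPt.comp (by fun_prop : Continuous fun t : ℝ => (t, y)))
  have hsign : ∀ p ∈ K, -(SignType.sign (c p) : ℝ) =
      SignType.sign (outwardNormal K (K.erase p) 0) := by
    intro p hp
    obtain ⟨-, κ, hκ, h⟩ := hb.outwardNormal_spec hp (by
      rw [← Finset.card_pos, Finset.card_erase_of_mem hp]; omega)
    have h1 : c p = -(κ * outwardNormal K (K.erase p) 0) := by
      simp only [hc, h, he₀, EuclideanSpace.inner_single_right]; simp
    rw [h1, Left.sign_neg, sign_mul, sign_pos hκ, one_mul]
    simp
  rw [setIntegral_eq_integral_slices (isCompact_simplex K) (continuous_evalAt _)]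
  have hae : ∀ᵐ y : EuclideanSpace ℝ (Fin n),
      ∫ t in {t | consPt t y ∈ simplex K}, evalAt (MvPolynomial.pderiv 0 F) (consPt t y) =
      ∑ p ∈ K, -(SignType.sign (c p) : ℝ) * {y | consPt (-lam p (consPt 0 y) / c p) y ∈
        simplex K}.indicator (fun y => evalAt F (consPt (-lam p (consPt 0 y) / c p) y)) y := by
    filter_upwards [hgen] with y hy
    rw [hslice y, setIntegral_deriv_inequalities K c (fun p => lam p (consPt 0 y)) hpos hneg hy
      (hderiv y) (hcont y), ← hslice y]
    rfl
  have hint : ∀ p ∈ K, c p ≠ 0 → ∀ s : Set (EuclideanSpace ℝ (Fin n)),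
      s = tailPt '' simplex (K.erase p) → Integrable (s.indicator
        fun y => evalAt F (consPt (-lam p (consPt 0 y) / c p) y)) := by
    rintro p hp hcp s rfl
    exact (integrable_indicator_iff (measurableSet_shadow _)).2
      (((continuous_evalAt F).comp (continuous_graph (lam p) (c p))).continuousOn.integrableOn_compact
        ((isCompact_simplex _).image continuous_tailPt))
  rw [integral_congr_ae hae, integral_finsetSum]
  · refine Finset.sum_congr rfl fun p hp => ?_
    rw [integral_const_mul, hsign p hp]
    -- A facet parallel to the first axis is not a graph over the other coordinates, but its sign
    -- factor is zero.
    by_cases hcp : c p = 0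
    · rw [← hsign p hp, hcp]; simp
    · rw [← hb.shadow_eq hp hcp, integral_indicator (measurableSet_shadow _),
        shadowIntegral_eq (g := fun y => consPt (-lam p (consPt 0 y) / c p) y)
          fun x hx => hb.graph_spec hp hcp hx]
  · intro p hp
    by_cases hcp : c p = 0
    · simp [hcp]
    · exact (hint p hp hcp _ (hb.shadow_eq hp hcp).symm).const_mul _

end Divergence

/-! ### Comparison of the surface measure with Lebesgue measure. -/

section SurfaceMeasure

lemma euclideanHausdorffMeasure_image_le {X Y : Type*} [EMetricSpace X] [MeasurableSpace X]
    [BorelSpace X] [EMetricSpace Y] [MeasurableSpace Y] [BorelSpace Y] {f : X → Y}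
    (hf : LipschitzWith 1 f) (n : ℕ) (s : Set X) : μHE[n] (f '' s) ≤ μHE[n] s := by
  rw [Measure.euclideanHausdorffMeasure_def, Measure.euclideanHausdorffMeasure_def,
    Measure.smul_apply, Measure.smul_apply]
  have := hf.hausdorffMeasure_image_le (d := n) (by positivity) s
  simp only [ENNReal.coe_one, ENNReal.one_rpow, one_mul] at this
  exact smul_mono_right _ this

/-- The hyperplane of the facet is an isometric copy of ℝⁿ, and the facet lies within distance h of
any of its vertices. -/
lemma euclideanHausdorffMeasure_simplex_le {n : ℕ}
    {e : Finset (EuclideanSpace ℝ (Fin (n + 1)))}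
    (he : AffineIndependent ℝ ((↑) : e → EuclideanSpace ℝ (Fin (n + 1)))) (hc : e.card = n + 1)
    {h : ℝ} (hdiam : Metric.diam (simplex e) ≤ h) :
    μHE[n] (simplex e) ≤ volume (Metric.closedBall (0 : EuclideanSpace ℝ (Fin n)) h) := by
  obtain ⟨x₀, hx₀⟩ : e.Nonempty := Finset.card_pos.1 (by omega)
  set W := vectorSpan ℝ (e : Set (EuclideanSpace ℝ (Fin (n + 1)))) with hW
  have hfin : Module.finrank ℝ W = n := by
    have := he.finrank_vectorSpan (n := n) (by simpa using hc)
    have hr : Set.range ((↑) : e → EuclideanSpace ℝ (Fin (n + 1))) = ↑e := by ext; simp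
    rwa [hr] at this
  let b := (stdOrthonormalBasis ℝ W).reindex (finCongr hfin)
  let φ : EuclideanSpace ℝ (Fin n) → EuclideanSpace ℝ (Fin (n + 1)) :=
    fun y => x₀ + (b.repr.symm y : W)
  have hφ : Isometry φ := by
    refine Isometry.of_dist_eq fun y z => ?_
    rw [dist_add_left]
    exact b.repr.symm.dist_map y z
  have hsub : simplex e ⊆ φ '' Metric.closedBall 0 h := by
    intro x hx
    have hxW : x - x₀ ∈ W := by
      rw [hW, ← direction_affineSpan]
      exact AffineSubspace.vsub_mem_direction (convexHull_subset_affineSpan _ hx)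
        (subset_affineSpan ℝ _ hx₀)
    refine ⟨b.repr ⟨x - x₀, hxW⟩, ?_, by simp [φ]⟩
    rw [mem_closedBall_zero_iff, LinearIsometryEquiv.norm_map]
    change ‖x - x₀‖ ≤ h
    rw [← dist_eq_norm]
    exact (Metric.dist_le_diam_of_mem (isCompact_simplex e).isBounded hx
      (subset_convexHull ℝ _ hx₀)).trans hdiam
  refine (measure_mono hsub).trans ?_
  rw [hφ.euclideanHausdorffMeasure_image, EuclideanSpace.euclideanHausdorffMeasure_eq_volume]

variable {n : ℕ} {e : Finset (EuclideanSpace ℝ (Fin (n + 1)))}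

lemma integrableOn_simplex_of_continuous {n k : ℕ} {e : Finset (EuclideanSpace ℝ (Fin n))}
    (he : μHE[k] (simplex e) ≠ ⊤) {f : EuclideanSpace ℝ (Fin n) → ℝ} (hf : Continuous f) :
    IntegrableOn f (simplex e) μHE[k] := by
  obtain ⟨C, hC⟩ := (isCompact_simplex e).exists_bound_of_continuousOn hf.continuousOn
  exact Measure.integrableOn_of_bounded he hf.aestronglyMeasurable
    ((ae_restrict_iff' (measurableSet_simplex e)).2 (Filter.Eventually.of_forall hC))

/-- Forgetting a coordinate is 1-Lipschitz, hence does not increase the normalized Hausdorff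
measure. Only this inequality is needed, not the exact area factor |n₀|. -/
lemma volume_restrict_shadow_le (e : Finset (EuclideanSpace ℝ (Fin (n + 1)))) :
    (volume : Measure (EuclideanSpace ℝ (Fin n))).restrict (tailPt '' simplex e) ≤
      ((μHE[n] : Measure (EuclideanSpace ℝ (Fin (n + 1)))).restrict (simplex e)).map tailPt := by
  refine Measure.le_iff.2 fun B hB => ?_
  rw [Measure.restrict_apply hB, Measure.map_apply continuous_tailPt.measurable hB,
    Measure.restrict_apply (continuous_tailPt.measurable hB),
    ← EuclideanSpace.euclideanHausdorffMeasure_eq_volume]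
  refine le_trans (le_of_eq ?_) (euclideanHausdorffMeasure_image_le lipschitzWith_tailPt n _)
  rw [Set.inter_comm (tailPt ⁻¹' B), Set.image_inter_preimage, Set.inter_comm]

lemma IsGraph.shadowIntegral_le (hg : IsGraph e) (he : μHE[n] (simplex e) ≠ ⊤)
    {F : EuclideanSpace ℝ (Fin (n + 1)) → ℝ} (hF : Continuous F) (h0 : ∀ x, 0 ≤ F x) :
    shadowIntegral e F ≤ ∫ x in simplex e, F x ∂μHE[n] := by
  obtain ⟨g, hgc, hg⟩ := hg
  rw [shadowIntegral_eq hg]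
  have hm : AEMeasurable (tailPt (n := n))
    ((μHE[n] : Measure (EuclideanSpace ℝ (Fin (n + 1)))).restrict (simplex e)) :=
    continuous_tailPt.measurable.aemeasurable
  have hsm : AEStronglyMeasurable (fun y => F (g y))
      (((μHE[n] : Measure (EuclideanSpace ℝ (Fin (n + 1)))).restrict (simplex e)).map tailPt) :=
    (hF.comp hgc).aestronglyMeasurable
  calc ∫ y in tailPt '' simplex e, F (g y)
      ≤ ∫ y, F (g y) ∂(((μHE[n] : Measure (EuclideanSpace ℝ (Fin (n + 1)))).restrict
          (simplex e)).map tailPt) := by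
        refine integral_mono_measure (volume_restrict_shadow_le e)
          (Filter.Eventually.of_forall fun y => h0 _) ?_
        rw [integrable_map_measure hsm hm]
        exact integrableOn_simplex_of_continuous he ((hF.comp hgc).comp continuous_tailPt)
    _ = ∫ x in simplex e, F (g (tailPt x)) ∂μHE[n] := integral_map hm hsm
    _ = ∫ x in simplex e, F x ∂μHE[n] :=
        setIntegral_congr_fun (measurableSet_simplex e) fun x hx => by simp only [hg x hx]

lemma IsGraph.shadowIntegral_sub (hg : IsGraph e) {F G : EuclideanSpace ℝ (Fin (n + 1)) → ℝ}
    (hF : Continuous F) (hG : Continuous G) :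
    shadowIntegral e (fun x => F x - G x) = shadowIntegral e F - shadowIntegral e G := by
  obtain ⟨g, hgc, hg⟩ := hg
  have hc := (isCompact_simplex e).image continuous_tailPt
  rw [shadowIntegral_eq hg, shadowIntegral_eq hg, shadowIntegral_eq hg]
  exact integral_sub ((hF.comp hgc).continuousOn.integrableOn_compact hc)
    ((hG.comp hgc).continuousOn.integrableOn_compact hc)

lemma IsGraph.abs_shadowIntegral_le (hg : IsGraph e) (he : μHE[n] (simplex e) ≠ ⊤)
    {F : EuclideanSpace ℝ (Fin (n + 1)) → ℝ} (hF : Continuous F) :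
    |shadowIntegral e F| ≤ ∫ x in simplex e, |F x| ∂μHE[n] := by
  refine le_trans ?_ (hg.shadowIntegral_le he hF.abs fun _ => abs_nonneg _)
  exact abs_integral_le_integral_abs

end SurfaceMeasure

/-! ### Sums over faces and the boundary terms of the divergence theorem. -/

namespace Triangulation

variable {n : ℕ} {Ω : Set (EuclideanSpace ℝ (Fin (n + 1)))} {T : Triangulation Ω}
  {e : Finset (EuclideanSpace ℝ (Fin (n + 1)))}

lemma exists_mem_adjacent (he : e ∈ T.meshFaces) : ∃ K : T.Elem, e ⊆ K.1 := by
  obtain ⟨t, ht, hs, hc⟩ := T.pure e (T.mem_meshFaces.1 he).1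
  exact ⟨⟨t, T.mem_elements.2 ⟨ht, hc⟩⟩, hs⟩

lemma hausdorff_face_ne_top (he : e ∈ T.meshFaces) : μHE[n] (simplex e) ≠ ⊤ := by
  rw [mem_meshFaces] at he
  exact ne_top_of_le_ne_top measure_closedBall_lt_top.ne
    (euclideanHausdorffMeasure_simplex_le (T.complex.indep he.1) he.2 le_rfl)

lemma hausdorff_face_le (he : e ∈ T.meshFaces) :
    (μHE[n] : Measure (EuclideanSpace ℝ (Fin (n + 1)))).real (simplex e) ≤ T.meshSize ^ n *
      volume.real (Metric.closedBall (0 : EuclideanSpace ℝ (Fin n)) 1) := by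
  obtain ⟨K, hK⟩ := exists_mem_adjacent he
  have : Nonempty T.Elem := ⟨K⟩
  rw [← volume_real_closedBall 0 (T.meshSize_pos (by omega)).le]
  rw [mem_meshFaces] at he
  exact ENNReal.toReal_mono measure_closedBall_lt_top.ne
    (euclideanHausdorffMeasure_simplex_le (T.complex.indep he.1) he.2 (diam_face_le hK))

/-- Pairs (face, adjacent element) correspond to pairs (element, vertex) through the facet opposite
the vertex; this regroups the elementwise boundary terms by face. -/
lemma sum_meshFaces_adjacent [DecidableEq (EuclideanSpace ℝ (Fin (n + 1)))] {M : Type*}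
    [AddCommMonoid M] (g : T.Elem → Finset (EuclideanSpace ℝ (Fin (n + 1))) → M) :
    ∑ e ∈ T.meshFaces, ∑ K ∈ T.adjacent e, g K e = ∑ K : T.Elem, ∑ p ∈ K.1, g K (K.1.erase p) := by
  have h1 : ∀ K : T.Elem, ∑ p ∈ K.1, g K (K.1.erase p) =
      ∑ e ∈ T.meshFaces.filter (· ⊆ K.1), g K e := by
    intro K
    refine Finset.sum_bij (fun p _ => K.1.erase p) ?_ ?_ ?_ (fun _ _ => rfl)
    · intro p hp
      rw [Finset.mem_filter, mem_meshFaces, Finset.card_erase_of_mem hp, Elem.card_eq]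
      refine ⟨⟨T.complex.down_closed (Elem.mem_faces T K) (Finset.erase_subset _ _) ?_, rfl⟩,
        Finset.erase_subset _ _⟩
      rw [← Finset.card_pos, Finset.card_erase_of_mem hp, Elem.card_eq]; omega
    · intro p hp q hq hpq
      by_contra hne
      have : p ∈ K.1.erase q := Finset.mem_erase.2 ⟨hne, hp⟩
      rw [← hpq] at this
      simp at this
    · intro e he
      rw [Finset.mem_filter, mem_meshFaces] at he
      obtain ⟨p, hp, h⟩ := T.exists_erase_eq he.1.2 he.2
      exact ⟨p, hp, h⟩
  simp only [h1]
  refine Finset.sum_comm' fun e K => ?_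
  simp [mem_adjacent]

lemma isGraph_of_outwardNormal_ne_zero {K : T.Elem} (he : e.card = n + 1) (hK : e ⊆ K.1)
    (h0 : outwardNormal K.1 e 0 ≠ 0) : IsGraph e := by
  classical
  obtain ⟨p, hp, rfl⟩ := T.exists_erase_eq he hK
  obtain ⟨lam, hb⟩ := Elem.exists_barycentric T K
  obtain ⟨-, κ, hκ, h⟩ := hb.outwardNormal_spec hp (Finset.card_pos.1 (by omega))
  refine hb.isGraph hp ?_
  rw [h, EuclideanSpace.inner_single_right]
  simpa using ⟨hκ.ne', h0⟩

variable (u : T.Elem → MvPolynomial (Fin (n + 1)) ℝ)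

lemma continuous_jump (u : T.Elem → MvPolynomial (Fin (n + 1)) ℝ)
    (e : Finset (EuclideanSpace ℝ (Fin (n + 1)))) : Continuous (T.jump u e) := by
  unfold jump
  exact continuous_finsetSum _ fun K _ => (continuous_evalAt (u K)).smul continuous_const

/-- The contribution of a face to the divergence theorem is controlled by the jump. -/
lemma face_term_le (he : e ∈ T.meshFaces) {M : ℝ} (hM : ∀ x ∈ closure Ω, |x 0| ≤ M) :
    ∑ K ∈ T.adjacent e, (SignType.sign (outwardNormal K.1 e 0) : ℝ) *
        shadowIntegral e (evalAt (MvPolynomial.X 0 * u K ^ 2)) ≤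
      ∫ x in simplex e, M * (‖T.jump u e x‖ * ∑ K ∈ T.adjacent e, |evalAt (u K) x|) ∂μHE[n] := by
  have hcard := (T.mem_meshFaces.1 he).2
  have htop := hausdorff_face_ne_top he
  have hM0 : ∀ x ∈ simplex e, |x 0| ≤ M := by
    obtain ⟨K, hK⟩ := exists_mem_adjacent he
    exact fun x hx => hM x (T.simplex_subset_closure K (simplex_mono hK hx))
  have hint : IntegrableOn (fun x => M * (‖T.jump u e x‖ * ∑ K ∈ T.adjacent e, |evalAt (u K) x|))
      (simplex e) μHE[n] := by
    refine integrableOn_simplex_of_continuous htop ?_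
    have h1 := continuous_jump u e
    have h2 := fun K => continuous_evalAt (u K)
    fun_prop
  have hnonneg : 0 ≤ ∫ x in simplex e, M * (‖T.jump u e x‖ *
      ∑ K ∈ T.adjacent e, |evalAt (u K) x|) ∂μHE[n] := by
    refine setIntegral_nonneg (measurableSet_simplex e) fun x hx => ?_
    have := (abs_nonneg _).trans (hM0 x hx)
    exact mul_nonneg this (mul_nonneg (norm_nonneg _) (Finset.sum_nonneg fun _ _ => abs_nonneg _))
  -- the common estimate
  have key : ∀ K : T.Elem, e ⊆ K.1 → ∀ D : EuclideanSpace ℝ (Fin (n + 1)) → ℝ, Continuous D →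
      (∀ x, |D x| ≤ ‖T.jump u e x‖ * ∑ K ∈ T.adjacent e, |evalAt (u K) x|) →
      (SignType.sign (outwardNormal K.1 e 0) : ℝ) * shadowIntegral e (fun x => x 0 * D x) ≤
      ∫ x in simplex e, M * (‖T.jump u e x‖ * ∑ K ∈ T.adjacent e, |evalAt (u K) x|) ∂μHE[n] := by
    intro K hK D hD hbound
    by_cases h0 : outwardNormal K.1 e 0 = 0
    · rw [h0]; simpa using hnonneg
    have hg := isGraph_of_outwardNormal_ne_zero hcard hK h0
    have hcont : Continuous fun x : EuclideanSpace ℝ (Fin (n + 1)) => x 0 * D x := by fun_prop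
    have h1 : (SignType.sign (outwardNormal K.1 e 0) : ℝ) *
        shadowIntegral e (fun x => x 0 * D x) ≤ |shadowIntegral e (fun x => x 0 * D x)| := by
      rcases lt_or_gt_of_ne h0 with h | h
      · rw [sign_neg h]; simpa using neg_le_abs _
      · rw [sign_pos h]; simpa using le_abs_self _
    refine h1.trans ((hg.abs_shadowIntegral_le htop hcont).trans ?_)
    refine setIntegral_mono_on (integrableOn_simplex_of_continuous htop hcont.abs) hint
      (measurableSet_simplex e) fun x hx => ?_
    rw [abs_mul]
    exact mul_le_mul (hM0 x hx) (hbound x) (abs_nonneg _) ((abs_nonneg _).trans (hM0 x hx))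
  rcases T.adjacent_cases (by omega) hcard with h | ⟨K, h⟩ | ⟨K, K', hne, h⟩
  · rw [h]; simp
  · have hK : e ⊆ K.1 := T.mem_adjacent.1 (h ▸ Finset.mem_singleton_self K)
    refine le_trans (le_of_eq ?_) (key K hK (fun x => evalAt (u K) x ^ 2)
      (continuous_evalAt_sq _) fun x => ?_)
    · rw [h, Finset.sum_singleton]
      congr 2; ext x; simp
    · rw [jump, h, Finset.sum_singleton, Finset.sum_singleton, norm_smul,
        T.norm_outwardNormal (by omega) hcard hK, abs_pow, Real.norm_eq_abs]
      exact le_of_eq (by ring)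
  · have hK : e ⊆ K.1 := T.mem_adjacent.1 (h ▸ Finset.mem_insert_self K _)
    have hK' : e ⊆ K'.1 := T.mem_adjacent.1
      (h ▸ Finset.mem_insert_of_mem (Finset.mem_singleton_self K'))
    have hneg := T.outwardNormal_eq_neg hne (by omega) hcard hK hK'
    -- Opposite normals turn the two contributions into a difference of squares, which factors as
    -- the jump times the sum of the traces.
    refine le_trans (le_of_eq ?_) (key K hK (fun x => evalAt (u K) x ^ 2 - evalAt (u K') x ^ 2)
      ((continuous_evalAt_sq _).sub (continuous_evalAt_sq _)) fun x => ?_)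
    · rw [h, Finset.sum_pair hne, hneg]
      by_cases h0 : outwardNormal K.1 e 0 = 0
      · simp [h0]
      have hg := isGraph_of_outwardNormal_ne_zero hcard hK h0
      have h2 := hg.shadowIntegral_sub (continuous_evalAt (MvPolynomial.X 0 * u K ^ 2))
        (continuous_evalAt (MvPolynomial.X 0 * u K' ^ 2))
      have h3 : (fun x : EuclideanSpace ℝ (Fin (n + 1)) => x 0 * (evalAt (u K) x ^ 2 -
          evalAt (u K') x ^ 2)) = fun x => evalAt (MvPolynomial.X 0 * u K ^ 2) x -
          evalAt (MvPolynomial.X 0 * u K' ^ 2) x := by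
        ext x; simp; ring
      rw [h3, h2, PiLp.neg_apply, Left.sign_neg]
      simp only [SignType.coe_neg]
      ring
    · have hj : T.jump u e x = (evalAt (u K) x - evalAt (u K') x) • outwardNormal K.1 e := by
        rw [jump, h, Finset.sum_pair hne, hneg, sub_smul, smul_neg, sub_eq_add_neg]
      rw [hj, h, Finset.sum_pair hne, norm_smul, T.norm_outwardNormal (by omega) hcard hK, mul_one,
        Real.norm_eq_abs, sq_sub_sq, abs_mul, mul_comm]
      exact mul_le_mul_of_nonneg_left (abs_add_le _ _) (abs_nonneg _)

end Triangulation

/-! ### Broken norms and the discrete Poincaré inequality. -/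

namespace Triangulation

variable {n : ℕ} {Ω : Set (EuclideanSpace ℝ (Fin (n + 1)))}

/-- The square of the `L²` norm of a piecewise polynomial. -/
noncomputable def l2Sq (T : Triangulation Ω) (u : T.Elem → MvPolynomial (Fin (n + 1)) ℝ) : ℝ :=
  ∑ K : T.Elem, ∫ x in simplex K.1, evalAt (u K) x ^ 2

/-- The square of the broken `H¹` seminorm. -/
noncomputable def gradSq (T : Triangulation Ω) (u : T.Elem → MvPolynomial (Fin (n + 1)) ℝ) : ℝ :=
  ∑ K : T.Elem, ∫ x in simplex K.1, ‖gradAt (u K) x‖ ^ 2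

/-- The weighted square of the `L²` norms of the jumps. -/
noncomputable def jumpSq (T : Triangulation Ω) (u : T.Elem → MvPolynomial (Fin (n + 1)) ℝ) : ℝ :=
  ∑ e ∈ T.meshFaces, ∫ x in simplex e, (Metric.diam (simplex e))⁻¹ * ‖T.jump u e x‖ ^ 2 ∂μHE[n]

variable {T : Triangulation Ω} {u : T.Elem → MvPolynomial (Fin (n + 1)) ℝ}

lemma continuous_norm_gradAt_sq {d : ℕ} (p : MvPolynomial (Fin d) ℝ) :
    Continuous fun x => ‖gradAt p x‖ ^ 2 := (continuous_gradAt p).norm.pow 2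

lemma integrableOn_elem {d : ℕ} {K : Finset (EuclideanSpace ℝ (Fin d))}
    {f : EuclideanSpace ℝ (Fin d) → ℝ} (hf : Continuous f) : IntegrableOn f (simplex K) :=
  hf.continuousOn.integrableOn_compact (isCompact_simplex _)

lemma integral_sq_nonneg {d : ℕ} (K : Finset (EuclideanSpace ℝ (Fin d)))
    (p : MvPolynomial (Fin d) ℝ) : 0 ≤ ∫ x in simplex K, evalAt p x ^ 2 :=
  integral_nonneg fun _ => sq_nonneg _

lemma integral_gradAt_sq_nonneg {d : ℕ} (K : Finset (EuclideanSpace ℝ (Fin d)))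
    (p : MvPolynomial (Fin d) ℝ) : 0 ≤ ∫ x in simplex K, ‖gradAt p x‖ ^ 2 :=
  integral_nonneg fun _ => sq_nonneg _

lemma gradSq_nonneg : 0 ≤ T.gradSq u := Finset.sum_nonneg fun _ _ => integral_gradAt_sq_nonneg _ _

lemma face_jumpSq_nonneg (e : Finset (EuclideanSpace ℝ (Fin (n + 1)))) :
    0 ≤ ∫ x in simplex e, (Metric.diam (simplex e))⁻¹ * ‖T.jump u e x‖ ^ 2 ∂μHE[n] :=
  integral_nonneg fun _ => mul_nonneg (inv_nonneg.2 Metric.diam_nonneg) (sq_nonneg _)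

lemma jumpSq_nonneg : 0 ≤ T.jumpSq u := Finset.sum_nonneg fun e _ => face_jumpSq_nonneg e

variable {e : Finset (EuclideanSpace ℝ (Fin (n + 1)))}

lemma card_adjacent_le (he : e ∈ T.meshFaces) : (T.adjacent e).card ≤ 2 := by
  rcases T.adjacent_cases (by omega) (T.mem_meshFaces.1 he).2 with h | ⟨K, h⟩ | ⟨K, K', -, h⟩
  · simp [h]
  · simp [h]
  · rw [h]; exact Finset.card_le_two

lemma sum_meshFaces_adjacent_const (g : T.Elem → ℝ) :
    ∑ e ∈ T.meshFaces, ∑ K ∈ T.adjacent e, g K = (n + 2) * ∑ K, g K := by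
  classical
  rw [T.sum_meshFaces_adjacent fun K _ => g K, Finset.mul_sum]
  refine Finset.sum_congr rfl fun K _ => ?_
  rw [Finset.sum_const, Elem.card_eq, nsmul_eq_mul]
  push_cast; ring

lemma face_integral_le (he : e ∈ T.meshFaces) {f : EuclideanSpace ℝ (Fin (n + 1)) → ℝ}
    (hf : Continuous f) {B : ℝ} (hB : 0 ≤ B) (hfB : ∀ x ∈ simplex e, f x ≤ B) :
    ∫ x in simplex e, f x ∂μHE[n] ≤
      B * (T.meshSize ^ n * volume.real (Metric.closedBall (0 : EuclideanSpace ℝ (Fin n)) 1)) := by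
  have htop := hausdorff_face_ne_top he
  refine (setIntegral_mono_on (integrableOn_simplex_of_continuous htop hf)
    (integrableOn_simplex_of_continuous htop (continuous_const (y := B)))
    (measurableSet_simplex e) hfB).trans ?_
  rw [setIntegral_const, smul_eq_mul, mul_comm]
  exact mul_le_mul_of_nonneg_left (hausdorff_face_le he) hB

lemma volume_unitBall_pos (n : ℕ) :
    0 < volume.real (Metric.closedBall (0 : EuclideanSpace ℝ (Fin n)) 1) :=
  ENNReal.toReal_pos (Metric.measure_closedBall_pos _ _ one_pos).ne' measure_closedBall_lt_top.ne

end Triangulation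

lemma IsConvexPolytopalDomain.exists_norm_le {d : ℕ} {Ω : Set (EuclideanSpace ℝ (Fin d))}
    (hΩ : IsConvexPolytopalDomain Ω) : ∃ M : ℝ, 0 < M ∧ ∀ x ∈ closure Ω, ‖x‖ ≤ M := by
  obtain ⟨V, hV⟩ := hΩ.polytopal
  have hc : IsCompact (closure Ω) := hV ▸ V.finite_toSet.isCompact_convexHull ℝ
  obtain ⟨M, hM, h⟩ := hc.isBounded.exists_pos_norm_le
  exact ⟨M, hM, h⟩

open Triangulation in
/-- The Poincaré inequality for piecewise polynomials. -/
theorem exists_poincare {n : ℕ} (hn : 1 ≤ n) {Ω : Set (EuclideanSpace ℝ (Fin (n + 1)))}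
    (hΩ : IsConvexPolytopalDomain Ω) (m : ℕ) {Cσ : ℝ} (hCσ : 0 < Cσ) :
    ∃ C : ℝ, 0 < C ∧ ∀ T : Triangulation Ω, T.QuasiUniform Cσ →
      ∀ u : T.Elem → MvPolynomial (Fin (n + 1)) ℝ, (∀ K, u K ∈ PolySpace (n + 1) m) →
        T.l2Sq u ≤ C * (T.gradSq u + T.jumpSq u) := by
  classical
  obtain ⟨M, hM, hMΩ⟩ := hΩ.exists_norm_le
  obtain ⟨C, hC, hinv⟩ := exists_inverse_estimate (n + 1) m (by omega) hCσ
  set ω := volume.real (Metric.closedBall (0 : EuclideanSpace ℝ (Fin n)) 1) with hω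
  have hω0 : 0 < ω := volume_unitBall_pos n
  -- Each of the n + 2 facets of an element charges its L² norm once, so with this δ the face terms
  -- cost exactly a quarter of ‖u‖².
  set δ : ℝ := (8 * C * ω * (n + 2))⁻¹ with hδ
  have hδ0 : 0 < δ := by positivity
  -- One quarter of ‖u‖² is lost on the faces and one in the cells; the remaining half on the left
  -- doubles the coefficients 4M² and M²/(4δ).
  refine ⟨8 * M ^ 2 + M ^ 2 / (2 * δ), by positivity, fun T hT u hu => ?_⟩
  have hne := T.nonempty_elem hΩ.nonempty
  set h := T.meshSize with hh
  have hpos : 0 < h := T.meshSize_pos (by omega)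
  have hcoord : ∀ x ∈ closure Ω, |x 0| ≤ M := fun x hx => by
    simpa using (PiLp.norm_apply_le x 0).trans (hMΩ x hx)
  set I := fun K : T.Elem => ∫ x in simplex K.1, evalAt (u K) x ^ 2 with hI
  have hI0 : ∀ K, 0 ≤ I K := fun K => integral_sq_nonneg _ _
  have hface : ∀ e ∈ T.meshFaces, ∑ K ∈ T.adjacent e,
      (SignType.sign (outwardNormal K.1 e 0) : ℝ) *
        shadowIntegral e (evalAt (MvPolynomial.X 0 * u K ^ 2)) ≤
      M ^ 2 / (4 * δ) * (∫ x in simplex e, (Metric.diam (simplex e))⁻¹ * ‖T.jump u e x‖ ^ 2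
        ∂μHE[n]) + δ * (2 * C * ω) * ∑ K ∈ T.adjacent e, I K := by
    intro e he
    have hcard := (T.mem_meshFaces.1 he).2
    have htop := hausdorff_face_ne_top he
    obtain ⟨K₀, hK₀⟩ := exists_mem_adjacent he
    set q := Metric.diam (simplex e) with hq
    have hq0 : 0 < q := lt_of_lt_of_le (by positivity) (hT.le_diam_face (by omega) hCσ hcard hK₀)
    have hqh : q ≤ h := diam_face_le hK₀
    have hJ := continuous_jump u e
    have hE := fun K => continuous_evalAt (u K)
    have hc1 : Continuous fun x => M * (‖T.jump u e x‖ * ∑ K ∈ T.adjacent e, |evalAt (u K) x|) := by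
      fun_prop
    have hc2 : Continuous fun x => q⁻¹ * ‖T.jump u e x‖ ^ 2 := by fun_prop
    have hc3 : Continuous fun x => q * (∑ K ∈ T.adjacent e, |evalAt (u K) x|) ^ 2 := by fun_prop
    have h3 : ∫ x in simplex e, q * (∑ K ∈ T.adjacent e, |evalAt (u K) x|) ^ 2 ∂μHE[n] ≤
        2 * C * ω * ∑ K ∈ T.adjacent e, I K := by
      have hsum0 : 0 ≤ ∑ K ∈ T.adjacent e, I K := Finset.sum_nonneg fun K _ => hI0 K
      refine (face_integral_le he hc3 (B := h * (2 * (C * (h ^ (n + 1))⁻¹ *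
        ∑ K ∈ T.adjacent e, I K))) (by positivity) fun x hx => ?_).trans (le_of_eq ?_)
      · refine mul_le_mul hqh ?_ (sq_nonneg _) hpos.le
        refine (sq_sum_le_card_mul_sum_sq).trans ?_
        have hcd : ((T.adjacent e).card : ℝ) ≤ 2 := by exact_mod_cast card_adjacent_le he
        refine mul_le_mul hcd ?_ (Finset.sum_nonneg fun _ _ => sq_nonneg _) (by norm_num)
        rw [Finset.mul_sum]
        refine Finset.sum_le_sum fun K hK => ?_
        rw [sq_abs]
        exact hinv Ω T hT K (u K) (hu K) x (simplex_mono (T.mem_adjacent.1 hK) hx)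
      · rw [← hh, ← hω]
        field_simp
        ring
    have i2 : IntegrableOn (fun x => M ^ 2 / (4 * δ) * (q⁻¹ * ‖T.jump u e x‖ ^ 2))
        (simplex e) μHE[n] :=
      integrableOn_simplex_of_continuous htop (continuous_const.mul hc2)
    have i3 : IntegrableOn (fun x => δ * (q * (∑ K ∈ T.adjacent e, |evalAt (u K) x|) ^ 2))
        (simplex e) μHE[n] :=
      integrableOn_simplex_of_continuous htop (continuous_const.mul hc3)
    calc _ ≤ ∫ x in simplex e, M * (‖T.jump u e x‖ * ∑ K ∈ T.adjacent e, |evalAt (u K) x|)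
          ∂μHE[n] := face_term_le u he hcoord
      _ ≤ ∫ x in simplex e, (M ^ 2 / (4 * δ) * (q⁻¹ * ‖T.jump u e x‖ ^ 2) +
          δ * (q * (∑ K ∈ T.adjacent e, |evalAt (u K) x|) ^ 2)) ∂μHE[n] := by
          refine setIntegral_mono_on (integrableOn_simplex_of_continuous htop hc1)
            (i2.add i3) (measurableSet_simplex e) fun x _ => ?_
          set j := ‖T.jump u e x‖
          set S := ∑ K ∈ T.adjacent e, |evalAt (u K) x|
          -- Young's inequality, with the defect displayed as a square; the weights q and q⁻¹ match
          -- the jump seminorm.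
          have h4 : M ^ 2 / (4 * δ) * (q⁻¹ * j ^ 2) + δ * (q * S ^ 2) - M * (j * S) =
              (M * j - 2 * δ * q * S) ^ 2 / (4 * δ * q) := by
            field_simp; ring
          have h5 : 0 ≤ (M * j - 2 * δ * q * S) ^ 2 / (4 * δ * q) := by positivity
          linarith
      _ = M ^ 2 / (4 * δ) * (∫ x in simplex e, q⁻¹ * ‖T.jump u e x‖ ^ 2 ∂μHE[n]) +
          δ * ∫ x in simplex e, q * (∑ K ∈ T.adjacent e, |evalAt (u K) x|) ^ 2 ∂μHE[n] := by
          rw [integral_add i2 i3, integral_const_mul (M ^ 2 / (4 * δ)), integral_const_mul δ]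
      _ ≤ _ := by
          rw [mul_assoc δ]
          gcongr
  -- The divergence theorem for x₀u², whose derivative is u² + 2x₀u∂₀u; Young splits the last
  -- product into u²/4 and 4M²|∇u|².
  have hcell : ∀ K : T.Elem, I K ≤ (∑ p ∈ K.1,
      (SignType.sign (outwardNormal K.1 (K.1.erase p) 0) : ℝ) *
        shadowIntegral (K.1.erase p) (evalAt (MvPolynomial.X 0 * u K ^ 2))) +
      (I K / 4 + 4 * M ^ 2 * ∫ x in simplex K.1, ‖gradAt (u K) x‖ ^ 2) := by
    intro K
    obtain ⟨lam, hb⟩ := Elem.exists_barycentric T K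
    rw [← hb.integral_pderiv (by rw [Elem.card_eq]; omega)]
    have hc1 := integrableOn_elem (K := K.1) (continuous_evalAt_sq (u K))
    have hc2 := integrableOn_elem (K := K.1) (continuous_norm_gradAt_sq (u K))
    have hc3 := integrableOn_elem (K := K.1)
      (continuous_evalAt (MvPolynomial.pderiv 0 (MvPolynomial.X 0 * u K ^ 2)))
    have h4 : I K / 4 + 4 * M ^ 2 * ∫ x in simplex K.1, ‖gradAt (u K) x‖ ^ 2 =
        ∫ x in simplex K.1, (1 / 4 * evalAt (u K) x ^ 2 + 4 * M ^ 2 * ‖gradAt (u K) x‖ ^ 2) := by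
      rw [integral_add (hc1.const_mul _) (hc2.const_mul _), integral_const_mul, integral_const_mul]
      ring
    have hc4 : IntegrableOn (fun x => 1 / 4 * evalAt (u K) x ^ 2 +
        4 * M ^ 2 * ‖gradAt (u K) x‖ ^ 2) (simplex K.1) :=
      (hc1.const_mul _).add (hc2.const_mul _)
    rw [h4, ← integral_add hc3 hc4]
    refine setIntegral_mono_on hc1 (hc3.add hc4)
      (measurableSet_simplex _) fun x hx => ?_
    have hx0 := hcoord x (T.simplex_subset_closure K hx)
    have hgx : evalAt (MvPolynomial.pderiv 0 (u K)) x ^ 2 ≤ ‖gradAt (u K) x‖ ^ 2 := by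
      rw [norm_gradAt_sq]
      exact Finset.single_le_sum (f := fun i => evalAt (MvPolynomial.pderiv i (u K)) x ^ 2)
        (fun _ _ => sq_nonneg _) (Finset.mem_univ 0)
    have hp : evalAt (MvPolynomial.pderiv 0 (MvPolynomial.X 0 * u K ^ 2)) x =
        evalAt (u K) x ^ 2 + x 0 * (2 * evalAt (u K) x * evalAt (MvPolynomial.pderiv 0 (u K)) x) := by
      rw [MvPolynomial.pderiv_mul, MvPolynomial.pderiv_X_self, MvPolynomial.pderiv_pow]
      simp [evalAt]
    rw [hp]
    set a := evalAt (u K) x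
    set b := evalAt (MvPolynomial.pderiv 0 (u K)) x
    have h5 : (x 0 * b) ^ 2 ≤ M ^ 2 * ‖gradAt (u K) x‖ ^ 2 := by
      rw [mul_pow]
      exact mul_le_mul (sq_le_sq' (by linarith [abs_le.1 hx0]) (abs_le.1 hx0).2) hgx (sq_nonneg _)
        (sq_nonneg _)
    nlinarith [sq_nonneg (a / 2 + 2 * (x 0 * b))]
  have hsum : T.l2Sq u ≤ (∑ K : T.Elem, ∑ p ∈ K.1,
      (SignType.sign (outwardNormal K.1 (K.1.erase p) 0) : ℝ) *
        shadowIntegral (K.1.erase p) (evalAt (MvPolynomial.X 0 * u K ^ 2))) +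
      (T.l2Sq u / 4 + 4 * M ^ 2 * T.gradSq u) := by
    refine (Finset.sum_le_sum fun K _ => hcell K).trans (le_of_eq ?_)
    rw [Finset.sum_add_distrib, Finset.sum_add_distrib, ← Finset.sum_div, ← Finset.mul_sum]
    rfl
  rw [← T.sum_meshFaces_adjacent fun K e => (SignType.sign (outwardNormal K.1 e 0) : ℝ) *
        shadowIntegral e (evalAt (MvPolynomial.X 0 * u K ^ 2))] at hsum
  have hfsum := Finset.sum_le_sum hface
  rw [Finset.sum_add_distrib, ← Finset.mul_sum, ← Finset.mul_sum, sum_meshFaces_adjacent_const]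
    at hfsum
  change _ ≤ M ^ 2 / (4 * δ) * T.jumpSq u + δ * (2 * C * ω) * ((n + 2) * T.l2Sq u) at hfsum
  have h6 : δ * (2 * C * ω) * ((n + 2) * T.l2Sq u) = T.l2Sq u / 4 := by
    rw [hδ]; field_simp; ring
  rw [h6] at hfsum
  have h7 : M ^ 2 / (2 * δ) = 2 * (M ^ 2 / (4 * δ)) := by field_simp; norm_num
  rw [h7]
  have h8 : 0 ≤ M ^ 2 / (4 * δ) := by positivity
  nlinarith [T.gradSq_nonneg (u := u), T.jumpSq_nonneg (u := u),
    mul_nonneg h8 (T.gradSq_nonneg (u := u)),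
    mul_nonneg (sq_nonneg M) (T.jumpSq_nonneg (u := u))]

/-! ### The constrained least squares reconstruction. -/

namespace Triangulation

variable {d : ℕ} {Ω : Set (EuclideanSpace ℝ (Fin d))} {T : Triangulation Ω} {m N : ℕ} {Cσ : ℝ}

section Reconstruction

/-- Evaluation of polynomials at the barycenters of a finite family of elements. -/
noncomputable def evalBarycenters (s : Finset T.Elem) :
    MvPolynomial (Fin d) ℝ →ₗ[ℝ] (s → ℝ) where
  toFun p K' := evalAt p (barycenter K'.1.1)
  map_add' p q := by ext; simp
  map_smul' c p := by ext; simp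

/-- Subtracting the constant v_K makes the constraint linear, and the minimizer is the orthogonal
projection of the data onto the vectors of values of admissible polynomials. Existence needs no
unisolvence. -/
lemma exists_isLocalFit (m N : ℕ) (K : T.Elem) (v : T.Elem → ℝ) :
    ∃ p, T.IsLocalFit m N K v p := by
  let Ev : MvPolynomial (Fin d) ℝ →ₗ[ℝ] EuclideanSpace ℝ (T.patch N K) :=
    (WithLp.linearEquiv 2 ℝ (T.patch N K → ℝ)).symm.toLinearMap ∘ₗ evalBarycenters (T.patch N K)
  have hEv : ∀ p K', Ev p K' = evalAt p (barycenter K'.1.1) := fun p K' => rfl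
  let at₀ : MvPolynomial (Fin d) ℝ →ₗ[ℝ] ℝ :=
    { toFun := fun p => evalAt p (barycenter K.1)
      map_add' := by simp
      map_smul' := by simp }
  let W : Submodule ℝ (MvPolynomial (Fin d) ℝ) := PolySpace d m ⊓ LinearMap.ker at₀
  let S := W.map Ev
  let y : EuclideanSpace ℝ (T.patch N K) := WithLp.toLp 2 fun K' => v K'.1 - v K
  obtain ⟨w₀, hw₀, hw₀y⟩ : ∃ w ∈ W, Ev w = S.starProjection y := by
    have := Submodule.starProjection_apply_mem S y
    exact this
  have hlsq : ∀ w, T.lsqFunctional N K v (w + MvPolynomial.C (v K)) = ‖y - Ev w‖ ^ 2 := by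
    intro w
    rw [EuclideanSpace.norm_sq_eq, lsqFunctional, ← Finset.sum_coe_sort]
    refine Finset.sum_congr rfl fun K' _ => ?_
    rw [PiLp.sub_apply, hEv, Real.norm_eq_abs, sq_abs]
    simp only [y, evalAt_add, evalAt_C]
    ring
  have hmin : ∀ w ∈ W, ‖y - Ev w₀‖ ≤ ‖y - Ev w‖ := by
    intro w hw
    rw [hw₀y, Submodule.starProjection_minimal]
    exact ciInf_le (f := fun x : S => ‖y - x‖) ⟨0, by rintro _ ⟨_, rfl⟩; exact norm_nonneg _⟩
      ⟨Ev w, Submodule.mem_map_of_mem hw⟩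
  have hw₀0 : evalAt w₀ (barycenter K.1) = 0 := hw₀.2
  refine ⟨w₀ + MvPolynomial.C (v K), Submodule.add_mem _ hw₀.1 (C_mem_polySpace m _), ?_,
    fun q hq hqK => ?_⟩
  · simp [hw₀0]
  · have hqW : q - MvPolynomial.C (v K) ∈ W := by
      refine ⟨Submodule.sub_mem _ hq (C_mem_polySpace m _), ?_⟩
      change evalAt (q - MvPolynomial.C (v K)) (barycenter K.1) = 0
      simp [hqK]
    have h1 := hlsq (q - MvPolynomial.C (v K))
    rw [sub_add_cancel] at h1
    rw [hlsq, h1]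
    exact pow_le_pow_left₀ (norm_nonneg _) (hmin _ hqW) 2

lemma isLocalFit_basisFun (m N : ℕ) (i K : T.Elem) :
    T.IsLocalFit m N K (Pi.single i 1) (T.basisFun m N i K) := by
  have h := exists_isLocalFit m N K (Pi.single i (1 : ℝ) : T.Elem → ℝ)
  unfold basisFun reconstruct
  rw [dif_pos h]
  exact h.choose_spec

lemma basisFun_mem (m N : ℕ) (i K : T.Elem) : T.basisFun m N i K ∈ PolySpace d m :=
  (isLocalFit_basisFun m N i K).1

lemma evalAt_basisFun_self (m N : ℕ) (i K : T.Elem) :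
    evalAt (T.basisFun m N i K) (barycenter K.1) = (Pi.single i 1 : T.Elem → ℝ) K :=
  (isLocalFit_basisFun m N i K).2.1

lemma sq_sub_le_lsqFunctional {K K' : T.Elem} (hK' : K' ∈ T.patch N K) (v : T.Elem → ℝ)
    (p : MvPolynomial (Fin d) ℝ) :
    (evalAt p (barycenter K'.1) - v K') ^ 2 ≤ T.lsqFunctional N K v p :=
  Finset.single_le_sum (f := fun K' : T.Elem => (evalAt p (barycenter K'.1) - v K') ^ 2)
    (fun _ _ => sq_nonneg _) hK'

/-- The data vanish on the patch, so the zero polynomial is admissible with zero residual, and every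
minimizer interpolates zero. -/
lemma evalAt_basisFun_of_notMem {i K K' : T.Elem} (hi : i ∉ T.patch N K)
    (hK' : K' ∈ T.patch N K) : evalAt (T.basisFun m N i K) (barycenter K'.1) = 0 := by
  obtain ⟨-, -, hmin⟩ := isLocalFit_basisFun m N i K
  have hv : ∀ L ∈ T.patch N K, (Pi.single i 1 : T.Elem → ℝ) L = 0 := fun L hL =>
    Pi.single_eq_of_ne (by rintro rfl; exact hi hL) _
  have h1 := hmin 0 (Submodule.zero_mem _) (by rw [evalAt_zero, hv K (self_mem_patch N K)])
  have h2 : T.lsqFunctional N K (Pi.single i 1) 0 = 0 :=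
    Finset.sum_eq_zero fun L hL => by rw [evalAt_zero, hv L hL]; norm_num
  have h3 := sq_sub_le_lsqFunctional hK' (Pi.single i 1) (T.basisFun m N i K)
  rw [hv K' hK', sub_zero] at h3
  exact pow_eq_zero_iff two_ne_zero |>.1 (le_antisymm (by linarith) (sq_nonneg _))

/-- The competitor is the constant v_K: the data are 0 or 1, so its residual, hence the minimal one,
is at most the patch size. -/
lemma abs_evalAt_basisFun_le (m : ℕ) (i : T.Elem) {K K' : T.Elem} (hK' : K' ∈ T.patch N K) :
    |evalAt (T.basisFun m N i K) (barycenter K'.1)| ≤ 1 + (T.patch N K).card := by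
  obtain ⟨-, -, hmin⟩ := isLocalFit_basisFun m N i K
  set v : T.Elem → ℝ := Pi.single i 1 with hv
  have hv01 : ∀ L, v L = 0 ∨ v L = 1 := by
    intro L
    by_cases h : L = i
    · right; rw [hv, h, Pi.single_eq_same]
    · left; exact Pi.single_eq_of_ne h _
  have h1 := hmin (MvPolynomial.C (v K)) (C_mem_polySpace m _) (evalAt_C _ _)
  have h2 : T.lsqFunctional N K v (MvPolynomial.C (v K)) ≤ (T.patch N K).card := by
    rw [lsqFunctional, Finset.card_eq_sum_ones, Nat.cast_sum]
    refine Finset.sum_le_sum fun L _ => ?_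
    rw [evalAt_C]
    rcases hv01 K with h | h <;> rcases hv01 L with h' | h' <;> rw [h, h'] <;> norm_num
  have h3 := (sq_sub_le_lsqFunctional hK' v (T.basisFun m N i K)).trans (h1.trans h2)
  have h4 : (1 : ℝ) ≤ (T.patch N K).card := by
    exact_mod_cast Finset.card_pos.2 ⟨K, self_mem_patch N K⟩
  have h5 : |evalAt (T.basisFun m N i K) (barycenter K'.1) - v K'| ≤ (T.patch N K).card :=
    abs_le_of_sq_le_sq (h3.trans (by nlinarith)) (by linarith)
  rw [abs_le] at h5 ⊢
  rcases hv01 K' with h | h <;> rw [h] at h5 <;> constructor <;> linarith [h5.1, h5.2]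

variable (m N) in
/-- The reconstructed function with the given degrees of freedom. -/
noncomputable def combine (v : T.Elem → ℝ) : T.Elem → MvPolynomial (Fin d) ℝ :=
  ∑ i, v i • T.basisFun m N i

lemma combine_apply (v : T.Elem → ℝ) (K : T.Elem) :
    T.combine m N v K = ∑ i, v i • T.basisFun m N i K := by
  simp [combine]

lemma combine_mem (v : T.Elem → ℝ) (K : T.Elem) : T.combine m N v K ∈ PolySpace d m := by
  rw [combine_apply]
  exact Submodule.sum_mem _ fun i _ => Submodule.smul_mem _ _ (basisFun_mem m N i K)

lemma evalAt_combine (v : T.Elem → ℝ) (K : T.Elem) (x : EuclideanSpace ℝ (Fin d)) :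
    evalAt (T.combine m N v K) x = ∑ i, v i * evalAt (T.basisFun m N i K) x := by
  rw [combine_apply, evalAt_sum]; simp

lemma evalAt_combine_barycenter (v : T.Elem → ℝ) (K : T.Elem) :
    evalAt (T.combine m N v K) (barycenter K.1) = v K := by
  rw [evalAt_combine]
  simp_rw [evalAt_basisFun_self]
  rw [Finset.sum_eq_single K]
  · simp
  · exact fun i _ hi => by rw [Pi.single_eq_of_ne hi.symm, mul_zero]
  · simp

lemma abs_evalAt_combine_le (v : T.Elem → ℝ) {K K' : T.Elem} (hK' : K' ∈ T.patch N K) :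
    |evalAt (T.combine m N v K) (barycenter K'.1)| ≤
      (1 + (T.patch N K).card) * ∑ i ∈ T.patch N K, |v i| := by
  rw [evalAt_combine, ← Finset.sum_subset (Finset.subset_univ (T.patch N K)) fun i _ hi => by
    rw [evalAt_basisFun_of_notMem hi hK', mul_zero]]
  refine (Finset.abs_sum_le_sum_abs _ _).trans ?_
  rw [Finset.mul_sum]
  refine Finset.sum_le_sum fun i _ => ?_
  rw [abs_mul, mul_comm]
  exact mul_le_mul_of_nonneg_right (abs_evalAt_basisFun_le m i hK') (abs_nonneg _)

end Reconstruction

/-! ### From collocation points to the whole element: the Lebesgue constant. -/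

section Lebesgue

lemma isCompact_patchRegion (N : ℕ) (K : T.Elem) : IsCompact (T.patchRegion N K) :=
  (T.patch N K).isCompact_biUnion fun _ _ => isCompact_simplex _

lemma simplex_subset_patchRegion (N : ℕ) (K : T.Elem) : simplex K.1 ⊆ T.patchRegion N K :=
  Set.subset_biUnion_of_mem (u := fun K' : T.Elem => simplex K'.1) (self_mem_patch N K)

/-- The Lebesgue constant bounds a polynomial by its values at the collocation points. -/
lemma QuasiUniform.abs_evalAt_le (hT : T.QuasiUniform Cσ) (hd : 1 ≤ d) (hCσ : 0 < Cσ)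
    (hU : T.Unisolvent m N) (K : T.Elem) {p : MvPolynomial (Fin d) ℝ} (hp : p ∈ PolySpace d m)
    {B : ℝ} (hB : ∀ K' ∈ T.patch N K, |evalAt p (barycenter K'.1)| ≤ B)
    {x : EuclideanSpace ℝ (Fin d)} (hx : x ∈ simplex K.1) :
    |evalAt p x| ≤ T.lebesgueConst m N * B := by
  have hNe : Nonempty T.Elem := ⟨K⟩
  have hh := T.meshSize_pos hd
  set X := T.patchRegion N K with hX
  have hXc : IsCompact X := isCompact_patchRegion N K
  have : CompactSpace X := isCompact_iff_compactSpace.1 hXc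
  have hxX : x ∈ X := simplex_subset_patchRegion N K hx
  set ι : PolySpace d m →ₗ[ℝ] (T.patch N K → ℝ) :=
    (evalBarycenters (T.patch N K)).domRestrict (PolySpace d m) with hι
  have hιinj : Function.Injective ι := by
    rw [← LinearMap.ker_eq_bot, LinearMap.ker_eq_bot']
    intro q hq
    obtain ⟨z, hz⟩ := hT.exists_center hd hCσ K
    refine Subtype.ext (eq_zero_of_evalAt_eq_zero_on_ball (z := z)
      (r := T.meshSize / (2 * Cσ)) (by positivity) fun y hy => ?_)
    refine hU K q.1 q.2 (fun K' hK' => congrFun hq ⟨K', hK'⟩) y ?_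
    exact simplex_subset_patchRegion N K (hz (Metric.ball_subset_closedBall hy))
  obtain ⟨C, hC, hbound⟩ := exists_norm_le_of_injective ι hιinj
    ((evalOn X).domRestrict (PolySpace d m))
  set sX : PolySpace d m → ℝ := fun q => ⨆ x : X, |evalAt q.1 x.1| with hsX
  set sI : PolySpace d m → ℝ := fun q => ⨆ K' : T.patch N K, |evalAt q.1 (barycenter K'.1.1)|
    with hsI
  have hK₀ : Nonempty (T.patch N K) := ⟨⟨K, self_mem_patch N K⟩⟩
  have hX₀ : Nonempty X := ⟨⟨x, hxX⟩⟩
  have hle : ∀ (q : PolySpace d m) (y : X), |evalAt q.1 y.1| ≤ ‖evalOn X q.1‖ := fun q y =>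
    ContinuousMap.norm_coe_le_norm (evalOn X q.1) y
  have hsXle : ∀ q, sX q ≤ ‖evalOn X q.1‖ := fun q => ciSup_le (hle q)
  have hlesX : ∀ (q : PolySpace d m) (y : X), |evalAt q.1 y.1| ≤ sX q := fun q y =>
    le_ciSup (f := fun x : X => |evalAt q.1 x.1|)
      ⟨‖evalOn X q.1‖, by rintro _ ⟨y, rfl⟩; exact hle q y⟩ y
  have hlesI : ∀ (q : PolySpace d m) (K' : T.patch N K),
      |evalAt q.1 (barycenter K'.1.1)| ≤ sI q := fun q K' =>
    le_ciSup (f := fun K' : T.patch N K => |evalAt q.1 (barycenter K'.1.1)|)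
      (Set.finite_range _).bddAbove K'
  have hsI0 : ∀ q, 0 ≤ sI q := fun q => Real.iSup_nonneg fun _ => abs_nonneg _
  have hιle : ∀ q, ‖ι q‖ ≤ sI q := fun q =>
    (pi_norm_le_iff_of_nonneg (hsI0 q)).2 fun K' => hlesI q K'
  -- A real `⨆` over an unbounded family would be 0 and bound nothing, so the quotients must first
  -- be shown bounded; unisolvence gives this through injectivity of ι.
  have hratio : ∀ q, sX q / sI q ≤ C := by
    intro q
    refine div_le_of_le_mul₀ (hsI0 q) hC.le ?_
    exact (hsXle q).trans ((hbound q).trans (mul_le_mul_of_nonneg_left (hιle q) hC.le))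
  have hloc : ∀ q, sX q / sI q ≤ T.lebesgueConst m N := fun q =>
    (le_ciSup (f := fun q => sX q / sI q) ⟨C, by rintro _ ⟨q, rfl⟩; exact hratio q⟩ q).trans
      (le_ciSup (f := fun K => T.localLebesgue m N K) (Set.finite_range _).bddAbove K)
  have hΛ : 0 ≤ T.lebesgueConst m N := by
    refine (div_nonneg ?_ (hsI0 0)).trans (hloc 0)
    exact Real.iSup_nonneg fun _ => abs_nonneg _
  have hsIB : sI ⟨p, hp⟩ ≤ B := ciSup_le fun K' => hB K'.1 K'.2
  refine le_trans ?_ (mul_le_mul_of_nonneg_left hsIB hΛ)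
  refine (hlesX ⟨p, hp⟩ ⟨x, hxX⟩).trans ?_
  -- If all collocation values vanish, the quotient is 0 by the convention for division and carries
  -- no information; the bound from injectivity shows that p vanishes on the patch.
  rcases (hsI0 ⟨p, hp⟩).eq_or_lt with h0 | h0
  · have h1 : ‖ι ⟨p, hp⟩‖ ≤ 0 := h0 ▸ hιle ⟨p, hp⟩
    have h2 := (hsXle ⟨p, hp⟩).trans ((hbound ⟨p, hp⟩).trans
      (mul_le_mul_of_nonneg_left h1 hC.le))
    rw [← h0]; simpa using h2
  · exact (div_le_iff₀ h0).1 (hloc ⟨p, hp⟩)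

end Lebesgue

/-! ### Two-sided bounds for the mass matrix. -/

section Mass

variable {n : ℕ} {Ω : Set (EuclideanSpace ℝ (Fin (n + 1)))} {T : Triangulation Ω}

lemma dotProduct_massMatrix (m N : ℕ) (v : T.Elem → ℝ) :
    v ⬝ᵥ (T.massMatrix m N *ᵥ v) = T.l2Sq (T.combine m N v) := by
  have hint : ∀ i j K : T.Elem, IntegrableOn (fun x => v i * v j *
      (evalAt (T.basisFun m N i K) x * evalAt (T.basisFun m N j K) x)) (simplex K.1) :=
    fun i j K => integrableOn_elem
      (continuous_const.mul ((continuous_evalAt _).mul (continuous_evalAt _)))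
  have hexp : ∀ K : T.Elem, ∫ x in simplex K.1, evalAt (T.combine m N v K) x ^ 2 =
      ∑ i, ∑ j, v i * v j *
        ∫ x in simplex K.1, evalAt (T.basisFun m N i K) x * evalAt (T.basisFun m N j K) x := by
    intro K
    simp_rw [← integral_const_mul]
    rw [Finset.sum_congr rfl fun i _ => (integral_finsetSum _ fun j _ => hint i j K).symm,
      ← integral_finsetSum _ fun i _ => integrable_finsetSum _ fun j _ => hint i j K]
    refine integral_congr_ae (Filter.Eventually.of_forall fun x => ?_)
    simp only [evalAt_combine, pow_two, Finset.sum_mul_sum]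
    exact Finset.sum_congr rfl fun i _ => Finset.sum_congr rfl fun j _ => by ring
  rw [l2Sq, Finset.sum_congr rfl fun K _ => hexp K, Finset.sum_comm, dotProduct]
  refine Finset.sum_congr rfl fun i _ => ?_
  rw [Finset.sum_comm, mulVec, dotProduct, Finset.mul_sum]
  refine Finset.sum_congr rfl fun j _ => ?_
  rw [massMatrix, Matrix.of_apply, ← Finset.mul_sum]
  ring

/-- Each degree of freedom is the value of the reconstruction at the barycenter of its own element,
so the inverse estimate bounds it by the L² norm there. The constant is independent of N. -/
lemma exists_le_l2Sq_combine (m : ℕ) (hCσ : 0 < Cσ) :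
    ∃ c : ℝ, 0 < c ∧ ∀ (Ω : Set (EuclideanSpace ℝ (Fin (n + 1)))) (T : Triangulation Ω),
      T.QuasiUniform Cσ → ∀ (N : ℕ) (v : T.Elem → ℝ),
      c * T.meshSize ^ (n + 1) * (v ⬝ᵥ v) ≤ T.l2Sq (T.combine m N v) := by
  obtain ⟨C, hC, hinv⟩ := exists_inverse_estimate (n + 1) m (by omega) hCσ
  refine ⟨C⁻¹, by positivity, fun Ω T hT N v => ?_⟩
  rw [dotProduct, Finset.mul_sum]
  refine Finset.sum_le_sum fun K _ => ?_
  have : Nonempty T.Elem := ⟨K⟩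
  have hh := T.meshSize_pos (by omega)
  have h1 := hinv Ω T hT K _ (combine_mem (N := N) v K) _
    (barycenter_mem_simplex (Elem.nonempty T K))
  rw [evalAt_combine_barycenter] at h1
  rw [← pow_two, mul_assoc, inv_mul_le_iff₀ hC, ← le_inv_mul_iff₀ (by positivity)]
  refine h1.trans (le_of_eq (by ring))

lemma exists_l2Sq_combine_le (m N : ℕ) (hCσ : 0 < Cσ) :
    ∃ C : ℝ, 0 < C ∧ ∀ (Ω : Set (EuclideanSpace ℝ (Fin (n + 1)))) (T : Triangulation Ω),
      T.QuasiUniform Cσ → T.Unisolvent m N → ∀ v : T.Elem → ℝ,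
      T.l2Sq (T.combine m N v) ≤
        C * T.lebesgueConst m N ^ 2 * T.meshSize ^ (n + 1) * (v ⬝ᵥ v) := by
  set c : ℕ := ⌈(4 * Cσ) ^ (n + 1)⌉₊ ^ N with hc
  set ω := volume.real (Metric.closedBall (0 : EuclideanSpace ℝ (Fin (n + 1))) 1) with hω
  have hω0 : 0 < ω := volume_unitBall_pos (n + 1)
  refine ⟨ω * (1 + c) ^ 2 * c * c + 1, by positivity, fun Ω T hT hU v => ?_⟩
  set Λ := T.lebesgueConst m N
  have hcell : ∀ K : T.Elem, ∫ x in simplex K.1, evalAt (T.combine m N v K) x ^ 2 ≤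
      ω * (1 + c) ^ 2 * c * Λ ^ 2 * T.meshSize ^ (n + 1) * ∑ i ∈ T.patch N K, v i ^ 2 := by
    intro K
    have : Nonempty T.Elem := ⟨K⟩
    have hh := T.meshSize_pos (by omega)
    have hcard : ((T.patch N K).card : ℝ) ≤ c := by
      exact_mod_cast hT.card_patch_le (by omega) hCσ N K
    have hV := volume_simplex_le (T := T) (by omega) K
    set S := ∑ i ∈ T.patch N K, v i ^ 2 with hS
    have hS0 : 0 ≤ S := Finset.sum_nonneg fun _ _ => sq_nonneg _
    have hpt : ∀ x ∈ simplex K.1, evalAt (T.combine m N v K) x ^ 2 ≤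
        Λ ^ 2 * ((1 + c) ^ 2 * (c * S)) := by
      intro x hx
      have h1 := hT.abs_evalAt_le (by omega) hCσ hU K (combine_mem v K)
        (fun K' hK' => abs_evalAt_combine_le v hK') hx
      rw [← sq_abs]
      refine (pow_le_pow_left₀ (abs_nonneg _) h1 2).trans ?_
      rw [mul_pow, mul_pow]
      refine mul_le_mul_of_nonneg_left ?_ (sq_nonneg _)
      refine mul_le_mul (by gcongr) ?_ (sq_nonneg _) (by positivity)
      refine sq_sum_le_card_mul_sum_sq.trans ?_
      simp only [sq_abs]
      exact mul_le_mul_of_nonneg_right hcard hS0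
    refine (setIntegral_mono_on (integrableOn_elem (continuous_evalAt_sq _))
      (integrableOn_elem (continuous_const (y := Λ ^ 2 * ((1 + c) ^ 2 * (c * S)))))
      (measurableSet_simplex _) hpt).trans ?_
    rw [setIntegral_const, smul_eq_mul]
    refine (mul_le_mul_of_nonneg_right hV (by positivity)).trans (le_of_eq ?_)
    ring
  -- Bounded overlap: after exchanging the sums, each i is counted once for every patch that
  -- contains it.
  have hsum : ∑ K : T.Elem, ∑ i ∈ T.patch N K, v i ^ 2 ≤ c * (v ⬝ᵥ v) := by
    rw [Finset.sum_comm' (s' := fun i => Finset.univ.filter fun K => i ∈ T.patch N K)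
      (t' := Finset.univ) (by simp), dotProduct, Finset.mul_sum]
    refine Finset.sum_le_sum fun i _ => ?_
    rw [Finset.sum_const, nsmul_eq_mul, ← pow_two]
    refine mul_le_mul_of_nonneg_right ?_ (sq_nonneg _)
    exact_mod_cast hT.card_filter_mem_patch_le (by omega) hCσ N i
  have hh : 0 ≤ T.meshSize := Real.iSup_nonneg fun _ => Metric.diam_nonneg
  have hvv : 0 ≤ v ⬝ᵥ v := Finset.sum_nonneg fun i _ => mul_self_nonneg _
  calc T.l2Sq (T.combine m N v) ≤ ∑ K : T.Elem, ω * (1 + c) ^ 2 * c * Λ ^ 2 *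
        T.meshSize ^ (n + 1) * ∑ i ∈ T.patch N K, v i ^ 2 := Finset.sum_le_sum fun K _ => hcell K
    _ = ω * (1 + c) ^ 2 * c * Λ ^ 2 * T.meshSize ^ (n + 1) *
        ∑ K : T.Elem, ∑ i ∈ T.patch N K, v i ^ 2 := by rw [Finset.mul_sum]
    _ ≤ ω * (1 + c) ^ 2 * c * Λ ^ 2 * T.meshSize ^ (n + 1) * (c * (v ⬝ᵥ v)) := by gcongr
    _ = (ω * (1 + c) ^ 2 * c * c) * (Λ ^ 2 * T.meshSize ^ (n + 1) * (v ⬝ᵥ v)) := by ring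
    _ ≤ (ω * (1 + c) ^ 2 * c * c + 1) * (Λ ^ 2 * T.meshSize ^ (n + 1) * (v ⬝ᵥ v)) := by
        gcongr; linarith
    _ = _ := by ring

end Mass

end Triangulation

/-! ### Condition numbers of coercive matrices. -/

section ConditionNumber

variable {ι : Type*} [Fintype ι] [DecidableEq ι]

lemma inner_toEuclideanCLM (A : Matrix ι ι ℝ) (x y : EuclideanSpace ℝ ι) :
    inner ℝ x (Matrix.toEuclideanCLM (𝕜 := ℝ) A y) = x.ofLp ⬝ᵥ (A *ᵥ y.ofLp) := by
  rw [EuclideanSpace.inner_eq_star_dotProduct, Matrix.ofLp_toEuclideanCLM, dotProduct_comm]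
  simp

omit [DecidableEq ι] in
lemma inner_self_eq_dotProduct (x : EuclideanSpace ℝ ι) : ‖x‖ ^ 2 = x.ofLp ⬝ᵥ x.ofLp := by
  rw [← real_inner_self_eq_norm_sq, EuclideanSpace.inner_eq_star_dotProduct]
  simp

/-- A coercive bounded matrix is invertible, with the expected bound on its condition number. -/
lemma isUnit_and_condNumber_le {A : Matrix ι ι ℝ} {β B : ℝ} (hβ : 0 < β) (hB : 0 ≤ B)
    (hcoer : ∀ v : ι → ℝ, β * (v ⬝ᵥ v) ≤ v ⬝ᵥ (A *ᵥ v))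
    (hbdd : ∀ w v : ι → ℝ, w ⬝ᵥ (A *ᵥ v) ≤ B * (w ⬝ᵥ w + v ⬝ᵥ v)) :
    IsUnit A ∧ condNumber A ≤ 2 * B / β := by
  have hu : IsUnit A := by
    rw [← Matrix.mulVec_injective_iff_isUnit]
    intro v w hvw
    have h0 : A *ᵥ (v - w) = 0 := by rw [Matrix.mulVec_sub]; exact sub_eq_zero.2 hvw
    have h1 := hcoer (v - w)
    rw [h0, dotProduct_zero] at h1
    have h2 : (v - w) ⬝ᵥ (v - w) = 0 :=
      le_antisymm (nonpos_of_mul_nonpos_right h1 hβ)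
        (Finset.sum_nonneg fun i _ => mul_self_nonneg _)
    exact sub_eq_zero.1 (dotProduct_self_eq_zero.1 h2)
  refine ⟨hu, ?_⟩
  have hn1 : ‖Matrix.toEuclideanCLM (𝕜 := ℝ) A‖ ≤ 2 * B := by
    refine ContinuousLinearMap.opNorm_le_bound _ (by positivity) fun x => ?_
    set y := Matrix.toEuclideanCLM (𝕜 := ℝ) A x with hy
    rcases eq_or_ne y 0 with h0 | h0
    · rw [h0, norm_zero]; positivity
    have hy0 : 0 < ‖y‖ := norm_pos_iff.2 h0
    have hx0 : 0 < ‖x‖ := norm_pos_iff.2 (by rintro rfl; exact h0 (by rw [hy, map_zero]))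
    -- Testing with the multiple of y = Ax that has the norm of x balances the two squares, turning
    -- the additive bound into ‖y‖ ≤ 2B‖x‖.
    have h1 := hbdd ((‖x‖ / ‖y‖) • y).ofLp x.ofLp
    rw [← inner_toEuclideanCLM, ← hy, ← inner_self_eq_dotProduct, ← inner_self_eq_dotProduct,
      real_inner_smul_left, real_inner_self_eq_norm_sq, norm_smul,
      Real.norm_of_nonneg (by positivity : 0 ≤ ‖x‖ / ‖y‖), div_mul_cancel₀ _ hy0.ne'] at h1
    have h2 : ‖x‖ / ‖y‖ * ‖y‖ ^ 2 = ‖x‖ * ‖y‖ := by field_simp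
    rw [h2] at h1
    refine le_of_mul_le_mul_left ?_ hx0
    linarith
  have hn2 : ‖Matrix.toEuclideanCLM (𝕜 := ℝ) A⁻¹‖ ≤ 1 / β := by
    refine ContinuousLinearMap.opNorm_le_bound _ (by positivity) fun y => ?_
    set x := Matrix.toEuclideanCLM (𝕜 := ℝ) A⁻¹ y with hx
    have hxy : Matrix.toEuclideanCLM (𝕜 := ℝ) A x = y := by
      rw [hx, ← mul_apply_eq_comp, ← map_mul,
        Matrix.mul_nonsing_inv _ ((Matrix.isUnit_iff_isUnit_det A).1 hu), map_one,
        one_apply_eq_self]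
    have h1 := hcoer x.ofLp
    rw [← inner_toEuclideanCLM, ← inner_self_eq_dotProduct, hxy] at h1
    have h2 := h1.trans (real_inner_le_norm x y)
    rw [one_div, ← div_eq_inv_mul, le_div_iff₀ hβ]
    rcases (norm_nonneg x).eq_or_lt with h0 | h0
    · rw [← h0]; simp
    · exact le_of_mul_le_mul_left (by linarith) h0
  calc condNumber A ≤ 2 * B * (1 / β) := mul_le_mul hn1 hn2 (norm_nonneg _) (by positivity)
    _ = 2 * B / β := by ring

lemma exists_coercive_of_posDef [Nonempty ι] {A : Matrix ι ι ℝ} (hA : A.PosDef) :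
    ∃ α : ℝ, 0 < α ∧ ∀ x : EuclideanSpace ℝ ι,
      α * ‖x‖ ^ 2 ≤ inner ℝ (Matrix.toEuclideanCLM (𝕜 := ℝ) A x) x := by
  have hcont : Continuous fun x : EuclideanSpace ℝ ι =>
      (inner ℝ (Matrix.toEuclideanCLM (𝕜 := ℝ) A x) x : ℝ) := by fun_prop
  obtain ⟨x₀, hx₀, hmin⟩ := (isCompact_sphere (0 : EuclideanSpace ℝ ι) 1).exists_isMinOn
    (NormedSpace.sphere_nonempty.2 zero_le_one) hcont.continuousOn
  have hx₀1 : ‖x₀‖ = 1 := by simpa using hx₀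
  refine ⟨inner ℝ (Matrix.toEuclideanCLM (𝕜 := ℝ) A x₀) x₀, ?_, fun x => ?_⟩
  · rw [real_inner_comm, inner_toEuclideanCLM]
    have := hA.dotProduct_mulVec_pos (x := x₀.ofLp) (fun h => by
      have : x₀ = 0 := by ext i; exact congrFun h i
      rw [this] at hx₀1; simp at hx₀1)
    simpa using this
  · rcases eq_or_ne x 0 with rfl | hx
    · simp
    have hn : 0 < ‖x‖ := norm_pos_iff.2 hx
    have h1 : ‖x‖⁻¹ • x ∈ Metric.sphere (0 : EuclideanSpace ℝ ι) 1 := by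
      simp [norm_smul, hn.ne']
    have h2 := hmin h1
    simp only [Set.mem_ofPred_eq, map_smul, real_inner_smul_left, real_inner_smul_right] at h2
    have h3 : ‖x‖⁻¹ * (‖x‖⁻¹ * inner ℝ (Matrix.toEuclideanCLM (𝕜 := ℝ) A x) x) =
        inner ℝ (Matrix.toEuclideanCLM (𝕜 := ℝ) A x) x / ‖x‖ ^ 2 := by field_simp
    rw [h3] at h2
    exact (le_div_iff₀ (by positivity)).1 h2

end ConditionNumber

/-! ### The interior penalty form, its bilinearity and pointwise face bounds. -/

namespace Triangulation

variable {n : ℕ} {Ω : Set (EuclideanSpace ℝ (Fin (n + 1)))} {T : Triangulation Ω}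

section Form

lemma exists_bilinear_integral {U E : Type*} [AddCommGroup U] [Module ℝ U]
    [TopologicalSpace E] [MeasurableSpace E] [BorelSpace E] [T2Space E] {F : Type*}
    [NormedAddCommGroup F] [InnerProductSpace ℝ F] {ν : Measure E} {s : Set E}
    (hs : ∀ f : E → ℝ, Continuous f → IntegrableOn f s ν) (c : ℝ) (f g : U →ₗ[ℝ] (E → F))
    (hf : ∀ u, Continuous (f u)) (hg : ∀ u, Continuous (g u)) :
    ∃ B : U →ₗ[ℝ] U →ₗ[ℝ] ℝ, ∀ u v, B u v = ∫ x in s, c * inner ℝ (f u x) (g v x) ∂ν := by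
  have hi : ∀ u v, IntegrableOn (fun x => c * inner ℝ (f u x) (g v x)) s ν := fun u v =>
    hs _ (continuous_const.mul ((hf u).inner (hg v)))
  refine ⟨LinearMap.mk₂ ℝ (fun u v => ∫ x in s, c * inner ℝ (f u x) (g v x) ∂ν) ?_ ?_ ?_ ?_,
    fun u v => rfl⟩
  · intro u u' v
    rw [← integral_add (hi u v) (hi u' v)]
    simp only [map_add, Pi.add_apply, inner_add_left, mul_add]
  · intro a u v
    rw [smul_eq_mul, ← integral_const_mul]
    simp only [map_smul, Pi.smul_apply, real_inner_smul_left]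
    congr 1; ext x; ring
  · intro u v v'
    rw [← integral_add (hi u v) (hi u v')]
    simp only [map_add, Pi.add_apply, inner_add_right, mul_add]
  · intro a u v
    rw [smul_eq_mul, ← integral_const_mul]
    simp only [map_smul, Pi.smul_apply, real_inner_smul_right]
    congr 1; ext x; ring

variable (T) in
/-- The jump as a linear map. -/
noncomputable def jumpLin (e : Finset (EuclideanSpace ℝ (Fin (n + 1)))) :
    (T.Elem → MvPolynomial (Fin (n + 1)) ℝ) →ₗ[ℝ]
      (EuclideanSpace ℝ (Fin (n + 1)) → EuclideanSpace ℝ (Fin (n + 1))) where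
  toFun u := T.jump u e
  map_add' u v := by
    funext x
    simp [jump, add_smul, Finset.sum_add_distrib]
  map_smul' c u := by
    funext x
    simp [jump, mul_smul, Finset.smul_sum]

variable (T) in
/-- The flux on an element as a linear map. -/
noncomputable def fluxLin (A : Matrix (Fin (n + 1)) (Fin (n + 1)) ℝ) (K : T.Elem) :
    (T.Elem → MvPolynomial (Fin (n + 1)) ℝ) →ₗ[ℝ]
      (EuclideanSpace ℝ (Fin (n + 1)) → EuclideanSpace ℝ (Fin (n + 1))) where
  toFun u := fun x => Matrix.toEuclideanCLM (𝕜 := ℝ) A (gradAt (u K) x)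
  map_add' u v := by
    funext x
    simp only [Pi.add_apply, gradAt_add, map_add]
  map_smul' c u := by
    funext x
    simp only [Pi.smul_apply, gradAt_smul, map_smul, RingHom.id_apply]

lemma continuous_fluxLin (A : Matrix (Fin (n + 1)) (Fin (n + 1)) ℝ) (K : T.Elem)
    (u : T.Elem → MvPolynomial (Fin (n + 1)) ℝ) : Continuous (T.fluxLin A K u) :=
  (Matrix.toEuclideanCLM (𝕜 := ℝ) A).continuous.comp (continuous_gradAt (u K))

variable (T) in
/-- The gradient on an element as a linear map. -/
noncomputable def gradLin (K : T.Elem) :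
    (T.Elem → MvPolynomial (Fin (n + 1)) ℝ) →ₗ[ℝ]
      (EuclideanSpace ℝ (Fin (n + 1)) → EuclideanSpace ℝ (Fin (n + 1))) where
  toFun u := gradAt (u K)
  map_add' u v := by
    funext x
    simp only [Pi.add_apply, gradAt_add]
  map_smul' c u := by
    funext x
    simp only [Pi.smul_apply, gradAt_smul, RingHom.id_apply]

lemma fluxAverage_eq (A : Matrix (Fin (n + 1)) (Fin (n + 1)) ℝ)
    (u : T.Elem → MvPolynomial (Fin (n + 1)) ℝ) (e : Finset (EuclideanSpace ℝ (Fin (n + 1)))) :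
    T.fluxAverage A u e =
      (((T.adjacent e).card : ℝ)⁻¹ • ∑ K ∈ T.adjacent e, T.fluxLin A K) u := by
  funext x
  simp [fluxAverage, fluxLin]

lemma continuous_fluxAverage (A : Matrix (Fin (n + 1)) (Fin (n + 1)) ℝ)
    (u : T.Elem → MvPolynomial (Fin (n + 1)) ℝ) (e : Finset (EuclideanSpace ℝ (Fin (n + 1)))) :
    Continuous (T.fluxAverage A u e) := by
  have h : Continuous fun x => ∑ K ∈ T.adjacent e, T.fluxLin A K u x :=
    continuous_finsetSum _ fun K _ => continuous_fluxLin A K u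
  exact h.const_smul ((T.adjacent e).card : ℝ)⁻¹

/-- The face term pairing average fluxes with jumps. -/
noncomputable def fluxTerm (T : Triangulation Ω) (A : Matrix (Fin (n + 1)) (Fin (n + 1)) ℝ)
    (u v : T.Elem → MvPolynomial (Fin (n + 1)) ℝ) : ℝ :=
  ∑ e ∈ T.meshFaces, ∫ x in simplex e, inner ℝ (T.fluxAverage A u e x) (T.jump v e x) ∂μHE[n]

/-- The element term of the interior penalty form. -/
noncomputable def cellTerm (T : Triangulation Ω) (A : Matrix (Fin (n + 1)) (Fin (n + 1)) ℝ)
    (u v : T.Elem → MvPolynomial (Fin (n + 1)) ℝ) : ℝ :=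
  ∑ K : T.Elem, ∫ x in simplex K.1,
      inner ℝ (Matrix.toEuclideanCLM (𝕜 := ℝ) A (gradAt (u K) x)) (gradAt (v K) x)

/-- The penalty term. -/
noncomputable def penaltyTerm (T : Triangulation Ω) (μ : ℝ)
    (u v : T.Elem → MvPolynomial (Fin (n + 1)) ℝ) : ℝ :=
  ∑ e ∈ T.meshFaces, ∫ x in simplex e,
        μ * (Metric.diam (simplex e))⁻¹ * inner ℝ (T.jump u e x) (T.jump v e x) ∂μHE[n]

lemma ipForm_eq (A : Matrix (Fin (n + 1)) (Fin (n + 1)) ℝ) (μ θ : ℝ)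
    (u v : T.Elem → MvPolynomial (Fin (n + 1)) ℝ) :
    T.ipForm A μ θ u v = T.cellTerm A u v - T.fluxTerm A u v + θ * T.fluxTerm A v u +
      T.penaltyTerm μ u v := rfl

lemma exists_bilinear_ipForm (T : Triangulation Ω) (A : Matrix (Fin (n + 1)) (Fin (n + 1)) ℝ)
    (μ θ : ℝ) :
    ∃ B : (T.Elem → MvPolynomial (Fin (n + 1)) ℝ) →ₗ[ℝ]
      (T.Elem → MvPolynomial (Fin (n + 1)) ℝ) →ₗ[ℝ] ℝ, ∀ u v, B u v = T.ipForm A μ θ u v := by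
  choose B₁ hB₁ using fun K : T.Elem => exists_bilinear_integral (ν := volume) (s := simplex K.1)
    (fun f hf => integrableOn_elem hf) 1 (T.fluxLin A K) (T.gradLin K)
    (continuous_fluxLin A K) (fun u => continuous_gradAt (u K))
  choose B₂ hB₂ using fun e : {e // e ∈ T.meshFaces} => exists_bilinear_integral (ν := μHE[n])
    (s := simplex e.1) (fun f hf => integrableOn_simplex_of_continuous (hausdorff_face_ne_top e.2) hf)
    1 (((T.adjacent e.1).card : ℝ)⁻¹ • ∑ K ∈ T.adjacent e.1, T.fluxLin A K) (T.jumpLin e.1)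
    (fun u => fluxAverage_eq A u e.1 ▸ continuous_fluxAverage A u e.1)
    (fun u => continuous_jump u e.1)
  choose B₃ hB₃ using fun e : {e // e ∈ T.meshFaces} => exists_bilinear_integral (ν := μHE[n])
    (s := simplex e.1) (fun f hf => integrableOn_simplex_of_continuous (hausdorff_face_ne_top e.2) hf)
    (μ * (Metric.diam (simplex e.1))⁻¹) (T.jumpLin e.1) (T.jumpLin e.1)
    (fun u => continuous_jump u e.1) (fun u => continuous_jump u e.1)
  refine ⟨∑ K, B₁ K - ∑ e, B₂ e + θ • (∑ e, B₂ e).flip + ∑ e, B₃ e, fun u v => ?_⟩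
  have h2 : ∀ u v, ∑ e, B₂ e u v = T.fluxTerm A u v := by
    intro u v
    rw [fluxTerm, ← Finset.sum_coe_sort T.meshFaces]
    refine Finset.sum_congr rfl fun e _ => ?_
    rw [hB₂, ← fluxAverage_eq]
    simp only [one_mul]
    rfl
  have h1 : ∑ K, B₁ K u v = T.cellTerm A u v := by
    refine Finset.sum_congr rfl fun K _ => ?_
    rw [hB₁]
    simp only [one_mul]
    rfl
  have h3 : ∑ e, B₃ e u v = T.penaltyTerm μ u v := by
    rw [penaltyTerm, ← Finset.sum_coe_sort T.meshFaces]
    refine Finset.sum_congr rfl fun e _ => ?_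
    rw [hB₃]
    rfl
  rw [ipForm_eq, ← h1, ← h2, ← h2, ← h3]
  simp only [LinearMap.add_apply, LinearMap.sub_apply, LinearMap.smul_apply, LinearMap.flip_apply,
    LinearMap.sum_apply, smul_eq_mul]

lemma dotProduct_stiffnessMatrix (m N : ℕ) (A : Matrix (Fin (n + 1)) (Fin (n + 1)) ℝ)
    (μ θ : ℝ) (w v : T.Elem → ℝ) :
    w ⬝ᵥ (T.stiffnessMatrix m N A μ θ *ᵥ v) =
      T.ipForm A μ θ (T.combine m N w) (T.combine m N v) := by
  obtain ⟨B, hB⟩ := T.exists_bilinear_ipForm A μ θ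
  have h1 : B (T.combine m N w) = ∑ i, w i • B (T.basisFun m N i) := by
    rw [combine, map_sum]
    simp only [map_smul]
  rw [← hB, h1, LinearMap.sum_apply, dotProduct]
  refine Finset.sum_congr rfl fun i _ => ?_
  rw [LinearMap.smul_apply, smul_eq_mul, combine, map_sum, mulVec, dotProduct]
  congr 1
  refine Finset.sum_congr rfl fun j _ => ?_
  rw [map_smul, hB, smul_eq_mul, mul_comm]
  rfl

end Form

section Bounds

variable {u v : T.Elem → MvPolynomial (Fin (n + 1)) ℝ}

lemma norm_jump_sq_le {e : Finset (EuclideanSpace ℝ (Fin (n + 1)))} (he : e ∈ T.meshFaces)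
    (u : T.Elem → MvPolynomial (Fin (n + 1)) ℝ) (x : EuclideanSpace ℝ (Fin (n + 1))) :
    ‖T.jump u e x‖ ^ 2 ≤ 2 * ∑ K ∈ T.adjacent e, evalAt (u K) x ^ 2 := by
  have h1 : ‖T.jump u e x‖ ≤ ∑ K ∈ T.adjacent e, |evalAt (u K) x| := by
    refine (norm_sum_le _ _).trans (Finset.sum_le_sum fun K hK => ?_)
    rw [norm_smul, T.norm_outwardNormal (by omega) (T.mem_meshFaces.1 he).2
      (T.mem_adjacent.1 hK), mul_one, Real.norm_eq_abs]
  refine (pow_le_pow_left₀ (norm_nonneg _) h1 2).trans (sq_sum_le_card_mul_sum_sq.trans ?_)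
  simp only [sq_abs]
  refine mul_le_mul_of_nonneg_right ?_ (Finset.sum_nonneg fun _ _ => sq_nonneg _)
  exact_mod_cast card_adjacent_le he

lemma norm_fluxAverage_sq_le (A : Matrix (Fin (n + 1)) (Fin (n + 1)) ℝ)
    (e : Finset (EuclideanSpace ℝ (Fin (n + 1))))
    (u : T.Elem → MvPolynomial (Fin (n + 1)) ℝ) (x : EuclideanSpace ℝ (Fin (n + 1))) :
    ‖T.fluxAverage A u e x‖ ^ 2 ≤
      ‖Matrix.toEuclideanCLM (𝕜 := ℝ) A‖ ^ 2 * ∑ K ∈ T.adjacent e, ‖gradAt (u K) x‖ ^ 2 := by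
  set a := ‖Matrix.toEuclideanCLM (𝕜 := ℝ) A‖
  set c : ℝ := ((T.adjacent e).card : ℝ) with hc
  have hS : 0 ≤ ∑ K ∈ T.adjacent e, ‖gradAt (u K) x‖ ^ 2 :=
    Finset.sum_nonneg fun _ _ => sq_nonneg _
  have h1 : ‖T.fluxAverage A u e x‖ ≤ c⁻¹ * (a * ∑ K ∈ T.adjacent e, ‖gradAt (u K) x‖) := by
    rw [fluxAverage, norm_smul, norm_inv, Real.norm_of_nonneg (Nat.cast_nonneg _), Finset.mul_sum]
    refine mul_le_mul_of_nonneg_left ((norm_sum_le _ _).trans (Finset.sum_le_sum fun K _ => ?_))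
      (inv_nonneg.2 (Nat.cast_nonneg _))
    exact ContinuousLinearMap.le_opNorm _ _
  refine (pow_le_pow_left₀ (norm_nonneg _) h1 2).trans ?_
  rw [mul_pow, mul_pow]
  have h2 : (∑ K ∈ T.adjacent e, ‖gradAt (u K) x‖) ^ 2 ≤
      c * ∑ K ∈ T.adjacent e, ‖gradAt (u K) x‖ ^ 2 := sq_sum_le_card_mul_sum_sq
  rcases Nat.eq_zero_or_pos (T.adjacent e).card with h0 | h0
  · rw [hc, h0]; simp only [Nat.cast_zero, _root_.inv_zero]
    rw [zero_pow two_ne_zero, zero_mul]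
    positivity
  · have hc1 : 1 ≤ c := by rw [hc]; exact_mod_cast h0
    calc c⁻¹ ^ 2 * (a ^ 2 * (∑ K ∈ T.adjacent e, ‖gradAt (u K) x‖) ^ 2)
        ≤ c⁻¹ ^ 2 * (a ^ 2 * (c * ∑ K ∈ T.adjacent e, ‖gradAt (u K) x‖ ^ 2)) := by gcongr
      _ = c⁻¹ * (a ^ 2 * ∑ K ∈ T.adjacent e, ‖gradAt (u K) x‖ ^ 2) := by
          field_simp
      _ ≤ 1 * (a ^ 2 * ∑ K ∈ T.adjacent e, ‖gradAt (u K) x‖ ^ 2) := by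
          refine mul_le_mul_of_nonneg_right (inv_le_one_of_one_le₀ hc1) (by positivity)
      _ = _ := one_mul _

end Bounds

end Triangulation

/-! ### Bounds for the separate terms of the form. -/

open Triangulation

variable {n : ℕ} {Cσ : ℝ}

lemma exists_gradSq_le (m : ℕ) (hCσ : 0 < Cσ) :
    ∃ C : ℝ, 0 < C ∧ ∀ (Ω : Set (EuclideanSpace ℝ (Fin (n + 1)))) (T : Triangulation Ω),
      T.QuasiUniform Cσ → ∀ u : T.Elem → MvPolynomial (Fin (n + 1)) ℝ,
      (∀ K, u K ∈ PolySpace (n + 1) m) → T.gradSq u ≤ C * (T.meshSize ^ 2)⁻¹ * T.l2Sq u := by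
  obtain ⟨C, hC, hinv⟩ := exists_inverse_estimate_gradAt (n + 1) m (by omega) hCσ
  set ω := volume.real (Metric.closedBall (0 : EuclideanSpace ℝ (Fin (n + 1))) 1) with hω
  have hω0 : 0 < ω := volume_unitBall_pos (n + 1)
  refine ⟨C * ω, by positivity, fun Ω T hT u hu => ?_⟩
  rw [l2Sq, Finset.mul_sum]
  refine Finset.sum_le_sum fun K _ => ?_
  have : Nonempty T.Elem := ⟨K⟩
  have hh := T.meshSize_pos (by omega)
  have hI := integral_sq_nonneg K.1 (u K)
  refine (setIntegral_mono_on (integrableOn_elem (continuous_norm_gradAt_sq _))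
    (integrableOn_elem continuous_const) (measurableSet_simplex _)
    (hinv Ω T hT K (u K) (hu K))).trans ?_
  rw [setIntegral_const, smul_eq_mul]
  refine (mul_le_mul_of_nonneg_right (volume_simplex_le (by omega) K) (by positivity)).trans
    (le_of_eq ?_)
  rw [← hω, pow_add _ (n + 1) 2]
  field_simp

lemma exists_jumpSq_le (hn : 1 ≤ n) (m : ℕ) (hCσ : 0 < Cσ) :
    ∃ C : ℝ, 0 < C ∧ ∀ (Ω : Set (EuclideanSpace ℝ (Fin (n + 1)))) (T : Triangulation Ω),
      T.QuasiUniform Cσ → ∀ u : T.Elem → MvPolynomial (Fin (n + 1)) ℝ,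
      (∀ K, u K ∈ PolySpace (n + 1) m) → T.jumpSq u ≤ C * (T.meshSize ^ 2)⁻¹ * T.l2Sq u := by
  obtain ⟨C, hC, hinv⟩ := exists_inverse_estimate (n + 1) m (by omega) hCσ
  set ω := volume.real (Metric.closedBall (0 : EuclideanSpace ℝ (Fin n)) 1) with hω
  have hω0 : 0 < ω := volume_unitBall_pos n
  refine ⟨2 * Cσ * C * ω * (n + 2), by positivity, fun Ω T hT u hu => ?_⟩
  set I := fun K : T.Elem => ∫ x in simplex K.1, evalAt (u K) x ^ 2 with hI
  have hI0 : ∀ K, 0 ≤ I K := fun K => integral_sq_nonneg _ _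
  have hface : ∀ e ∈ T.meshFaces,
      ∫ x in simplex e, (Metric.diam (simplex e))⁻¹ * ‖T.jump u e x‖ ^ 2 ∂μHE[n] ≤
        2 * Cσ * C * ω * (T.meshSize ^ 2)⁻¹ * ∑ K ∈ T.adjacent e, I K := by
    intro e he
    obtain ⟨K₀, hK₀⟩ := exists_mem_adjacent he
    have : Nonempty T.Elem := ⟨K₀⟩
    have hh := T.meshSize_pos (by omega)
    have hq := hT.le_diam_face (by omega) hCσ (T.mem_meshFaces.1 he).2 hK₀
    have hS : 0 ≤ ∑ K ∈ T.adjacent e, I K := Finset.sum_nonneg fun K _ => hI0 K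
    refine (face_integral_le he (continuous_const.mul ((continuous_jump u e).norm.pow 2))
      (B := (T.meshSize / Cσ)⁻¹ * (2 * (C * (T.meshSize ^ (n + 1))⁻¹ *
        ∑ K ∈ T.adjacent e, I K))) (by positivity) fun x hx => ?_).trans (le_of_eq ?_)
    · refine mul_le_mul (inv_anti₀ (by positivity) hq) ((norm_jump_sq_le he u x).trans ?_)
        (sq_nonneg _) (by positivity)
      rw [Finset.mul_sum (T.adjacent e) I]
      refine mul_le_mul_of_nonneg_left (Finset.sum_le_sum fun K hK => ?_) zero_le_two
      exact hinv Ω T hT K (u K) (hu K) x (simplex_mono (T.mem_adjacent.1 hK) hx)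
    · rw [← hω, pow_succ]
      field_simp
  refine (Finset.sum_le_sum hface).trans (le_of_eq ?_)
  rw [← Finset.mul_sum, sum_meshFaces_adjacent_const]
  change _ * ((n + 2) * T.l2Sq u) = _
  ring

/-- Weighting the flux by h_e and the jump by its inverse makes the estimate scale-invariant: h from
the weight, hⁿ from the face and h^{-(n+1)} from the inverse estimate for the gradient cancel. The
parameter ε stays free so that coercivity can absorb the gradient part. -/
lemma exists_abs_fluxTerm_le (hn : 1 ≤ n) (m : ℕ) (hCσ : 0 < Cσ)
    (A : Matrix (Fin (n + 1)) (Fin (n + 1)) ℝ) :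
    ∃ C : ℝ, 0 < C ∧ ∀ (Ω : Set (EuclideanSpace ℝ (Fin (n + 1)))) (T : Triangulation Ω),
      T.QuasiUniform Cσ → ∀ u v : T.Elem → MvPolynomial (Fin (n + 1)) ℝ,
      (∀ K, u K ∈ PolySpace (n + 1) m) → ∀ ε : ℝ, 0 < ε →
      |T.fluxTerm A u v| ≤ ε * C * T.gradSq u + (4 * ε)⁻¹ * T.jumpSq v := by
  obtain ⟨C, hC, hinv⟩ := exists_inverse_estimate_gradAt_gradAt (n + 1) m (by omega) hCσ
  set ω := volume.real (Metric.closedBall (0 : EuclideanSpace ℝ (Fin n)) 1) with hω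
  have hω0 : 0 < ω := volume_unitBall_pos n
  set a := ‖Matrix.toEuclideanCLM (𝕜 := ℝ) A‖ with ha
  have ha0 : 0 ≤ a := norm_nonneg _
  refine ⟨(a ^ 2 * C * ω + 1) * (n + 2), by positivity, fun Ω T hT u v hu ε hε => ?_⟩
  set G := fun K : T.Elem => ∫ x in simplex K.1, ‖gradAt (u K) x‖ ^ 2 with hG
  have hG0 : ∀ K, 0 ≤ G K := fun K => integral_gradAt_sq_nonneg _ _
  have hface : ∀ e ∈ T.meshFaces,
      |∫ x in simplex e, inner ℝ (T.fluxAverage A u e x) (T.jump v e x) ∂μHE[n]| ≤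
        ε * (a ^ 2 * C * ω + 1) * (∑ K ∈ T.adjacent e, G K) +
        (4 * ε)⁻¹ * ∫ x in simplex e, (Metric.diam (simplex e))⁻¹ * ‖T.jump v e x‖ ^ 2 ∂μHE[n] := by
    intro e he
    obtain ⟨K₀, hK₀⟩ := exists_mem_adjacent he
    have : Nonempty T.Elem := ⟨K₀⟩
    have htop := hausdorff_face_ne_top he
    set h := T.meshSize with hhd
    have hh : 0 < h := T.meshSize_pos (by omega)
    set q := Metric.diam (simplex e) with hqd
    have hq0 : 0 < q := lt_of_lt_of_le (by positivity)
      (hT.le_diam_face (by omega) hCσ (T.mem_meshFaces.1 he).2 hK₀)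
    have hqh : q ≤ h := diam_face_le hK₀
    have hS : 0 ≤ ∑ K ∈ T.adjacent e, G K := Finset.sum_nonneg fun K _ => hG0 K
    have hF := continuous_fluxAverage A u e
    have hJ := continuous_jump v e
    have hc1 : Continuous fun x => |(inner ℝ (T.fluxAverage A u e x) (T.jump v e x) : ℝ)| := by
      fun_prop
    have hc2 : Continuous fun x => q * ‖T.fluxAverage A u e x‖ ^ 2 := by fun_prop
    have hc3 : Continuous fun x => q⁻¹ * ‖T.jump v e x‖ ^ 2 := by fun_prop
    have i2 : IntegrableOn (fun x => ε * (q * ‖T.fluxAverage A u e x‖ ^ 2)) (simplex e) μHE[n] :=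
      integrableOn_simplex_of_continuous htop (continuous_const.mul hc2)
    have i3 : IntegrableOn (fun x => (4 * ε)⁻¹ * (q⁻¹ * ‖T.jump v e x‖ ^ 2)) (simplex e) μHE[n] :=
      integrableOn_simplex_of_continuous htop (continuous_const.mul hc3)
    have h2 : ∫ x in simplex e, q * ‖T.fluxAverage A u e x‖ ^ 2 ∂μHE[n] ≤
        a ^ 2 * C * ω * ∑ K ∈ T.adjacent e, G K := by
      refine (face_integral_le he hc2 (B := h * (a ^ 2 * (C * (h ^ (n + 1))⁻¹ *
        ∑ K ∈ T.adjacent e, G K))) (by positivity) fun x hx => ?_).trans (le_of_eq ?_)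
      · refine mul_le_mul hqh ((norm_fluxAverage_sq_le A e u x).trans ?_) (sq_nonneg _) hh.le
        rw [Finset.mul_sum (T.adjacent e) G]
        refine mul_le_mul_of_nonneg_left (Finset.sum_le_sum fun K hK => ?_) (sq_nonneg _)
        exact hinv Ω T hT K (u K) (hu K) x (simplex_mono (T.mem_adjacent.1 hK) hx)
      · rw [← hω, ← hhd]
        field_simp
        ring
    calc _ ≤ ∫ x in simplex e, |(inner ℝ (T.fluxAverage A u e x) (T.jump v e x) : ℝ)| ∂μHE[n] :=
          abs_integral_le_integral_abs
      _ ≤ ∫ x in simplex e, (ε * (q * ‖T.fluxAverage A u e x‖ ^ 2) +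
          (4 * ε)⁻¹ * (q⁻¹ * ‖T.jump v e x‖ ^ 2)) ∂μHE[n] := by
          refine setIntegral_mono_on (integrableOn_simplex_of_continuous htop hc1)
            (i2.add i3) (measurableSet_simplex e) fun x _ => ?_
          refine (abs_real_inner_le_norm _ _).trans ?_
          set f := ‖T.fluxAverage A u e x‖
          set j := ‖T.jump v e x‖
          have h4 : ε * (q * f ^ 2) + (4 * ε)⁻¹ * (q⁻¹ * j ^ 2) - f * j =
              (2 * ε * q * f - j) ^ 2 / (4 * ε * q) := by
            field_simp; ring
          have h5 : 0 ≤ (2 * ε * q * f - j) ^ 2 / (4 * ε * q) := by positivity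
          linarith
      _ = ε * (∫ x in simplex e, q * ‖T.fluxAverage A u e x‖ ^ 2 ∂μHE[n]) +
          (4 * ε)⁻¹ * ∫ x in simplex e, q⁻¹ * ‖T.jump v e x‖ ^ 2 ∂μHE[n] := by
          rw [integral_add i2 i3, integral_const_mul ε, integral_const_mul (4 * ε)⁻¹]
      _ ≤ _ := by
          rw [mul_assoc ε]
          gcongr
          refine h2.trans (mul_le_mul_of_nonneg_right (by linarith) hS)
  refine (Finset.abs_sum_le_sum_abs _ _).trans ((Finset.sum_le_sum hface).trans (le_of_eq ?_))
  rw [Finset.sum_add_distrib, ← Finset.mul_sum, ← Finset.mul_sum, sum_meshFaces_adjacent_const]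
  change ε * _ * ((n + 2) * T.gradSq u) + _ * T.jumpSq v = _
  ring

lemma le_cellTerm {Ω : Set (EuclideanSpace ℝ (Fin (n + 1)))} (T : Triangulation Ω)
    {A : Matrix (Fin (n + 1)) (Fin (n + 1)) ℝ} {α : ℝ}
    (hα : ∀ x, α * ‖x‖ ^ 2 ≤ inner ℝ (Matrix.toEuclideanCLM (𝕜 := ℝ) A x) x)
    (u : T.Elem → MvPolynomial (Fin (n + 1)) ℝ) : α * T.gradSq u ≤ T.cellTerm A u u := by
  rw [gradSq, Finset.mul_sum]
  refine Finset.sum_le_sum fun K _ => ?_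
  rw [← integral_const_mul]
  refine integral_mono (integrableOn_elem (continuous_const.mul (continuous_norm_gradAt_sq _)))
    (integrableOn_elem ?_) fun x => hα _
  exact (continuous_fluxLin A K u).inner (continuous_gradAt (u K))

lemma abs_cellTerm_le {Ω : Set (EuclideanSpace ℝ (Fin (n + 1)))} (T : Triangulation Ω)
    (A : Matrix (Fin (n + 1)) (Fin (n + 1)) ℝ) (u v : T.Elem → MvPolynomial (Fin (n + 1)) ℝ) :
    |T.cellTerm A u v| ≤ ‖Matrix.toEuclideanCLM (𝕜 := ℝ) A‖ * (T.gradSq u + T.gradSq v) := by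
  set a := ‖Matrix.toEuclideanCLM (𝕜 := ℝ) A‖ with ha
  rw [gradSq, gradSq, ← Finset.sum_add_distrib, Finset.mul_sum]
  refine (Finset.abs_sum_le_sum_abs _ _).trans (Finset.sum_le_sum fun K _ => ?_)
  have hc := (continuous_fluxLin A K u).inner (𝕜 := ℝ) (continuous_gradAt (v K))
  have hu := integrableOn_elem (K := K.1) (continuous_norm_gradAt_sq (u K))
  have hv := integrableOn_elem (K := K.1) (continuous_norm_gradAt_sq (v K))
  rw [← integral_add hu hv, ← integral_const_mul]
  refine abs_integral_le_integral_abs.trans ?_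
  refine integral_mono (integrableOn_elem hc.abs) ((hu.add hv).const_mul a) fun x => ?_
  refine (abs_real_inner_le_norm _ _).trans ?_
  refine (mul_le_mul_of_nonneg_right (ContinuousLinearMap.le_opNorm _ _) (norm_nonneg _)).trans ?_
  have h1 : ‖gradAt (u K) x‖ * ‖gradAt (v K) x‖ ≤
      ‖gradAt (u K) x‖ ^ 2 + ‖gradAt (v K) x‖ ^ 2 := by
    nlinarith [sq_nonneg (‖gradAt (u K) x‖ - ‖gradAt (v K) x‖),
      sq_nonneg ‖gradAt (u K) x‖, sq_nonneg ‖gradAt (v K) x‖]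
  rw [mul_assoc]
  exact mul_le_mul_of_nonneg_left h1 (norm_nonneg _)

lemma penaltyTerm_self {Ω : Set (EuclideanSpace ℝ (Fin (n + 1)))} (T : Triangulation Ω) (μ : ℝ)
    (u : T.Elem → MvPolynomial (Fin (n + 1)) ℝ) : T.penaltyTerm μ u u = μ * T.jumpSq u := by
  rw [jumpSq, Finset.mul_sum]
  refine Finset.sum_congr rfl fun e _ => ?_
  rw [← integral_const_mul]
  simp only [real_inner_self_eq_norm_sq, mul_assoc]

lemma abs_penaltyTerm_le {Ω : Set (EuclideanSpace ℝ (Fin (n + 1)))} (T : Triangulation Ω) (μ : ℝ)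
    (u v : T.Elem → MvPolynomial (Fin (n + 1)) ℝ) :
    |T.penaltyTerm μ u v| ≤ |μ| * (T.jumpSq u + T.jumpSq v) := by
  rw [jumpSq, jumpSq, ← Finset.sum_add_distrib, Finset.mul_sum]
  refine (Finset.abs_sum_le_sum_abs _ _).trans (Finset.sum_le_sum fun e he => ?_)
  have htop := hausdorff_face_ne_top he
  have hJu := continuous_jump u e
  have hJv := continuous_jump v e
  set q := Metric.diam (simplex e) with hq
  have hq0 : 0 ≤ q⁻¹ := inv_nonneg.2 Metric.diam_nonneg
  have i1 : IntegrableOn (fun x => |μ * q⁻¹ * (inner ℝ (T.jump u e x) (T.jump v e x) : ℝ)|)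
      (simplex e) μHE[n] := integrableOn_simplex_of_continuous htop (by fun_prop)
  have i2 : IntegrableOn (fun x => q⁻¹ * ‖T.jump u e x‖ ^ 2) (simplex e) μHE[n] :=
    integrableOn_simplex_of_continuous htop (by fun_prop)
  have i3 : IntegrableOn (fun x => q⁻¹ * ‖T.jump v e x‖ ^ 2) (simplex e) μHE[n] :=
    integrableOn_simplex_of_continuous htop (by fun_prop)
  rw [← integral_add i2 i3, ← integral_const_mul]
  refine abs_integral_le_integral_abs.trans (integral_mono i1 ((i2.add i3).const_mul _) fun x => ?_)
  change |μ * q⁻¹ * (inner ℝ (T.jump u e x) (T.jump v e x) : ℝ)| ≤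
    |μ| * (q⁻¹ * ‖T.jump u e x‖ ^ 2 + q⁻¹ * ‖T.jump v e x‖ ^ 2)
  rw [abs_mul, abs_mul, abs_of_nonneg hq0, mul_assoc, ← mul_add]
  refine mul_le_mul_of_nonneg_left (mul_le_mul_of_nonneg_left
    ((abs_real_inner_le_norm _ _).trans ?_) hq0) (abs_nonneg _)
  nlinarith [sq_nonneg (‖T.jump u e x‖ - ‖T.jump v e x‖),
      sq_nonneg ‖T.jump u e x‖, sq_nonneg ‖T.jump v e x‖]

/-! ### Boundedness, coercivity and the condition number estimate. -/

open Triangulation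

variable {n : ℕ} {Cσ : ℝ}

/-- The interior penalty form is bounded in terms of `h⁻²` times the squared `L²` norms. -/
lemma exists_abs_ipForm_le (hn : 1 ≤ n) (m : ℕ) (hCσ : 0 < Cσ)
    (A : Matrix (Fin (n + 1)) (Fin (n + 1)) ℝ) (μ : ℝ) {θ : ℝ} (hθ : |θ| ≤ 1) :
    ∃ C : ℝ, 0 < C ∧ ∀ (Ω : Set (EuclideanSpace ℝ (Fin (n + 1)))) (T : Triangulation Ω),
      T.QuasiUniform Cσ → ∀ u v : T.Elem → MvPolynomial (Fin (n + 1)) ℝ,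
      (∀ K, u K ∈ PolySpace (n + 1) m) → (∀ K, v K ∈ PolySpace (n + 1) m) →
      |T.ipForm A μ θ u v| ≤ C * (T.meshSize ^ 2)⁻¹ * (T.l2Sq u + T.l2Sq v) := by
  obtain ⟨C₁, hC₁, hgrad⟩ := exists_gradSq_le (n := n) m hCσ
  obtain ⟨C₂, hC₂, hjump⟩ := exists_jumpSq_le hn m hCσ
  obtain ⟨C₃, hC₃, hflux⟩ := exists_abs_fluxTerm_le hn m hCσ A
  set a := ‖Matrix.toEuclideanCLM (𝕜 := ℝ) A‖ with ha
  have ha0 : 0 ≤ a := norm_nonneg _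
  refine ⟨(a + C₃) * C₁ + (1 + |μ|) * C₂, by positivity, fun Ω T hT u v hu hv => ?_⟩
  have h1 := abs_cellTerm_le T A u v
  have h2 := hflux Ω T hT u v hu 1 one_pos
  have h3 := hflux Ω T hT v u hv 1 one_pos
  have h4 := abs_penaltyTerm_le T μ u v
  have h5 : |θ * T.fluxTerm A v u| ≤ |T.fluxTerm A v u| := by
    rw [abs_mul]
    exact mul_le_of_le_one_left (abs_nonneg _) hθ
  have hJu := (jumpSq_nonneg : 0 ≤ T.jumpSq u)
  have hJv := (jumpSq_nonneg : 0 ≤ T.jumpSq v)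
  have h6 : |T.ipForm A μ θ u v| ≤
      (a + C₃) * (T.gradSq u + T.gradSq v) + (1 + |μ|) * (T.jumpSq u + T.jumpSq v) := by
    rw [ipForm_eq]
    refine (abs_add_le _ _).trans ?_
    refine (add_le_add_left ((abs_add_le _ _).trans (add_le_add_left (abs_sub _ _) _)) _).trans ?_
    linarith
  refine h6.trans ?_
  have h7 := mul_le_mul_of_nonneg_left (add_le_add (hgrad Ω T hT u hu) (hgrad Ω T hT v hv))
    (by positivity : 0 ≤ a + C₃)
  have h8 := mul_le_mul_of_nonneg_left (add_le_add (hjump Ω T hT u hu) (hjump Ω T hT v hv))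
    (by positivity : 0 ≤ 1 + |μ|)
  refine (add_le_add h7 h8).trans (le_of_eq ?_)
  ring

/-- For θ = 1 the two flux terms cancel when both arguments agree, so any positive penalty suffices
for coercivity. -/
lemma le_ipForm_one {Ω : Set (EuclideanSpace ℝ (Fin (n + 1)))} (T : Triangulation Ω)
    {A : Matrix (Fin (n + 1)) (Fin (n + 1)) ℝ} {α μ : ℝ}
    (hα : ∀ x, α * ‖x‖ ^ 2 ≤ inner ℝ (Matrix.toEuclideanCLM (𝕜 := ℝ) A x) x)
    (u : T.Elem → MvPolynomial (Fin (n + 1)) ℝ) :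
    min α μ * (T.gradSq u + T.jumpSq u) ≤ T.ipForm A μ 1 u u := by
  rw [ipForm_eq, penaltyTerm_self, mul_add]
  have h1 := le_cellTerm T hα u
  have h2 := mul_le_mul_of_nonneg_right (min_le_left α μ) (gradSq_nonneg : 0 ≤ T.gradSq u)
  have h3 := mul_le_mul_of_nonneg_right (min_le_right α μ) (jumpSq_nonneg : 0 ≤ T.jumpSq u)
  linarith

/-- Coercivity of the symmetric interior penalty form for large penalties. -/
lemma exists_le_ipForm_neg_one (hn : 1 ≤ n) (m : ℕ) (hCσ : 0 < Cσ)
    {A : Matrix (Fin (n + 1)) (Fin (n + 1)) ℝ} {α : ℝ} (hα0 : 0 < α)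
    (hα : ∀ x, α * ‖x‖ ^ 2 ≤ inner ℝ (Matrix.toEuclideanCLM (𝕜 := ℝ) A x) x) :
    ∃ μ₀ : ℝ, 0 < μ₀ ∧ ∀ μ, μ₀ ≤ μ → ∀ (Ω : Set (EuclideanSpace ℝ (Fin (n + 1))))
      (T : Triangulation Ω), T.QuasiUniform Cσ → ∀ u : T.Elem → MvPolynomial (Fin (n + 1)) ℝ,
      (∀ K, u K ∈ PolySpace (n + 1) m) →
      min (α / 2) 1 * (T.gradSq u + T.jumpSq u) ≤ T.ipForm A μ (-1) u u := by
  obtain ⟨C, hC, hflux⟩ := exists_abs_fluxTerm_le hn m hCσ A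
  -- With this ε the two equal flux terms cost α/2 of the gradient part; the threshold for μ pays
  -- for their jump part and leaves coefficient 1.
  have hε : 0 < α / (4 * C) := by positivity
  refine ⟨2 * (4 * (α / (4 * C)))⁻¹ + 1, by positivity, fun μ hμ Ω T hT u hu => ?_⟩
  have hf := (abs_le.1 (hflux Ω T hT u u hu _ hε)).2
  have h0 : α / (4 * C) * C = α / 4 := by field_simp
  rw [h0] at hf
  rw [ipForm_eq, penaltyTerm_self, mul_add]
  have h1 := le_cellTerm T hα u
  have h2 := mul_le_mul_of_nonneg_right (min_le_left (α / 2) 1) (gradSq_nonneg : 0 ≤ T.gradSq u)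
  have h3 := mul_le_mul_of_nonneg_right (min_le_right (α / 2) 1) (jumpSq_nonneg : 0 ≤ T.jumpSq u)
  have h4 := mul_le_mul_of_nonneg_right hμ (jumpSq_nonneg : 0 ≤ T.jumpSq u)
  linarith

/-- Coercivity of the interior penalty form in the energy norm implies the condition number
estimate. -/
lemma exists_condNumber_stiffnessMatrix_le (hn : 1 ≤ n)
    {Ω : Set (EuclideanSpace ℝ (Fin (n + 1)))} (hΩ : IsConvexPolytopalDomain Ω) (m N : ℕ)
    (hCσ : 0 < Cσ) (A : Matrix (Fin (n + 1)) (Fin (n + 1)) ℝ) (μ : ℝ) {θ γ : ℝ} (hθ : |θ| ≤ 1)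
    (hγ : 0 < γ)
    (hcoer : ∀ T : Triangulation Ω, T.QuasiUniform Cσ →
      ∀ u : T.Elem → MvPolynomial (Fin (n + 1)) ℝ, (∀ K, u K ∈ PolySpace (n + 1) m) →
        γ * (T.gradSq u + T.jumpSq u) ≤ T.ipForm A μ θ u u) :
    ∃ C : ℝ, 0 < C ∧ ∀ T : Triangulation Ω, T.QuasiUniform Cσ → T.Unisolvent m N →
      IsUnit (T.stiffnessMatrix m N A μ θ) ∧ condNumber (T.stiffnessMatrix m N A μ θ) ≤
        C * T.lebesgueConst m N ^ 2 * (T.meshSize ^ 2)⁻¹ := by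
  obtain ⟨P, hP, hpoin⟩ := exists_poincare hn hΩ m hCσ
  obtain ⟨c, hc, hlow⟩ := exists_le_l2Sq_combine (n := n) m hCσ
  obtain ⟨C₁, hC₁, hup⟩ := exists_l2Sq_combine_le (n := n) m N hCσ
  obtain ⟨C₂, hC₂, hform⟩ := exists_abs_ipForm_le hn m hCσ A μ hθ
  -- This is 2B/β for the bounds `hcoer'` and `hbdd`, without Λ² and h^{-2}; the factors h^{n+1} in
  -- B and β cancel.
  refine ⟨2 * (C₂ * C₁) * P / (γ * c), by positivity, fun T hT hU => ?_⟩
  have := T.nonempty_elem hΩ.nonempty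
  have hh : 0 < T.meshSize := T.meshSize_pos (by omega)
  set h := T.meshSize with hhd
  set Λ := T.lebesgueConst m N with hΛ
  have hcoer' : ∀ v : T.Elem → ℝ, γ / P * (c * h ^ (n + 1)) * (v ⬝ᵥ v) ≤
      v ⬝ᵥ (T.stiffnessMatrix m N A μ θ *ᵥ v) := by
    intro v
    rw [dotProduct_stiffnessMatrix]
    have hmem := fun K => T.combine_mem (m := m) (N := N) v K
    refine le_trans ?_ (hcoer T hT _ hmem)
    have h1 := (hlow Ω T hT N v).trans (hpoin T hT _ hmem)
    calc γ / P * (c * h ^ (n + 1)) * (v ⬝ᵥ v) = γ / P * (c * h ^ (n + 1) * (v ⬝ᵥ v)) := by ring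
      _ ≤ γ / P * (P * (T.gradSq (T.combine m N v) + T.jumpSq (T.combine m N v))) :=
          mul_le_mul_of_nonneg_left h1 (by positivity)
      _ = _ := by field_simp
  have hbdd : ∀ w v : T.Elem → ℝ, w ⬝ᵥ (T.stiffnessMatrix m N A μ θ *ᵥ v) ≤
      C₂ * (h ^ 2)⁻¹ * (C₁ * Λ ^ 2 * h ^ (n + 1)) * (w ⬝ᵥ w + v ⬝ᵥ v) := by
    intro w v
    rw [dotProduct_stiffnessMatrix]
    refine (le_abs_self _).trans ((hform Ω T hT _ _ (T.combine_mem w) (T.combine_mem v)).trans ?_)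
    rw [mul_assoc _ (C₁ * Λ ^ 2 * h ^ (n + 1)), mul_add (C₁ * Λ ^ 2 * h ^ (n + 1))]
    exact mul_le_mul_of_nonneg_left (add_le_add (hup Ω T hT hU w) (hup Ω T hT hU v))
      (by positivity)
  obtain ⟨hu, hκ⟩ := isUnit_and_condNumber_le (by positivity) (by positivity) hcoer' hbdd
  refine ⟨hu, hκ.trans (le_of_eq ?_)⟩
  field_simp

end RDA

theorem mainTheorem4 (d : ℕ) (hd : d = 2 ∨ d = 3) (Ω : Set (EuclideanSpace ℝ (Fin d)))
    (hΩ : RDA.IsConvexPolytopalDomain Ω)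
    (m : ℕ) (hm : 1 ≤ m) (Cσ : ℝ) (hCσ : 0 < Cσ) :
    -- two-sided bounds for the mass matrix
    (∀ N : ℕ, ∃ c : ℝ, 0 < c ∧ ∃ C : ℝ, 0 < C ∧ ∀ T : RDA.Triangulation Ω,
      T.QuasiUniform Cσ → T.Unisolvent m N →
      ∀ v : T.Elem → ℝ,
        c * T.meshSize ^ d * (v ⬝ᵥ v) ≤ v ⬝ᵥ (T.massMatrix m N *ᵥ v) ∧
        v ⬝ᵥ (T.massMatrix m N *ᵥ v) ≤ C * T.lebesgueConst m N ^ 2 * T.meshSize ^ d * (v ⬝ᵥ v)) ∧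
    (∀ A : Matrix (Fin d) (Fin d) ℝ, A.PosDef →
    -- symmetric method: all sufficiently large penalties
    (∃ μ₀ : ℝ, 0 < μ₀ ∧ ∀ μ : ℝ, μ₀ ≤ μ →
      ∀ N : ℕ, ∃ C : ℝ, 0 < C ∧ ∀ T : RDA.Triangulation Ω,
      T.QuasiUniform Cσ → T.Unisolvent m N →
        IsUnit (T.stiffnessMatrix m N A μ (-1)) ∧
        RDA.condNumber (T.stiffnessMatrix m N A μ (-1)) ≤
          C * T.lebesgueConst m N ^ 2 * (T.meshSize ^ 2)⁻¹) ∧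
    -- nonsymmetric method: all positive penalties
    (∀ μ : ℝ, 0 < μ → ∀ N : ℕ, ∃ C : ℝ, 0 < C ∧ ∀ T : RDA.Triangulation Ω,
      T.QuasiUniform Cσ → T.Unisolvent m N →
        IsUnit (T.stiffnessMatrix m N A μ 1) ∧
        RDA.condNumber (T.stiffnessMatrix m N A μ 1) ≤
          C * T.lebesgueConst m N ^ 2 * (T.meshSize ^ 2)⁻¹)) := by
  -- Slicing needs a first coordinate, and n ≥ 1 ensures that a face has two distinct vertices,
  -- hence a diameter bounded below.
  obtain ⟨n, hn, rfl⟩ : ∃ n, 1 ≤ n ∧ d = n + 1 := ⟨d - 1, by omega, by omega⟩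
  refine ⟨fun N => ?_, fun A hA => ?_⟩
  · obtain ⟨c, hc, hlow⟩ := RDA.Triangulation.exists_le_l2Sq_combine (n := n) m hCσ
    obtain ⟨C, hC, hup⟩ := RDA.Triangulation.exists_l2Sq_combine_le (n := n) m N hCσ
    refine ⟨c, hc, C, hC, fun T hT hU v => ?_⟩
    rw [RDA.Triangulation.dotProduct_massMatrix]
    exact ⟨hlow Ω T hT N v, hup Ω T hT hU v⟩
  · obtain ⟨α, hα0, hα⟩ := RDA.exists_coercive_of_posDef hA
    refine ⟨?_, fun μ hμ N => ?_⟩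
    · obtain ⟨μ₀, hμ₀, hcoer⟩ := RDA.exists_le_ipForm_neg_one hn m hCσ hα0 hα
      exact ⟨μ₀, hμ₀, fun μ hμ N => RDA.exists_condNumber_stiffnessMatrix_le hn hΩ m N hCσ A μ
        (by norm_num) (lt_min (half_pos hα0) one_pos) (hcoer μ hμ Ω)⟩
    · exact RDA.exists_condNumber_stiffnessMatrix_le hn hΩ m N hCσ A μ (by norm_num)
        (lt_min hα0 hμ) fun T _ u _ => RDA.le_ipForm_one T hα u
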